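/- Let $X,Z$ be topological spaces (for instance connected CW-complexes), $Y\subset Z$ a subset and $f:X\to Z$ a continuous map. For $p\ge 0$ let $\Omega_p(A)$ denote the oriented bordism group of a space $A$: bordism classes of closed oriented smooth $p$-manifolds $S$ with a map $s:S\to A$, with disjoint union as addition. Put $C=f^{-1}(Y)$. Call $s_0:S_0\to C$ and $s_1:S_1\to C$ Nielsen equivalent, $s_0\sim_N s_1$, if there are a compact oriented $(p+1)$-manifold $W$ with $\partial W=S_0\sqcup -S_1$, a map $H:W\to X$ extending $s_0\sqcup s_1$, and a map $G:W\to Y$ extending $fs_0\sqcup fs_1$, such that $fH$ and $G$ are homotopic in $Z$ relative to $S_0\sqcup S_1$. Let $S'_p(f,Y)=\Omega_p(C)/{\sim_N}$. For a homotopy $F:[0,1]\times X\to Z$ with $F_0=f$, the inclusions $i_t:x\mapsto(t,x)$ induce homomorphisms $i_{t*}:S'_p(F_t,Y)\to S'_p(F,Y)$; let $M_p^F=\{s\in S'_p(f,Y): i_{0*}(s)\in \operatorname{Im} i_{0*}\cap\operatorname{Im} i_{1*}\}$. The Nielsen group of order $p$ is $S_p(f,Y)=\bigcap_F M_p^F$,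 the intersection over all homotopies $F$ of $f$, and the Nielsen number of order $p$ is $N_p(f,Y)=\operatorname{rank}S_p(f,Y)$. The rank of an abelian group is the (possibly infinite) cardinal number $\operatorname{rank}_{\mathbb Z}$, the supremum of the cardinalities of $\mathbb Z$-linearly independent subsets. The classical Nielsen number $N(f,Y)$ is defined as follows. Points $x,y\in C$ are equivalent if there are a path $\alpha$ in $X$ from $x$ to $y$ and a path $\beta$ in $Y$ from $f(x)$ to $f(y)$ such that $f\alpha$ and $\beta$ are homotopic in $Z$ relative to the end points; the equivalence classes are the Nielsen classes of $f$. A Nielsen class $N$ of $f$ is essential if for every homotopy $F$ of $f$ (with $F_0=f$) there is a Nielsen class $K\subset[0,1]\times X$ of $F$ whose $0$-section is $N$ and whose $1$-section is a Nielsen class of $F_1$. Then $N(f,Y)$ is the number of essential Nielsen classes of $f$. Then: (1) for every $p\ge 0$ and every $g:X\to Z$ homotopic to $f$, $N_p(f,Y)\le\operatorname{rank}\Omega_p(g^{-1}(Y))$; (2) $N_0(f,Y)=N(f,Y)$. -/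

import Mathlib

open scoped Manifold ContDiff Topology
open Set

noncomputable section

namespace HigherNielsen

section Orientation

variable {E H : Type*} [NormedAddCommGroup E] [NormedSpace ℝ E] [TopologicalSpace H]

/-- An orientation of a manifold `M`.  In Mathlib the tangent space of `M` at `x` is the model
vector space `E`, identified with the geometric tangent space by the preferred chart at `x`.  An
orientation is therefore a choice, for every `x`, of a sign saying whether this identification
preserves (`1`) or reverses (`-1`) orientation, such that the signs at nearby points are compatible:
they differ by the sign of the Jacobian determinant of the change of coordinates.  For
zero-dimensional `M` this is an arbitrary assignment of signs to the points. -/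
structure MOrientation (I : ModelWithCorners ℝ E H) (M : Type*) [TopologicalSpace M]
    [ChartedSpace H M] [IsManifold I ∞ M] where
  sign : M → ℤˣ
  coherent : ∀ x₀ : M, ∀ᶠ x in 𝓝 x₀,
    0 < (((sign x * sign x₀ : ℤˣ) : ℤ) : ℝ) *
      LinearMap.det (fderivWithin ℝ (extChartAt I x₀ ∘ (extChartAt I x).symm) (range I)
        (extChartAt I x x) : E →ₗ[ℝ] E)

/-- The Jacobian determinant at `x` of a map between manifolds with the same model, with respect to
the preferred charts at `x` and at `f x`. -/
def jac (I : ModelWithCorners ℝ E H) {M N : Type*} [TopologicalSpace M] [ChartedSpace H M]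
    [TopologicalSpace N] [ChartedSpace H N] (f : M → N) (x : M) : ℝ :=
  LinearMap.det ((show E →L[ℝ] E from mfderiv I I f x) : E →ₗ[ℝ] E)

variable {I : ModelWithCorners ℝ E H} {M N P : Type*}
    [TopologicalSpace M] [ChartedSpace H M]
    [TopologicalSpace N] [ChartedSpace H N]
    [TopologicalSpace P] [ChartedSpace H P]

theorem jac_congr {f g : M → N} {x : M} (h : f =ᶠ[𝓝 x] g) : jac I f x = jac I g x := by
  have : mfderiv I I f x = mfderiv I I g x := h.mfderiv_eq
  unfold jac
  exact congrArg (fun A : E →L[ℝ] E => LinearMap.det (A : E →ₗ[ℝ] E)) this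

theorem jac_comp {f : M → N} {g : N → P} {x : M} (hg : MDifferentiableAt I I g (f x))
    (hf : MDifferentiableAt I I f x) : jac I (g ∘ f) x = jac I g (f x) * jac I f x := by
  unfold jac
  rw [← LinearMap.det_comp]
  congr 1
  exact congrArg (fun A : E →L[ℝ] E => (A : E →ₗ[ℝ] E)) (mfderiv_comp x hg hf)

/-- `f` is, near `x`, the identity in the preferred charts at `x` and `f x`. -/
def ChartEq (H : Type*) [TopologicalSpace H] {M N : Type*} [TopologicalSpace M] [ChartedSpace H M]
    [TopologicalSpace N] [ChartedSpace H N] (f : M → N) (x : M) : Prop :=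
  ∀ᶠ x' in 𝓝 x, f x' ∈ (chartAt H (f x)).source ∧ chartAt H (f x) (f x') = chartAt H x x'

theorem ChartEq.eventuallyEq {f : M → N} {x : M} (h : ChartEq H f x) :
    f =ᶠ[𝓝 x] (chartAt H (f x)).symm ∘ chartAt H x := by
  filter_upwards [h] with y hy
  rw [Function.comp_apply, ← hy.2, (chartAt H (f x)).left_inv hy.1]

theorem ChartEq.continuousAt {f : M → N} {x : M} (h : ChartEq H f x) : ContinuousAt f x := by
  refine ContinuousAt.congr ?_ h.eventuallyEq.symm
  refine ContinuousAt.comp ?_ ((chartAt H x).continuousAt (mem_chart_source H x))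
  refine (chartAt H (f x)).symm.continuousAt ?_
  have h1 := h.self_of_nhds
  rw [← h1.2]
  exact (chartAt H (f x)).map_source h1.1

theorem ChartEq.hasMFDerivAt {f : M → N} {x : M} (h : ChartEq H f x) :
    HasMFDerivAt I I f x (ContinuousLinearMap.id ℝ E) := by
  refine ⟨h.continuousAt, ?_⟩
  have h1 : ∀ᶠ z in 𝓝[range I] (extChartAt I x x), writtenInExtChartAt I I x f z = z := by
    have h3 : Filter.Tendsto (extChartAt I x).symm (𝓝[range I] (extChartAt I x x)) (𝓝 x) := by
      have := (continuousAt_extChartAt_symm (I := I) x).tendsto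
      rw [extChartAt_to_inv] at this
      exact this.mono_left nhdsWithin_le_nhds
    have h2 := h3.eventually h
    filter_upwards [h2, extChartAt_target_mem_nhdsWithin (I := I) x] with z hz hz'
    simp only [writtenInExtChartAt, Function.comp_apply, extChartAt_coe, hz.2]
    have := (extChartAt I x).right_inv hz'
    simpa using this
  refine (hasFDerivWithinAt_id _ _).congr_of_eventuallyEq h1 ?_
  exact h1.self_of_nhdsWithin (extChartAt_target_subset_range x (mem_extChartAt_target x))

theorem ChartEq.isLocalDiffeomorphAt [IsManifold I ∞ M] [IsManifold I ∞ N]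
    {f : M → N} {x : M} (h : ChartEq H f x) : IsLocalDiffeomorphAt I I ∞ f x := by
  obtain ⟨U, hU, hUo, hxU⟩ := eventually_nhds_iff.1 h
  let φ := ((chartAt H x).restrOpen U hUo).trans (chartAt H (f x)).symm
  refine ⟨⟨φ.toPartialEquiv, φ.open_source, φ.open_target, ?_, ?_⟩, ?_, ?_⟩
  · refine (contMDiffOn_chart_symm (I := I) (x := f x)).comp
      ((contMDiffOn_chart (I := I) (x := x)).mono fun y hy => ?_) fun y hy => ?_
    · exact hy.1.1
    · exact hy.2
  · refine (contMDiffOn_chart_symm (I := I) (x := x)).comp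
      ((contMDiffOn_chart (I := I) (x := f x)).mono fun y hy => ?_) fun y hy => ?_
    · exact hy.1
    · exact hy.2.1
  · refine ⟨⟨mem_chart_source H x, hxU⟩, ?_⟩
    have h1 := hU x hxU
    change chartAt H x x ∈ (chartAt H (f x)).target
    rw [← h1.2]
    exact (chartAt H (f x)).map_source h1.1
  · intro y hy
    have h1 := hU y hy.1.2
    change f y = (chartAt H (f x)).symm (chartAt H x y)
    rw [← h1.2, (chartAt H (f x)).left_inv h1.1]

theorem ChartEq.jac {f : M → N} {x : M} (h : ChartEq H f x) : jac I f x = 1 := by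
  have : mfderiv I I f x = ContinuousLinearMap.id ℝ E := (h.hasMFDerivAt (I := I)).mfderiv
  unfold HigherNielsen.jac
  exact (congrArg (fun A : E →L[ℝ] E => LinearMap.det (A : E →ₗ[ℝ] E)) this).trans (by simp)

/-- The reversed orientation. -/
def MOrientation.neg [IsManifold I ∞ M] (o : MOrientation I M) : MOrientation I M where
  sign x := - o.sign x
  coherent x₀ := by simpa using o.coherent x₀

/-- The orientation of a disjoint union. -/
def MOrientation.sum [IsManifold I ∞ M] [IsManifold I ∞ N] (o : MOrientation I M)
    (o' : MOrientation I N) : MOrientation I (M ⊕ N) where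
  sign := Sum.elim o.sign o'.sign
  coherent := by
    rintro (x₀ | x₀)
    · rw [nhds_inl, Filter.eventually_map]
      filter_upwards [o.coherent x₀] with y hy
      have : extChartAt I (Sum.inl x₀ : M ⊕ N) ∘ (extChartAt I (Sum.inl y : M ⊕ N)).symm =
          extChartAt I x₀ ∘ (extChartAt I y).symm := by
        ext z
        simp [extChartAt, ChartedSpace.sum_chartAt_inl, Sum.inl_injective.extend_apply]
      rw [this, extChartAt_inl_apply]
      exact hy
    · rw [nhds_inr, Filter.eventually_map]
      filter_upwards [o'.coherent x₀] with y hy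
      have : extChartAt I (Sum.inr x₀ : M ⊕ N) ∘ (extChartAt I (Sum.inr y : M ⊕ N)).symm =
          extChartAt I x₀ ∘ (extChartAt I y).symm := by
        ext z
        simp [extChartAt, ChartedSpace.sum_chartAt_inr, Sum.inr_injective.extend_apply]
      rw [this, extChartAt_inr_apply]
      exact hy

theorem ChartEq.inl (x : M) : ChartEq H (Sum.inl : M → M ⊕ N) x := by
  filter_upwards [(chartAt H x).open_source.mem_nhds (mem_chart_source H x)] with y hy
  simp [ChartedSpace.sum_chartAt_inl, Sum.inl_injective.extend_apply, hy]

theorem ChartEq.inr (x : N) : ChartEq H (Sum.inr : N → M ⊕ N) x := by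
  filter_upwards [(chartAt H x).open_source.mem_nhds (mem_chart_source H x)] with y hy
  simp [ChartedSpace.sum_chartAt_inr, Sum.inr_injective.extend_apply, hy]

theorem ChartEq.elim_inl (x : M) : ChartEq H (Sum.elim id (fun _ => x) : M ⊕ N → M) (Sum.inl x) := by
  unfold ChartEq
  rw [nhds_inl, Filter.eventually_map]
  filter_upwards [(chartAt H x).open_source.mem_nhds (mem_chart_source H x)] with y hy
  simp [hy]

theorem ChartEq.elim_inr (x : N) : ChartEq H (Sum.elim (fun _ => x) id : M ⊕ N → N) (Sum.inr x) := by
  unfold ChartEq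
  rw [nhds_inr, Filter.eventually_map]
  filter_upwards [(chartAt H x).open_source.mem_nhds (mem_chart_source H x)] with y hy
  simp [hy]

theorem ChartEq.prod {K : Type*} [TopologicalSpace K] {f : M → N} {x : M} (hf : ChartEq H f x)
    (h : K) : ChartEq (ModelProd K H) (fun q : K × M => (q.1, f q.2)) (h, x) := by
  have h1 := (Filter.tendsto_snd (f := 𝓝 h) (g := 𝓝 x)).eventually hf
  rw [← nhds_prod_eq] at h1
  filter_upwards [h1] with q hq
  rw [prodChartedSpace_chartAt, prodChartedSpace_chartAt]
  exact ⟨⟨mem_univ q.1, hq.1⟩, Prod.ext rfl hq.2⟩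

/-- The product orientation. -/
def MOrientation.prod {E' H' : Type*} [NormedAddCommGroup E'] [NormedSpace ℝ E']
    [TopologicalSpace H'] [FiniteDimensional ℝ E] [FiniteDimensional ℝ E']
    {J : ModelWithCorners ℝ E' H'}
    {N : Type*} [TopologicalSpace N] [ChartedSpace H' N] [IsManifold I ∞ M] [IsManifold J ∞ N]
    (o : MOrientation I M) (o' : MOrientation J N) : MOrientation (I.prod J) (M × N) where
  sign x := o.sign x.1 * o'.sign x.2
  coherent := by
    rintro ⟨a, b⟩
    have : IsManifold I 1 M := .of_le (n := ∞) (by simp)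
    have : IsManifold J 1 N := .of_le (n := ∞) (by simp)
    have h1 := (o.coherent a).and (extChartAt_source_mem_nhds (I := I) a)
    have h2 := (o'.coherent b).and (extChartAt_source_mem_nhds (I := J) b)
    rw [nhds_prod_eq]
    filter_upwards [h1.prod_mk h2] with ⟨x, y⟩ ⟨⟨hx, hx'⟩, hy, hy'⟩
    have hdx := (hasFDerivWithinAt_tangentCoordChange (I := I)
      ⟨mem_extChartAt_source (I := I) x, hx'⟩)
    have hdy := (hasFDerivWithinAt_tangentCoordChange (I := J)
      ⟨mem_extChartAt_source (I := J) y, hy'⟩)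
    have hd := HasFDerivWithinAt.prodMap (p := (extChartAt I x x, extChartAt J y y))
      (s := range I ×ˢ range J)
      (hdx.mono (by rintro _ ⟨z, hz, rfl⟩; exact hz.1))
      (hdy.mono (by rintro _ ⟨z, hz, rfl⟩; exact hz.2))
    have hr : range (I.prod J) = range I ×ˢ range J := ModelWithCorners.range_prod
    have hf : fderivWithin ℝ (extChartAt (I.prod J) (a, b) ∘ (extChartAt (I.prod J) (x, y)).symm)
        (range (I.prod J)) (extChartAt (I.prod J) (x, y) (x, y)) =
        (tangentCoordChange I x a x).prodMap (tangentCoordChange J y b y) := by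
      rw [extChartAt_prod, extChartAt_prod, hr]
      refine HasFDerivWithinAt.fderivWithin hd ?_
      exact UniqueDiffWithinAt.prod
        (I.uniqueDiffOn _ (extChartAt_target_subset_range x (mem_extChartAt_target x)))
        (J.uniqueDiffOn _ (extChartAt_target_subset_range y (mem_extChartAt_target y)))
    rw [hf]
    have : LinearMap.det (((tangentCoordChange I x a x).prodMap
        (tangentCoordChange J y b y) : E × E' →L[ℝ] E × E') : E × E' →ₗ[ℝ] E × E') =
        LinearMap.det (tangentCoordChange I x a x : E →ₗ[ℝ] E) *
        LinearMap.det (tangentCoordChange J y b y : E' →ₗ[ℝ] E') :=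
      LinearMap.det_prodMap _ _
    rw [this]
    have := mul_pos hx hy
    simp only [tangentCoordChange_def] at this ⊢
    have hs : ∀ s t s' t' : ℤˣ, (((s * t * (s' * t') : ℤˣ) : ℤ) : ℝ) =
        (((s * s' : ℤˣ) : ℤ) : ℝ) * (((t * t' : ℤˣ) : ℤ) : ℝ) := by
      intros
      push_cast
      ring
    rw [hs, mul_mul_mul_comm]
    exact this

end Orientation

/-- The half-space `[0, ∞) × ℝᵖ`, on which `(p + 1)`-manifolds with boundary are modelled. -/
abbrev HalfModel (p : ℕ) := ModelProd (EuclideanHalfSpace 1) (EuclideanSpace ℝ (Fin p))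

/-- The inclusion of the half-space `[0, ∞) × ℝᵖ` into `ℝ × ℝᵖ`. -/
abbrev halfModel (p : ℕ) := (𝓡∂ 1).prod (𝓡 p)

/-- A closed oriented smooth `p`-manifold. -/
structure ClosedManifold (p : ℕ) where
  M : Type
  [top : TopologicalSpace M]
  [charted : ChartedSpace (EuclideanSpace ℝ (Fin p)) M]
  [smooth : IsManifold (𝓡 p) ∞ M]
  [compact : CompactSpace M]
  [t2 : T2Space M]
  orient : MOrientation (𝓡 p) M

namespace ClosedManifold

variable {p : ℕ}

instance (S : ClosedManifold p) : TopologicalSpace S.M := S.top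
instance (S : ClosedManifold p) : ChartedSpace (EuclideanSpace ℝ (Fin p)) S.M := S.charted
instance (S : ClosedManifold p) : IsManifold (𝓡 p) ∞ S.M := S.smooth
instance (S : ClosedManifold p) : CompactSpace S.M := S.compact
instance (S : ClosedManifold p) : T2Space S.M := S.t2

/-- The same manifold with the reversed orientation. -/
def neg (S : ClosedManifold p) : ClosedManifold p where
  M := S.M
  orient := S.orient.neg

/-- The disjoint union. -/
def sum (S T : ClosedManifold p) : ClosedManifold p where
  M := S.M ⊕ T.M
  orient := S.orient.sum T.orient

/-- The empty manifold. -/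
def empty (p : ℕ) : ClosedManifold p where
  M := Empty
  charted := ChartedSpace.empty _ _
  smooth := by
    let _ := ChartedSpace.empty (EuclideanSpace ℝ (Fin p)) Empty
    infer_instance
  orient := by
    letI := ChartedSpace.empty (EuclideanSpace ℝ (Fin p)) Empty
    exact ⟨fun x => x.elim, fun x => x.elim⟩

end ClosedManifold

/-- The part `[0, 1) × S` of the half-open cylinder `[0, ∞) × S`. -/
def collarDomain {p : ℕ} (S : ClosedManifold p) : Set (EuclideanHalfSpace 1 × S.M) :=
  {q | q.1.val 0 < 1}

/-- A compact oriented smooth `(p + 1)`-manifold `W` with oriented boundary `∂W = S`.  The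
identification of `S` with the boundary is given by a collar `[0, 1) × S → W`, a diffeomorphism onto
an open neighbourhood of the boundary that takes `{0} × S` onto the boundary.  The boundary is
oriented by the outward normal first convention; as the coordinate of `[0, 1)` points inwards,
this says that the collar reverses the product orientation. -/
structure Filling {p : ℕ} (S : ClosedManifold p) where
  W : Type
  [top : TopologicalSpace W]
  [charted : ChartedSpace (HalfModel p) W]
  [smooth : IsManifold (halfModel p) ∞ W]
  [compact : CompactSpace W]
  [t2 : T2Space W]
  orient : MOrientation (halfModel p) W
  collar : EuclideanHalfSpace 1 × S.M → W
  collar_diffeo :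
    IsLocalDiffeomorphOn (halfModel p) (halfModel p) ∞ collar (collarDomain S)
  collar_injOn : InjOn collar (collarDomain S)
  collar_boundary : (halfModel p).boundary W = range fun x : S.M => collar (0, x)
  collar_orient : ∀ q ∈ collarDomain S,
    (((orient.sign (collar q) * S.orient.sign q.2 : ℤˣ) : ℤ) : ℝ) *
      jac (halfModel p) collar q < 0

namespace Filling

variable {p : ℕ} {S : ClosedManifold p}

instance (V : Filling S) : TopologicalSpace V.W := V.top
instance (V : Filling S) : ChartedSpace (HalfModel p) V.W := V.charted
instance (V : Filling S) : IsManifold (halfModel p) ∞ V.W := V.smooth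
instance (V : Filling S) : CompactSpace V.W := V.compact
instance (V : Filling S) : T2Space V.W := V.t2

/-- The identification of `S` with the boundary of `W`. -/
def bdry (V : Filling S) (x : S.M) : V.W := V.collar (0, x)

end Filling

section Constructions

variable {p : ℕ} {S T : ClosedManifold p}

/-- An orientation preserving isomorphism that respects the preferred charts. -/
structure ChartIso (S T : ClosedManifold p) where
  e : S.M ≃ₜ T.M
  chart : ∀ x, ChartEq (EuclideanSpace ℝ (Fin p)) e x
  orient : ∀ x, T.orient.sign (e x) = S.orient.sign x

theorem mdiffAt_of_localDiffeo {E H M N : Type*} [NormedAddCommGroup E] [NormedSpace ℝ E]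
    [TopologicalSpace H] {I : ModelWithCorners ℝ E H}
    [TopologicalSpace M] [ChartedSpace H M] [TopologicalSpace N] [ChartedSpace H N]
    {f : M → N} {x : M}
    (h : IsLocalDiffeomorphAt I I ∞ f x) : MDifferentiableAt I I f x :=
  h.mdifferentiableAt (by simp)

theorem localDiffeo_comp {E H M N P : Type*} [NormedAddCommGroup E] [NormedSpace ℝ E]
    [TopologicalSpace H] {I : ModelWithCorners ℝ E H}
    [TopologicalSpace M] [ChartedSpace H M] [TopologicalSpace N] [ChartedSpace H N]
    [TopologicalSpace P] [ChartedSpace H P] {f : M → N} {g : N → P} {x : M}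
    (hf : IsLocalDiffeomorphAt I I ∞ f x) (hg : IsLocalDiffeomorphAt I I ∞ g (f x)) :
    IsLocalDiffeomorphAt I I ∞ (g ∘ f) x :=
  hf.comp _ _ hg

theorem jac_localDiffeo_comp {E H M N P : Type*} [NormedAddCommGroup E] [NormedSpace ℝ E]
    [TopologicalSpace H] {I : ModelWithCorners ℝ E H}
    [TopologicalSpace M] [ChartedSpace H M] [TopologicalSpace N] [ChartedSpace H N]
    [TopologicalSpace P] [ChartedSpace H P] {f : M → N} {g : N → P} {x : M}
    (hf : IsLocalDiffeomorphAt I I ∞ f x) (hg : IsLocalDiffeomorphAt I I ∞ g (f x)) :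
    jac I (g ∘ f) x = jac I g (f x) * jac I f x :=
  jac_comp (mdiffAt_of_localDiffeo hg) (mdiffAt_of_localDiffeo hf)

theorem jac_sandwich {E H M N P Q : Type*} [NormedAddCommGroup E] [NormedSpace ℝ E]
    [TopologicalSpace H] {I : ModelWithCorners ℝ E H}
    [TopologicalSpace M] [ChartedSpace H M] [TopologicalSpace N] [ChartedSpace H N]
    [TopologicalSpace P] [ChartedSpace H P] [TopologicalSpace Q] [ChartedSpace H Q]
    [IsManifold I ∞ M] [IsManifold I ∞ N] [IsManifold I ∞ P] [IsManifold I ∞ Q]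
    {d : M → N} {c : N → P} {i : P → Q} {x : M}
    (hd : ChartEq H d x) (hc : IsLocalDiffeomorphAt I I ∞ c (d x)) (hi : ChartEq H i (c (d x))) :
    jac I (i ∘ c ∘ d) x = jac I c (d x) := by
  have h1 := localDiffeo_comp hd.isLocalDiffeomorphAt hc
  rw [jac_localDiffeo_comp h1 hi.isLocalDiffeomorphAt,
    jac_localDiffeo_comp hd.isLocalDiffeomorphAt hc, hd.jac]
  have : jac I i ((c ∘ d) x) = 1 := hi.jac
  rw [this, one_mul, mul_one]

theorem localDiffeo_congr {E H M N : Type*} [NormedAddCommGroup E] [NormedSpace ℝ E]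
    [TopologicalSpace H] {I : ModelWithCorners ℝ E H}
    [TopologicalSpace M] [ChartedSpace H M] [TopologicalSpace N] [ChartedSpace H N]
    {f g : M → N} {x : M}
    (h : IsLocalDiffeomorphAt I I ∞ f x) (hfg : g =ᶠ[𝓝 x] f) :
    IsLocalDiffeomorphAt I I ∞ g x := by
  obtain ⟨Φ, hx, hΦ⟩ := h
  obtain ⟨U, hU, hUo, hxU⟩ := eventually_nhds_iff.1 hfg
  let φ := Φ.toOpenPartialHomeomorph.restrOpen U hUo
  refine ⟨⟨φ.toPartialEquiv, φ.open_source, φ.open_target, ?_, ?_⟩, ?_, ?_⟩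
  · exact Φ.contMDiffOn_toFun.mono fun y hy => hy.1
  · exact Φ.contMDiffOn_invFun.mono fun y hy => hy.1
  · exact ⟨hx, hxU⟩
  · intro y hy
    rw [hU y hy.2]
    exact hΦ hy.1

theorem ChartIso.prodChart (e : ChartIso S T) (q : EuclideanHalfSpace 1 × S.M) :
    ChartEq (HalfModel p) (fun q : EuclideanHalfSpace 1 × S.M => (q.1, e.e q.2)) q :=
  (e.chart q.2).prod q.1

/-- Transport along an isomorphism of the boundary. -/
def Filling.congr (e : ChartIso S T) (V : Filling T) : Filling S where
  W := V.W
  orient := V.orient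
  collar q := V.collar (q.1, e.e q.2)
  collar_diffeo q :=
    localDiffeo_comp (e.prodChart q.1).isLocalDiffeomorphAt
      (V.collar_diffeo ⟨(q.1.1, e.e q.1.2), q.2⟩)
  collar_injOn := by
    rintro ⟨h, x⟩ hq ⟨h', x'⟩ hq' heq
    have := V.collar_injOn (show (h, e.e x) ∈ collarDomain T from hq)
      (show (h', e.e x') ∈ collarDomain T from hq') heq
    simpa using this
  collar_boundary := by
    rw [V.collar_boundary]
    exact (e.e.surjective.range_comp (fun x => V.collar (0, x))).symm
  collar_orient q hq := by
    have h1 := V.collar_orient (q.1, e.e q.2) hq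
    have h2 : jac (halfModel p) (fun q : EuclideanHalfSpace 1 × S.M => V.collar (q.1, e.e q.2)) q =
        jac (halfModel p) V.collar (q.1, e.e q.2) * _ :=
      jac_comp (f := fun q : EuclideanHalfSpace 1 × S.M => (q.1, e.e q.2))
        (mdiffAt_of_localDiffeo (V.collar_diffeo ⟨(q.1, e.e q.2), hq⟩))
        (mdiffAt_of_localDiffeo (e.prodChart q).isLocalDiffeomorphAt)
    rw [h2, (e.prodChart q).jac, mul_one, ← e.orient]
    exact h1

/-- Reversal of all orientations. -/
def Filling.neg (V : Filling S) : Filling S.neg where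
  W := V.W
  orient := V.orient.neg
  collar := V.collar
  collar_diffeo := V.collar_diffeo
  collar_injOn := V.collar_injOn
  collar_boundary := V.collar_boundary
  collar_orient q hq := by
    have hs : V.orient.neg.sign (V.collar q) * S.neg.orient.sign q.2 =
        V.orient.sign (V.collar q) * S.orient.sign q.2 := neg_mul_neg _ _
    rw [hs]
    exact V.collar_orient q hq

/-- The projection of the half-open cylinder over a disjoint union to that over a summand. -/
theorem chartEq_left (h : EuclideanHalfSpace 1) (x : S.M) : ChartEq (HalfModel p)
    (fun q : EuclideanHalfSpace 1 × (S.sum T).M => ((q.1, Sum.elim id (fun _ => x) q.2) :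
      EuclideanHalfSpace 1 × S.M)) (h, Sum.inl x) :=
  (ChartEq.elim_inl x).prod h

theorem chartEq_right (h : EuclideanHalfSpace 1) (x : T.M) : ChartEq (HalfModel p)
    (fun q : EuclideanHalfSpace 1 × (S.sum T).M => ((q.1, Sum.elim (fun _ => x) id q.2) :
      EuclideanHalfSpace 1 × T.M)) (h, Sum.inr x) :=
  (ChartEq.elim_inr x).prod h

theorem sumCollar_left {W W' : Type*} (c : EuclideanHalfSpace 1 × S.M → W)
    (c' : EuclideanHalfSpace 1 × T.M → W') (h : EuclideanHalfSpace 1) (x : S.M) :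
    (fun q : EuclideanHalfSpace 1 × (S.sum T).M =>
      Sum.map (fun x => c (q.1, x)) (fun x => c' (q.1, x)) q.2) =ᶠ[𝓝 (h, Sum.inl x)]
    Sum.inl ∘ c ∘ fun q : EuclideanHalfSpace 1 × (S.sum T).M =>
      ((q.1, Sum.elim id (fun _ => x) q.2) : EuclideanHalfSpace 1 × S.M) := by
  have : {q : EuclideanHalfSpace 1 × (S.sum T).M | q.2 ∈ range (Sum.inl : S.M → S.M ⊕ T.M)} ∈
      𝓝 (h, (Sum.inl x : S.M ⊕ T.M)) :=
    (isOpen_range_inl.preimage continuous_snd).mem_nhds ⟨x, rfl⟩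
  filter_upwards [this]
  rintro ⟨h', _⟩ ⟨y, rfl⟩
  rfl

theorem sumCollar_right {W W' : Type*} (c : EuclideanHalfSpace 1 × S.M → W)
    (c' : EuclideanHalfSpace 1 × T.M → W') (h : EuclideanHalfSpace 1) (x : T.M) :
    (fun q : EuclideanHalfSpace 1 × (S.sum T).M =>
      Sum.map (fun x => c (q.1, x)) (fun x => c' (q.1, x)) q.2) =ᶠ[𝓝 (h, Sum.inr x)]
    Sum.inr ∘ c' ∘ fun q : EuclideanHalfSpace 1 × (S.sum T).M =>
      ((q.1, Sum.elim (fun _ => x) id q.2) : EuclideanHalfSpace 1 × T.M) := by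
  have : {q : EuclideanHalfSpace 1 × (S.sum T).M | q.2 ∈ range (Sum.inr : T.M → S.M ⊕ T.M)} ∈
      𝓝 (h, (Sum.inr x : S.M ⊕ T.M)) :=
    (isOpen_range_inr.preimage continuous_snd).mem_nhds ⟨x, rfl⟩
  filter_upwards [this]
  rintro ⟨h', _⟩ ⟨y, rfl⟩
  rfl

/-- The disjoint union of two fillings. -/
def Filling.sum (V : Filling S) (V' : Filling T) : Filling (S.sum T) where
  W := V.W ⊕ V'.W
  orient := V.orient.sum V'.orient
  collar q := Sum.map (fun x => V.collar (q.1, x)) (fun x => V'.collar (q.1, x)) q.2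
  collar_diffeo := by
    rintro ⟨⟨h, x | x⟩, hq⟩
    · exact localDiffeo_congr (localDiffeo_comp (localDiffeo_comp
        (chartEq_left h x).isLocalDiffeomorphAt (V.collar_diffeo ⟨(h, x), hq⟩))
        (ChartEq.inl _).isLocalDiffeomorphAt) (sumCollar_left _ _ h x)
    · exact localDiffeo_congr (localDiffeo_comp (localDiffeo_comp
        (chartEq_right h x).isLocalDiffeomorphAt (V'.collar_diffeo ⟨(h, x), hq⟩))
        (ChartEq.inr _).isLocalDiffeomorphAt) (sumCollar_right _ _ h x)
  collar_injOn := by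
    rintro ⟨h, x | x⟩ hq ⟨h', x' | x'⟩ hq' heq
    · have := V.collar_injOn (show (h, x) ∈ collarDomain S from hq)
        (show (h', x') ∈ collarDomain S from hq') (Sum.inl_injective heq)
      exact congrArg (fun q : EuclideanHalfSpace 1 × S.M =>
        ((q.1, Sum.inl q.2) : EuclideanHalfSpace 1 × (S.sum T).M)) this
    · exact absurd heq (by simp)
    · exact absurd heq (by simp)
    · have := V'.collar_injOn (show (h, x) ∈ collarDomain T from hq)
        (show (h', x') ∈ collarDomain T from hq') (Sum.inr_injective heq)
      exact congrArg (fun q : EuclideanHalfSpace 1 × T.M =>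
        ((q.1, Sum.inr q.2) : EuclideanHalfSpace 1 × (S.sum T).M)) this
  collar_boundary := by
    rw [ModelWithCorners.boundary_disjointUnion, V.collar_boundary, V'.collar_boundary]
    ext w
    constructor
    · rintro (⟨_, ⟨x, rfl⟩, rfl⟩ | ⟨_, ⟨x, rfl⟩, rfl⟩)
      · exact ⟨Sum.inl x, rfl⟩
      · exact ⟨Sum.inr x, rfl⟩
    · rintro ⟨x | x, rfl⟩
      · exact Or.inl ⟨_, ⟨x, rfl⟩, rfl⟩
      · exact Or.inr ⟨_, ⟨x, rfl⟩, rfl⟩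
  collar_orient := by
    rintro ⟨h, x | x⟩ hq
    · have h1 := V.collar_orient (h, x) hq
      have h2 := (jac_congr (I := halfModel p)
        (sumCollar_left (T := T) V.collar V'.collar h x)).trans
        (jac_sandwich (chartEq_left h x) (V.collar_diffeo ⟨(h, x), hq⟩)
          (ChartEq.inl _))
      exact (congrArg _ h2).trans_lt h1
    · have h1 := V'.collar_orient (h, x) hq
      have h2 := (jac_congr (I := halfModel p)
        (sumCollar_right (S := S) V.collar V'.collar h x)).trans
        (jac_sandwich (chartEq_right h x) (V'.collar_diffeo ⟨(h, x), hq⟩)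
          (ChartEq.inr _))
      exact (congrArg _ h2).trans_lt h1

end Constructions

section Cylinder

instance : Fact ((0 : ℝ) < 2) := ⟨by norm_num⟩

local notation "ℍ¹" => EuclideanHalfSpace 1

local notation "𝔼¹" => EuclideanSpace ℝ (Fin 1)

theorem det_neg_id : LinearMap.det ((-ContinuousLinearMap.id ℝ 𝔼¹ : 𝔼¹ →L[ℝ] 𝔼¹) : 𝔼¹ →ₗ[ℝ] 𝔼¹) = -1 := by
  have : ((-ContinuousLinearMap.id ℝ 𝔼¹ : 𝔼¹ →L[ℝ] 𝔼¹) : 𝔼¹ →ₗ[ℝ] 𝔼¹) = (-1 : ℝ) • LinearMap.id := by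
    ext; simp
  rw [this, LinearMap.det_smul]
  simp

theorem hasFDerivWithinAt_reflect {f : 𝔼¹ → 𝔼¹} {z : 𝔼¹} (hz : z ∈ range (𝓡∂ 1)) (hz2 : z 0 < 2)
    (hf : ∀ h : ℍ¹, h.val 0 < 2 → f ((𝓡∂ 1) h) = WithLp.toLp 2 (fun _ => 2 - h.val 0)) :
    HasFDerivWithinAt f (-ContinuousLinearMap.id ℝ 𝔼¹) (range (𝓡∂ 1)) z := by
  have h1 : HasFDerivWithinAt (fun z : 𝔼¹ => WithLp.toLp 2 (fun _ => (2 : ℝ)) - z)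
      (-ContinuousLinearMap.id ℝ 𝔼¹) (range (𝓡∂ 1)) z := by
    simpa using (hasFDerivWithinAt_id z (range (𝓡∂ 1))).const_sub (WithLp.toLp 2 (fun _ => (2 : ℝ)))
  have h2 : ∀ z : 𝔼¹, z ∈ range (𝓡∂ 1) → z 0 < 2 →
      f z = WithLp.toLp 2 (fun _ => (2 : ℝ)) - z := by
    rintro _ ⟨h, rfl⟩ hh
    rw [hf h hh]
    ext i
    fin_cases i
    rfl
  refine h1.congr_of_eventuallyEq ?_ (h2 z hz hz2)
  have h3 : ∀ᶠ w : 𝔼¹ in 𝓝 z, w 0 < 2 :=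
    (by fun_prop : Continuous fun w : 𝔼¹ => w 0).continuousAt.eventually (gt_mem_nhds hz2)
  filter_upwards [self_mem_nhdsWithin, nhdsWithin_le_nhds h3] with w hw hw2 using h2 w hw hw2

theorem extChartAt_icc_left {u : Icc (0 : ℝ) 2} (hu : u.val < 2) :
    extChartAt (𝓡∂ 1) u = (IccLeftChart 0 2).extend (𝓡∂ 1) := by
  rw [extChartAt, Icc_chartedSpaceChartAt_of_le_top hu]

theorem extChartAt_icc_right {u : Icc (0 : ℝ) 2} (hu : ¬ u.val < 2) :
    extChartAt (𝓡∂ 1) u = (IccRightChart 0 2).extend (𝓡∂ 1) := by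
  rw [extChartAt, Icc_chartedSpaceChartAt_of_top_le (not_lt.1 hu)]

theorem fderiv_coord_self (u : Icc (0 : ℝ) 2) :
    fderivWithin ℝ (extChartAt (𝓡∂ 1) u ∘ (extChartAt (𝓡∂ 1) u).symm) (range (𝓡∂ 1))
      (extChartAt (𝓡∂ 1) u u) = ContinuousLinearMap.id ℝ 𝔼¹ := by
  ext1 v
  exact tangentCoordChange_self (I := 𝓡∂ 1) (mem_extChartAt_source u)

/-- The standard orientation of the interval `[0, 2]`. -/
def iccOrient : MOrientation (𝓡∂ 1) (Icc (0 : ℝ) 2) where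
  sign u := if u.val < 2 then 1 else -1
  coherent u₀ := by
    by_cases h0 : u₀.val < 2
    · have : ∀ᶠ u : Icc (0 : ℝ) 2 in 𝓝 u₀, u.val < 2 :=
        continuous_subtype_val.continuousAt.eventually (gt_mem_nhds h0)
      filter_upwards [this] with u hu
      have h1 : extChartAt (𝓡∂ 1) u₀ = extChartAt (𝓡∂ 1) u := by
        rw [extChartAt_icc_left h0, extChartAt_icc_left hu]
      rw [h1, fderiv_coord_self]
      simp [h0, hu]
    · filter_upwards with u
      by_cases hu : u.val < 2
      · have h1 := extChartAt_icc_left hu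
        have h2 := extChartAt_icc_right h0
        have h3 : HasFDerivWithinAt (extChartAt (𝓡∂ 1) u₀ ∘ (extChartAt (𝓡∂ 1) u).symm)
            (-ContinuousLinearMap.id ℝ 𝔼¹) (range (𝓡∂ 1)) (extChartAt (𝓡∂ 1) u u) := by
          apply hasFDerivWithinAt_reflect
          · exact extChartAt_target_subset_range u (mem_extChartAt_target u)
          · rw [h1]
            change u.val - 0 < 2
            linarith
          · intro h hh
            rw [h1, h2]
            simp only [Function.comp_apply, OpenPartialHomeomorph.extend_coe_symm,
              OpenPartialHomeomorph.extend_coe, (𝓡∂ 1).left_inv]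
            rw [IccLeftChart_symm_apply_of_le (by simpa using hh.le), IccRightChart_apply]
            simp [modelWithCornersEuclideanHalfSpace]
        have hu' := (𝓡∂ 1).uniqueDiffOn _
          (extChartAt_target_subset_range u (mem_extChartAt_target u))
        rw [h3.fderivWithin hu', det_neg_id]
        simp [h0, hu]
      · have h1 : extChartAt (𝓡∂ 1) u₀ = extChartAt (𝓡∂ 1) u := by
          rw [extChartAt_icc_right h0, extChartAt_icc_right hu]
        rw [h1, fderiv_coord_self]
        simp [h0, hu]

theorem hasMFDerivAt_right_symm {h : ℍ¹} (h0 : 0 < h.val 0) (h1 : h.val 0 < 1) :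
    HasMFDerivAt (𝓡∂ 1) (𝓡∂ 1) (IccRightChart 0 2).symm h (-ContinuousLinearMap.id ℝ 𝔼¹) := by
  have hlt : ((IccRightChart (0 : ℝ) 2).symm h).val < 2 := by
    rw [IccRightChart_symm_apply_of_le (by linarith)]
    simpa using h0
  have hcont : ContinuousAt (IccRightChart (0 : ℝ) 2).symm h :=
    (IccRightChart (0 : ℝ) 2).symm.continuousAt (by
      change h.val 0 < 2 - 0
      linarith)
  refine ⟨hcont, ?_⟩
  apply hasFDerivWithinAt_reflect
  · exact extChartAt_target_subset_range h (mem_extChartAt_target h)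
  · change h.val 0 < 2
    linarith
  · intro h' hh
    have h2 := extChartAt_icc_left hlt
    rw [writtenInExtChartAt, h2]
    have h3 : (extChartAt (𝓡∂ 1) h).symm ((𝓡∂ 1) h') = h' := by
      rw [extChartAt, chartAt_self_eq]
      exact (𝓡∂ 1).left_inv h'
    rw [Function.comp_apply, Function.comp_apply, h3,
      IccRightChart_symm_apply_of_le (by linarith)]
    simp [modelWithCornersEuclideanHalfSpace, IccLeftChart_apply]

variable {p : ℕ} {S T : ClosedManifold p}

/-- The two ends of the cylinder `[0, 2] × S`. -/
def cylLeft (S : ClosedManifold p) (q : ℍ¹ × S.M) : Icc (0 : ℝ) 2 × S.M :=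
  ((IccLeftChart 0 2).symm q.1, q.2)

def cylRight (S : ClosedManifold p) (q : ℍ¹ × S.M) : Icc (0 : ℝ) 2 × S.M :=
  ((IccRightChart 0 2).symm q.1, q.2)

theorem chartSymm_localDiffeo (S : ClosedManifold p)
    {c : OpenPartialHomeomorph (Icc (0 : ℝ) 2) ℍ¹} (hc : c ∈ atlas ℍ¹ (Icc (0 : ℝ) 2))
    {q : ℍ¹ × S.M} (hq : q.1 ∈ c.target) :
    IsLocalDiffeomorphAt (halfModel p) (halfModel p) ∞
      (fun q : ℍ¹ × S.M => ((c.symm q.1, q.2) : Icc (0 : ℝ) 2 × S.M)) q := by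
  have hc' : c ∈ IsManifold.maximalAtlas (𝓡∂ 1) ∞ (Icc (0 : ℝ) 2) :=
    IsManifold.subset_maximalAtlas hc
  let φ := c.symm.prod (OpenPartialHomeomorph.refl S.M)
  refine ⟨⟨φ.toPartialEquiv, φ.open_source, φ.open_target, ?_, ?_⟩, ⟨hq, mem_univ _⟩, ?_⟩
  · exact (contMDiffOn_symm_of_mem_maximalAtlas hc').prodMap contMDiffOn_id
  · exact (contMDiffOn_of_mem_maximalAtlas hc').prodMap contMDiffOn_id
  · intro q _
    rfl

theorem jac_right (S : ClosedManifold p) {q : ℍ¹ × S.M} (h0 : 0 < q.1.val 0) (h1 : q.1.val 0 < 1) :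
    jac (halfModel p) (cylRight S) q = -1 := by
  have hd : HasMFDerivAt (halfModel p) (halfModel p) (cylRight S) q
      ((-ContinuousLinearMap.id ℝ 𝔼¹ : 𝔼¹ →L[ℝ] 𝔼¹).prodMap
        (ContinuousLinearMap.id ℝ (EuclideanSpace ℝ (Fin p)))) := by
    have h := HasMFDerivAt.prodMap (p := q) (hasMFDerivAt_right_symm h0 h1)
      (hasMFDerivAt_id (I := 𝓡 p) q.2)
    rw [(hasMFDerivAt_right_symm h0 h1).mfderiv, mfderiv_id] at h
    exact h
  have := congrArg (fun A : 𝔼¹ × EuclideanSpace ℝ (Fin p) →L[ℝ] 𝔼¹ × EuclideanSpace ℝ (Fin p) =>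
    LinearMap.det A.toLinearMap) hd.mfderiv
  refine this.trans ?_
  refine (LinearMap.det_prodMap (-ContinuousLinearMap.id ℝ 𝔼¹ : 𝔼¹ →L[ℝ] 𝔼¹).toLinearMap
    (LinearMap.id : EuclideanSpace ℝ (Fin p) →ₗ[ℝ] _)).trans ?_
  rw [det_neg_id]
  simp

theorem chartSymm_chartEq (S : ClosedManifold p)
    {c : OpenPartialHomeomorph (Icc (0 : ℝ) 2) ℍ¹} {q : ℍ¹ × S.M} (hq : q.1 ∈ c.target)
    (hc : chartAt ℍ¹ (c.symm q.1) = c) :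
    ChartEq (HalfModel p) (fun q : ℍ¹ × S.M => ((c.symm q.1, q.2) : Icc (0 : ℝ) 2 × S.M)) q := by
  have h1 : ∀ᶠ q' : ℍ¹ × S.M in 𝓝 q, q'.1 ∈ c.target :=
    continuous_fst.continuousAt.eventually (c.open_target.mem_nhds hq)
  have h2 : ∀ᶠ q' : ℍ¹ × S.M in 𝓝 q, q'.2 ∈ (chartAt (EuclideanSpace ℝ (Fin p)) q.2).source :=
    continuous_snd.continuousAt.eventually
      ((chartAt (EuclideanSpace ℝ (Fin p)) q.2).open_source.mem_nhds (mem_chart_source _ q.2))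
  filter_upwards [h1, h2] with q' hq' hq2
  rw [prodChartedSpace_chartAt, prodChartedSpace_chartAt, hc]
  exact ⟨⟨c.map_target hq', hq2⟩, Prod.ext (c.right_inv hq') rfl⟩

theorem chartEq_cylLeft (S : ClosedManifold p) {q : ℍ¹ × S.M} (h1 : q.1.val 0 < 1) :
    ChartEq (HalfModel p) (cylLeft S) q := by
  apply chartSymm_chartEq
  · change q.1.val 0 < 2 - 0
    linarith
  · apply Icc_chartedSpaceChartAt_of_le_top
    rw [IccLeftChart_symm_apply_of_le (by linarith)]
    change q.1.val 0 + 0 < 2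
    linarith

theorem chartEq_cylRight (S : ClosedManifold p) {q : ℍ¹ × S.M} (h1 : q.1.val 0 = 0) :
    ChartEq (HalfModel p) (cylRight S) q := by
  apply chartSymm_chartEq
  · change q.1.val 0 < 2 - 0
    linarith
  · apply Icc_chartedSpaceChartAt_of_top_le
    rw [IccRightChart_symm_apply_of_le (by linarith)]
    change 2 ≤ 2 - q.1.val 0
    linarith

theorem cylLeft_fst (S : ClosedManifold p) {q : ℍ¹ × S.M} (h1 : q.1.val 0 < 1) :
    (cylLeft S q).1.val = q.1.val 0 := by
  rw [cylLeft, IccLeftChart_symm_apply_of_le (by linarith)]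
  exact add_zero _

theorem cylRight_fst (S : ClosedManifold p) {q : ℍ¹ × S.M} (h1 : q.1.val 0 < 1) :
    (cylRight S q).1.val = 2 - q.1.val 0 := by
  rw [cylRight, IccRightChart_symm_apply_of_le (by linarith)]

theorem halfSpace_ext {h h' : ℍ¹} (H : h.val 0 = h'.val 0) : h = h' := by
  apply Subtype.ext
  ext i
  fin_cases i
  exact H

/-- The collar of the cylinder. -/
def cylCollar (S : ClosedManifold p) (q : ℍ¹ × (S.sum S.neg).M) : Icc (0 : ℝ) 2 × S.M :=
  Sum.elim (fun x : S.M => cylLeft S (q.1, x)) (fun x : S.M => cylRight S (q.1, x)) q.2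

theorem cylCollar_left (S : ClosedManifold p) (h : ℍ¹) (x : S.M) :
    cylCollar S =ᶠ[𝓝 (h, Sum.inl x)] id ∘ cylLeft S ∘
      fun q : ℍ¹ × (S.sum S.neg).M => ((q.1, Sum.elim id (fun _ => x) q.2) : ℍ¹ × S.M) := by
  have : {q : ℍ¹ × (S.sum S.neg).M | q.2 ∈ range (Sum.inl : S.M → S.M ⊕ S.M)} ∈
      𝓝 (h, (Sum.inl x : S.M ⊕ S.M)) :=
    (isOpen_range_inl.preimage continuous_snd).mem_nhds ⟨x, rfl⟩
  filter_upwards [this]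
  rintro ⟨h', _⟩ ⟨y, rfl⟩
  rfl

theorem cylCollar_right (S : ClosedManifold p) (h : ℍ¹) (x : S.M) :
    cylCollar S =ᶠ[𝓝 (h, Sum.inr x)] id ∘ cylRight S ∘
      fun q : ℍ¹ × (S.sum S.neg).M => ((q.1, Sum.elim (fun _ => x) id q.2) : ℍ¹ × S.M) := by
  have : {q : ℍ¹ × (S.sum S.neg).M | q.2 ∈ range (Sum.inr : S.M → S.M ⊕ S.M)} ∈
      𝓝 (h, (Sum.inr x : S.M ⊕ S.M)) :=
    (isOpen_range_inr.preimage continuous_snd).mem_nhds ⟨x, rfl⟩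
  filter_upwards [this]
  rintro ⟨h', _⟩ ⟨y, rfl⟩
  rfl

theorem ChartEq.id {H M : Type*} [TopologicalSpace H] [TopologicalSpace M] [ChartedSpace H M]
    (x : M) : ChartEq H (id : M → M) x := by
  filter_upwards [(chartAt H x).open_source.mem_nhds (mem_chart_source H x)] with y hy
  exact ⟨hy, rfl⟩

theorem cylLeft_localDiffeo (S : ClosedManifold p) {q : ℍ¹ × S.M} (h1 : q.1.val 0 < 1) :
    IsLocalDiffeomorphAt (halfModel p) (halfModel p) ∞ (cylLeft S) q :=
  (chartEq_cylLeft S h1).isLocalDiffeomorphAt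

theorem cylRight_localDiffeo (S : ClosedManifold p) {q : ℍ¹ × S.M} (h1 : q.1.val 0 < 1) :
    IsLocalDiffeomorphAt (halfModel p) (halfModel p) ∞ (cylRight S) q := by
  refine chartSymm_localDiffeo S (c := IccRightChart 0 2) (by simp [atlas, ChartedSpace.atlas]) ?_
  change q.1.val 0 < 2 - 0
  linarith

/-- The cylinder `[0, 2] × S`, as a manifold with boundary `S ⊔ -S`. -/
def Filling.cylinder (S : ClosedManifold p) : Filling (S.sum S.neg) where
  W := Icc (0 : ℝ) 2 × S.M
  orient := (iccOrient.prod S.orient).neg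
  collar := cylCollar S
  collar_diffeo := by
    rintro ⟨⟨h, x | x⟩, hq⟩
    · exact localDiffeo_congr (localDiffeo_comp (localDiffeo_comp
        (chartEq_left (T := S.neg) h x).isLocalDiffeomorphAt
        (cylLeft_localDiffeo S (q := (h, x)) hq))
        (ChartEq.id _).isLocalDiffeomorphAt) (cylCollar_left S h x)
    · exact localDiffeo_congr (localDiffeo_comp (localDiffeo_comp
        (chartEq_right (S := S) (T := S.neg) h x).isLocalDiffeomorphAt
        (cylRight_localDiffeo S (q := (h, x)) hq))
        (ChartEq.id _).isLocalDiffeomorphAt) (cylCollar_right S h x)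
  collar_injOn := by
    rintro ⟨h, x | x⟩ hq ⟨h', x' | x'⟩ hq' heq
    · have h1 := congrArg (fun w => w.1.val) heq
      have h2 : x = x' := congrArg Prod.snd heq
      have h3 := (cylLeft_fst S (q := (h, x)) hq).symm.trans
        (h1.trans (cylLeft_fst S (q := (h', x')) hq'))
      exact congrArg₂ (fun (h : ℍ¹) (x : S.M) => ((h, Sum.inl x) : ℍ¹ × (S.sum S.neg).M))
        (halfSpace_ext h3) h2
    · have h1 := congrArg (fun w => w.1.val) heq
      have h3 := (cylLeft_fst S (q := (h, x)) hq).symm.trans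
        (h1.trans (cylRight_fst S (q := (h', x')) hq'))
      have h4 : h.val 0 < 1 := hq
      have h5 : h'.val 0 < 1 := hq'
      simp only at h3
      linarith
    · have h1 := congrArg (fun w => w.1.val) heq
      have h3 := (cylRight_fst S (q := (h, x)) hq).symm.trans
        (h1.trans (cylLeft_fst S (q := (h', x')) hq'))
      have h4 : h.val 0 < 1 := hq
      have h5 : h'.val 0 < 1 := hq'
      simp only at h3
      linarith
    · have h1 := congrArg (fun w => w.1.val) heq
      have h2 : x = x' := congrArg Prod.snd heq
      have h3 := (cylRight_fst S (q := (h, x)) hq).symm.trans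
        (h1.trans (cylRight_fst S (q := (h', x')) hq'))
      exact congrArg₂ (fun (h : ℍ¹) (x : S.M) => ((h, Sum.inr x) : ℍ¹ × (S.sum S.neg).M))
        (halfSpace_ext (sub_right_injective h3)) h2
  collar_boundary := by
    have : Fact ((0 : ℝ) ≤ 2) := ⟨by norm_num⟩
    have h0 : ∀ x : S.M, cylLeft S (0, x) = (⊥, x) := fun x =>
      Prod.ext (Subtype.ext (cylLeft_fst S (q := (0, x)) one_pos)) rfl
    have h2 : ∀ x : S.M, cylRight S (0, x) = (⊤, x) := fun x =>
      Prod.ext (Subtype.ext ((cylRight_fst S (q := (0, x)) one_pos).trans (sub_zero 2))) rfl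
    rw [ModelWithCorners.boundary_of_boundaryless_right, boundary_Icc]
    ext ⟨u, x⟩
    constructor
    · rintro ⟨hu | hu, -⟩
      · refine ⟨Sum.inl x, (h0 x).trans ?_⟩
        exact Prod.ext hu.symm rfl
      · refine ⟨Sum.inr x, (h2 x).trans ?_⟩
        exact Prod.ext hu.symm rfl
    · rintro ⟨y | y, hy⟩
      · exact ⟨Or.inl (congrArg Prod.fst (hy.symm.trans (h0 y))), trivial⟩
      · exact ⟨Or.inr (congrArg Prod.fst (hy.symm.trans (h2 y))), trivial⟩
  collar_orient := by
    have hsq : ∀ s : ℤˣ, (((s : ℤˣ) : ℤ) : ℝ) * (((s : ℤˣ) : ℤ) : ℝ) = 1 := by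
      intro s
      rcases Int.units_eq_one_or s with rfl | rfl <;> simp
    rintro ⟨h, x | x⟩ hq
    · have hj : jac (halfModel p) (cylCollar S) (h, Sum.inl x) = 1 :=
        ((jac_congr (I := halfModel p) (cylCollar_left S h x)).trans
        (jac_sandwich (chartEq_left (T := S.neg) h x) (cylLeft_localDiffeo S (q := (h, x)) hq)
          (ChartEq.id _))).trans (chartEq_cylLeft S (q := (h, x)) hq).jac
      have h1 : (cylLeft S (h, x)).1.val < 2 := by
        rw [cylLeft_fst S (q := (h, x)) hq]
        have h4 : h.val 0 < 1 := hq
        simp only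
        linarith
      have h3 : (iccOrient.prod S.orient).neg.sign (cylCollar S (h, Sum.inl x)) =
          - S.orient.sign x := by
        change -((if (cylLeft S (h, x)).1.val < 2 then 1 else -1) * S.orient.sign x) = _
        rw [if_pos h1, one_mul]
      rw [hj, h3]
      change (((-S.orient.sign x * S.orient.sign x : ℤˣ) : ℤ) : ℝ) * 1 < 0
      have := hsq (S.orient.sign x)
      push_cast
      linarith
    · have hj : jac (halfModel p) (cylCollar S) (h, Sum.inr x) =
          jac (halfModel p) (cylRight S) (h, x) :=
        ((jac_congr (I := halfModel p) (cylCollar_right S h x)).trans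
        (jac_sandwich (chartEq_right (S := S) (T := S.neg) h x)
          (cylRight_localDiffeo S (q := (h, x)) hq) (ChartEq.id _)))
      rw [hj]
      have h1 := cylRight_fst S (q := (h, x)) hq
      change (((-((if (cylRight S (h, x)).1.val < 2 then 1 else -1) * S.orient.sign x) *
        -S.orient.sign x : ℤˣ) : ℤ) : ℝ) * _ < 0
      have h5 := hsq (S.orient.sign x)
      rcases h.2.eq_or_lt with h0 | h0
      · rw [(chartEq_cylRight S (q := (h, x)) h0.symm).jac, if_neg (by
          rw [h1]
          simp [← h0])]
        push_cast
        linarith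
      · rw [jac_right S (q := (h, x)) h0 hq, if_pos (by
          rw [h1]
          simpa using h0)]
        push_cast
        linarith

end Cylinder

section Isomorphisms

variable {p : ℕ} {S T S' T' R : ClosedManifold p}

theorem ChartEq.of_inl {H M M' N : Type*} [TopologicalSpace H] [TopologicalSpace M]
    [ChartedSpace H M] [TopologicalSpace M'] [ChartedSpace H M'] [TopologicalSpace N]
    [ChartedSpace H N] {f : M ⊕ M' → N} {x : M} (h : ChartEq H (f ∘ Sum.inl) x) :
    ChartEq H f (Sum.inl x) := by
  unfold ChartEq at h ⊢
  rw [nhds_inl, Filter.eventually_map]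
  filter_upwards [h] with y hy
  simpa using hy

theorem ChartEq.of_inr {H M M' N : Type*} [TopologicalSpace H] [TopologicalSpace M]
    [ChartedSpace H M] [TopologicalSpace M'] [ChartedSpace H M'] [TopologicalSpace N]
    [ChartedSpace H N] {f : M ⊕ M' → N} {x : M'} (h : ChartEq H (f ∘ Sum.inr) x) :
    ChartEq H f (Sum.inr x) := by
  unfold ChartEq at h ⊢
  rw [nhds_inr, Filter.eventually_map]
  filter_upwards [h] with y hy
  simpa using hy

theorem ChartEq.comp {H M N P : Type*} [TopologicalSpace H] [TopologicalSpace M]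
    [ChartedSpace H M] [TopologicalSpace N] [ChartedSpace H N] [TopologicalSpace P]
    [ChartedSpace H P] {f : M → N} {g : N → P} {x : M} (hg : ChartEq H g (f x))
    (hf : ChartEq H f x) : ChartEq H (g ∘ f) x := by
  filter_upwards [hf, hf.continuousAt.eventually hg] with y hy hy'
  exact ⟨hy'.1, hy'.2.trans hy.2⟩

theorem chartEq_inl (S T : ClosedManifold p) (x : S.M) :
    ChartEq (EuclideanSpace ℝ (Fin p)) (Sum.inl : S.M → (S.sum T).M) x := ChartEq.inl x

theorem chartEq_inr (S T : ClosedManifold p) (x : T.M) :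
    ChartEq (EuclideanSpace ℝ (Fin p)) (Sum.inr : T.M → (S.sum T).M) x := ChartEq.inr x

namespace ChartIso

def refl (S : ClosedManifold p) : ChartIso S S where
  e := Homeomorph.refl _
  chart x := ChartEq.id x
  orient _ := rfl

def neg (a : ChartIso S T) : ChartIso S.neg T.neg where
  e := a.e
  chart := a.chart
  orient x := congrArg Neg.neg (a.orient x)

def sum (a : ChartIso S T) (b : ChartIso S' T') : ChartIso (S.sum S') (T.sum T') where
  e := a.e.sumCongr b.e
  chart := by
    rintro (x | x)
    · exact ChartEq.of_inl ((ChartEq.inl _).comp (a.chart x))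
    · exact ChartEq.of_inr ((ChartEq.inr _).comp (b.chart x))
  orient := by
    rintro (x | x)
    · exact a.orient x
    · exact b.orient x

def comm (S T : ClosedManifold p) : ChartIso (S.sum T) (T.sum S) where
  e := Homeomorph.sumComm S.M T.M
  chart := by
    rintro (x | x)
    · exact ChartEq.of_inl (ChartEq.inr x)
    · exact ChartEq.of_inr (ChartEq.inl x)
  orient := by
    rintro (x | x) <;> rfl

def assoc (R S T : ClosedManifold p) : ChartIso (R.sum (S.sum T)) ((R.sum S).sum T) where
  e := (Homeomorph.sumAssoc R.M S.M T.M).symm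
  chart := by
    rintro (x | x | x)
    · exact ChartEq.of_inl ((chartEq_inl (R.sum S) T _).comp (chartEq_inl R S x))
    · exact ChartEq.of_inr (ChartEq.of_inl
        ((chartEq_inl (R.sum S) T _).comp (chartEq_inr R S x)))
    · exact ChartEq.of_inr (ChartEq.of_inr (chartEq_inr (R.sum S) T x))
  orient := by
    rintro (x | x | x) <;> rfl

def exchange (S T S' T' : ClosedManifold p) :
    ChartIso ((S.sum T).sum (S'.sum T')) ((S.sum S').sum (T.sum T')) where
  e := Homeomorph.sumSumSumComm S.M T.M S'.M T'.M
  chart := by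
    rintro ((x | x) | (x | x))
    · exact ChartEq.of_inl (ChartEq.of_inl
        ((chartEq_inl (S.sum S') (T.sum T') _).comp (chartEq_inl S S' x)))
    · exact ChartEq.of_inl (ChartEq.of_inr
        ((chartEq_inr (S.sum S') (T.sum T') _).comp (chartEq_inl T T' x)))
    · exact ChartEq.of_inr (ChartEq.of_inl
        ((chartEq_inl (S.sum S') (T.sum T') _).comp (chartEq_inr S S' x)))
    · exact ChartEq.of_inr (ChartEq.of_inr
        ((chartEq_inr (S.sum S') (T.sum T') _).comp (chartEq_inr T T' x)))
  orient := by
    rintro ((x | x) | (x | x)) <;> rfl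

instance : IsEmpty (ClosedManifold.empty p).M := inferInstanceAs (IsEmpty Empty)

instance : IsEmpty (ClosedManifold.empty p).neg.M := inferInstanceAs (IsEmpty Empty)

def emptySum (S : ClosedManifold p) : ChartIso S ((ClosedManifold.empty p).sum S) where
  e := (Homeomorph.emptySum S.M (ClosedManifold.empty p).M).symm
  chart x := ChartEq.inr x
  orient _ := rfl

def sumNegEmpty (S : ClosedManifold p) : ChartIso (S.sum (ClosedManifold.empty p).neg) S where
  e := Homeomorph.sumEmpty S.M (ClosedManifold.empty p).neg.M
  chart := by
    rintro (x | x)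
    · exact ChartEq.of_inl (ChartEq.id x)
    · exact isEmptyElim x
  orient := by
    rintro (x | x)
    · rfl
    · exact isEmptyElim x

def negSum (S T : ClosedManifold p) : ChartIso (S.sum T).neg (S.neg.sum T.neg) where
  e := Homeomorph.refl (S.M ⊕ T.M)
  chart x := ChartEq.id (M := S.M ⊕ T.M) x
  orient := by
    rintro (x | x) <;> rfl

def sumNeg (S T : ClosedManifold p) : ChartIso (S.neg.sum T.neg) (S.sum T).neg where
  e := Homeomorph.refl (S.M ⊕ T.M)
  chart x := ChartEq.id (M := S.M ⊕ T.M) x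
  orient := by
    rintro (x | x) <;> rfl

def trans (a : ChartIso R S) (b : ChartIso S T) : ChartIso R T where
  e := a.e.trans b.e
  chart x := (b.chart _).comp (a.chart x)
  orient x := (b.orient _).trans (a.orient x)

end ChartIso

end Isomorphisms

/-- A closed oriented singular `p`-manifold in the topological space `A`: a closed oriented
`p`-manifold with a continuous map to `A`. -/
structure SingularMfd (p : ℕ) (A : Type*) [TopologicalSpace A] where
  dom : ClosedManifold p
  map : C(dom.M, A)

namespace SingularMfd

variable {p : ℕ} {A B : Type*} [TopologicalSpace A] [TopologicalSpace B]

/-- Reversal of the orientation. -/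
def neg (s : SingularMfd p A) : SingularMfd p A where
  dom := s.dom.neg
  map := ⟨s.map, s.map.continuous⟩

/-- Disjoint union. -/
def sum (s t : SingularMfd p A) : SingularMfd p A where
  dom := s.dom.sum t.dom
  map := ⟨Sum.elim s.map t.map, s.map.continuous.sumElim t.map.continuous⟩

/-- The empty singular manifold. -/
def empty (p : ℕ) (A : Type*) [TopologicalSpace A] : SingularMfd p A where
  dom := ClosedManifold.empty p
  map := ⟨fun x => isEmptyElim x, continuous_of_const fun x => isEmptyElim x⟩

/-- Composition with a continuous map. -/
def push (φ : C(A, B)) (s : SingularMfd p A) : SingularMfd p B where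
  dom := s.dom
  map := φ.comp s.map

/-- `s : S → A` bounds: it extends to a compact oriented manifold `W` with `∂W = S`. -/
def Bounds (s : SingularMfd p A) : Prop :=
  ∃ (V : Filling s.dom) (h : C(V.W, A)), ∀ x, h (V.bdry x) = s.map x

/-- `s₀ : S₀ → A` and `s₁ : S₁ → A` are bordant: there is a compact oriented manifold `W` with
`∂W = S₀ ⊔ -S₁`, and `s₀ ⊔ s₁` extends to a map `W → A`. -/
def Bordant (s t : SingularMfd p A) : Prop := (s.sum t.neg).Bounds

theorem Bounds.congr {s t : SingularMfd p A} (ht : t.Bounds) (a : ChartIso s.dom t.dom)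
    (ha : ∀ x, t.map (a.e x) = s.map x) : s.Bounds := by
  obtain ⟨V, h, hh⟩ := ht
  exact ⟨V.congr a, h, fun x => (hh (a.e x)).trans (ha x)⟩

theorem Bounds.sum {s t : SingularMfd p A} (hs : s.Bounds) (ht : t.Bounds) :
    (s.sum t).Bounds := by
  obtain ⟨V, h, hh⟩ := hs
  obtain ⟨V', h', hh'⟩ := ht
  refine ⟨V.sum V', ⟨Sum.elim h h', h.continuous.sumElim h'.continuous⟩, ?_⟩
  rintro (x | x)
  · exact hh x
  · exact hh' x

theorem Bounds.neg {s : SingularMfd p A} (hs : s.Bounds) : s.neg.Bounds := by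
  obtain ⟨V, h, hh⟩ := hs
  exact ⟨V.neg, h, hh⟩

theorem bordant_refl (s : SingularMfd p A) : Bordant s s := by
  refine ⟨Filling.cylinder s.dom, ⟨fun w => s.map w.2, s.map.continuous.comp continuous_snd⟩, ?_⟩
  rintro (x | x) <;> rfl

theorem bordant_of_iso {s t : SingularMfd p A} (a : ChartIso t.dom s.dom)
    (ha : ∀ x, s.map (a.e x) = t.map x) : Bordant s t := by
  refine (bordant_refl s).congr ((ChartIso.refl s.dom).sum a.neg) ?_
  change ∀ x : s.dom.M ⊕ t.dom.M, _
  rintro (x | x)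
  · rfl
  · exact ha x

theorem Bordant.sum {s s' t t' : SingularMfd p A} (h : Bordant s s') (h' : Bordant t t') :
    Bordant (s.sum t) (s'.sum t') := by
  refine (Bounds.sum h h').congr
    (((ChartIso.refl (s.dom.sum t.dom)).sum (ChartIso.negSum s'.dom t'.dom)).trans
      (ChartIso.exchange s.dom t.dom s'.dom.neg t'.dom.neg)) ?_
  rintro ((x | x) | (x | x)) <;> rfl

theorem Bordant.neg {s t : SingularMfd p A} (h : Bordant s t) : Bordant s.neg t.neg :=
  (Bounds.neg h).congr (ChartIso.sumNeg s.dom t.dom.neg) (by rintro (x | x) <;> rfl)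

theorem Bordant.push {s t : SingularMfd p A} (h : Bordant s t) (φ : C(A, B)) :
    Bordant (s.push φ) (t.push φ) := by
  obtain ⟨V, h, hh⟩ := h
  refine ⟨V, φ.comp h, ?_⟩
  rintro (x | x)
  · exact congrArg φ (hh (Sum.inl x))
  · exact congrArg φ (hh (Sum.inr x))

theorem neg_sum_bordant (s : SingularMfd p A) : Bordant (s.neg.sum s) (empty p A) := by
  refine (bordant_refl s).congr
    ((ChartIso.sumNegEmpty (s.dom.neg.sum s.dom)).trans (ChartIso.comm s.dom.neg s.dom)) ?_
  rintro ((x | x) | x)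
  · rfl
  · rfl
  · exact isEmptyElim (α := (ClosedManifold.empty p).M) x

end SingularMfd

/-- The oriented bordism group `Ω_p(A)`: bordism classes of closed oriented singular `p`-manifolds
in `A`, with disjoint union as addition. -/
def Bordism (p : ℕ) (A : Type*) [TopologicalSpace A] := Quot (SingularMfd.Bordant (p := p) (A := A))

namespace Bordism

variable {p : ℕ} {A B : Type*} [TopologicalSpace A] [TopologicalSpace B]

/-- The bordism class of a singular manifold. -/
def mk (s : SingularMfd p A) : Bordism p A := Quot.mk _ s

instance : Add (Bordism p A) := ⟨Quot.map₂ SingularMfd.sum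
  (fun s _ _ h => (SingularMfd.bordant_refl s).sum h)
  (fun _ _ t h => h.sum (SingularMfd.bordant_refl t))⟩

instance : Zero (Bordism p A) := ⟨mk (SingularMfd.empty p A)⟩

instance : Neg (Bordism p A) := ⟨Quot.map SingularMfd.neg fun _ _ h => h.neg⟩

instance : AddCommGroup (Bordism p A) where
  nsmul := nsmulRec
  zsmul := zsmulRec
  add_assoc := by
    rintro ⟨r⟩ ⟨s⟩ ⟨t⟩
    exact Quot.sound (SingularMfd.bordant_of_iso (ChartIso.assoc r.dom s.dom t.dom)
      (by rintro (x | x | x) <;> rfl))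
  zero_add := by
    rintro ⟨s⟩
    exact Quot.sound (SingularMfd.bordant_of_iso (ChartIso.emptySum s.dom) fun _ => rfl)
  add_zero := by
    rintro ⟨s⟩
    exact Quot.sound (SingularMfd.bordant_of_iso
      ((ChartIso.emptySum s.dom).trans (ChartIso.comm _ _)) fun _ => rfl)
  add_comm := by
    rintro ⟨s⟩ ⟨t⟩
    exact Quot.sound (SingularMfd.bordant_of_iso (ChartIso.comm t.dom s.dom)
      (by rintro (x | x) <;> rfl))
  neg_add_cancel := by
    rintro ⟨s⟩
    exact Quot.sound (SingularMfd.neg_sum_bordant s)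

/-- The homomorphism of bordism groups induced by a continuous map. -/
def push (φ : C(A, B)) : Bordism p A →+ Bordism p B where
  toFun := Quot.map (SingularMfd.push φ) fun _ _ h => h.push φ
  map_zero' := Quot.sound (SingularMfd.bordant_of_iso (ChartIso.refl _) fun x => isEmptyElim
    (α := (ClosedManifold.empty p).M) x)
  map_add' := by
    rintro ⟨s⟩ ⟨t⟩
    exact Quot.sound (SingularMfd.bordant_of_iso (ChartIso.refl _) (by rintro (x | x) <;> rfl))

end Bordism

section Nielsen

variable {p : ℕ} {X X' Z : Type*} [TopologicalSpace X] [TopologicalSpace X'] [TopologicalSpace Z]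

/-- The inclusion of a subset. -/
def incl (Y : Set Z) : C(Y, Z) := ⟨Subtype.val, continuous_subtype_val⟩

/-- Nielsen equivalence of singular manifolds `s₀ : S₀ → C`, `s₁ : S₁ → C` in the preimage set
`C = f ⁻¹' Y`: there are a compact oriented manifold `W` with `∂W = S₀ ⊔ -S₁`, a map `K : W → X`
extending `s₀ ⊔ s₁`, and a map `G : W → Y` extending `f s₀ ⊔ f s₁`, such that `f K` and `G` are
homotopic, as maps to `Z`, relative to `S₀ ⊔ S₁`. -/
def NielsenEquiv (f : C(X, Z)) (Y : Set Z) (s t : SingularMfd p (f ⁻¹' Y)) : Prop :=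
  ∃ (V : Filling (s.sum t.neg).dom) (K : C(V.W, X)) (G : C(V.W, Y)),
    (∀ x, K (V.bdry x) = (s.sum t.neg).map x) ∧
    (∀ x, (G (V.bdry x) : Z) = f ((s.sum t.neg).map x)) ∧
    (f.comp K).HomotopicRel ((incl Y).comp G) (range V.bdry)

/-- The subgroup of `Ω_p(f ⁻¹' Y)` by which Nielsen equivalent classes are identified. -/
def nielsenSubgroup (p : ℕ) (f : C(X, Z)) (Y : Set Z) : AddSubgroup (Bordism p (f ⁻¹' Y)) :=
  AddSubgroup.closure {b | ∃ s t, NielsenEquiv f Y s t ∧ b = Bordism.mk s - Bordism.mk t}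

/-- The group `S'_p(f, Y) = Ω_p(f ⁻¹' Y) / ∼_N` of Nielsen classes of order `p`. -/
abbrev PreNielsenGroup (p : ℕ) (f : C(X, Z)) (Y : Set Z) :=
  Bordism p (f ⁻¹' Y) ⧸ nielsenSubgroup p f Y

/-- The map of preimage sets induced by a map `k` over `Z`. -/
def preimageMap {f : C(X, Z)} {f' : C(X', Z)} (Y : Set Z) (k : C(X, X')) (hk : f'.comp k = f) :
    C(f ⁻¹' Y, f' ⁻¹' Y) where
  toFun x := ⟨k x, by
    subst hk
    exact x.2⟩
  continuous_toFun := by fun_prop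

theorem NielsenEquiv.push {f : C(X, Z)} {f' : C(X', Z)} {Y : Set Z} {s t : SingularMfd p (f ⁻¹' Y)}
    (h : NielsenEquiv f Y s t) (k : C(X, X')) (hk : f'.comp k = f) :
    NielsenEquiv f' Y (s.push (preimageMap Y k hk)) (t.push (preimageMap Y k hk)) := by
  subst hk
  obtain ⟨V, K, G, hK, hG, hrel⟩ := h
  refine ⟨V, k.comp K, G, ?_, ?_, hrel⟩
  · rintro (x | x)
    · exact congrArg k (hK (Sum.inl x))
    · exact congrArg k (hK (Sum.inr x))
  · rintro (x | x)
    · exact hG (Sum.inl x)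
    · exact hG (Sum.inr x)

/-- The homomorphism `S'_p(f, Y) → S'_p(f', Y)`, `[s] ↦ [k s]`, induced by a map `k` with
`f' k = f`. -/
def PreNielsenGroup.map {f : C(X, Z)} {f' : C(X', Z)} (Y : Set Z) (k : C(X, X'))
    (hk : f'.comp k = f) : PreNielsenGroup p f Y →+ PreNielsenGroup p f' Y :=
  QuotientAddGroup.map _ _ (Bordism.push (preimageMap Y k hk)) <| by
    rw [nielsenSubgroup, AddSubgroup.closure_le]
    rintro _ ⟨s, t, hst, rfl⟩
    refine AddSubgroup.subset_closure ⟨_, _, hst.push k hk, ?_⟩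
    exact map_sub (Bordism.push (preimageMap Y k hk)) (Bordism.mk s) (Bordism.mk t)

/-- The inclusion `X → [0, 1] × X`, `x ↦ (t, x)`. -/
def inclAt (X : Type*) [TopologicalSpace X] (t : unitInterval) : C(X, unitInterval × X) :=
  ⟨fun x => (t, x), by fun_prop⟩

/-- The map `F_t : X → Z`, `x ↦ F (t, x)`, of a homotopy `F : [0, 1] × X → Z`. -/
def slice (F : C(unitInterval × X, Z)) (t : unitInterval) : C(X, Z) := F.comp (inclAt X t)

/-- The group `S_p(f, Y)` of topologically essential Nielsen classes: the intersection, over all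
homotopies `F` of `f`, of the subgroups `M^F` of `S'_p(f, Y)` of all classes preserved by `F`.
In `S'_p(F, Y)` the group `M^F` is the intersection of the images of `S'_p(F_0, Y)` and
`S'_p(F_1, Y)`; here `F_0 = f`. -/
def nielsenGroup (p : ℕ) (f : C(X, Z)) (Y : Set Z) : AddSubgroup (PreNielsenGroup p f Y) :=
  ⨅ (F : C(unitInterval × X, Z)) (hF : slice F 0 = f),
    let i₀ : PreNielsenGroup p f Y →+ PreNielsenGroup p F Y := PreNielsenGroup.map Y (inclAt X 0) hF
    let i₁ : PreNielsenGroup p (slice F 1) Y →+ PreNielsenGroup p F Y := PreNielsenGroup.map Y (inclAt X 1) rfl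
    (i₀.range ⊓ i₁.range).comap i₀

/-- The Nielsen number of order `p`, the rank of the abelian group `S_p(f, Y)`. -/
def nielsenNumber (p : ℕ) (f : C(X, Z)) (Y : Set Z) : Cardinal :=
  Module.rank ℤ (nielsenGroup p f Y)

end Nielsen

section Classical

variable {X Z : Type*} [TopologicalSpace X] [TopologicalSpace Z]

/-- The classical Nielsen relation on the points of `f ⁻¹' Y`: there are a path `α` in `X` from `x`
to `y` and a path `β` in `Y` from `f x` to `f y` such that `f α` and `β` are homotopic in `Z`
relative to the end points. -/
def NielsenRel (f : C(X, Z)) (Y : Set Z) (x y : X) : Prop :=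
  ∃ (hx : f x ∈ Y) (hy : f y ∈ Y) (α : Path x y) (β : Path (⟨f x, hx⟩ : Y) ⟨f y, hy⟩),
    (α.map f.continuous).Homotopic (β.map continuous_subtype_val)

/-- The classical Nielsen classes, as subsets of `X`. -/
def IsNielsenClass (f : C(X, Z)) (Y : Set Z) (N : Set X) : Prop :=
  ∃ x, f x ∈ Y ∧ N = {y | NielsenRel f Y x y}

/-- A classical Nielsen class `N` of `f` is essential if, for every homotopy `F` of `f`, it
corresponds to a Nielsen class of `F_1`, that is, there is a Nielsen class `K` of `F` whose
`0`-section is `N` and whose `1`-section is a Nielsen class of `F_1`. -/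
def IsEssentialClass (f : C(X, Z)) (Y : Set Z) (N : Set X) : Prop :=
  IsNielsenClass f Y N ∧ ∀ F : C(unitInterval × X, Z), slice F 0 = f →
    ∃ K : Set (unitInterval × X), IsNielsenClass F Y K ∧ {x | (0, x) ∈ K} = N ∧
      IsNielsenClass (slice F 1) Y {x | (1, x) ∈ K}

/-- The classical Nielsen number, the number of essential Nielsen classes. -/
def classicalNielsenNumber (f : C(X, Z)) (Y : Set Z) : Cardinal :=
  Cardinal.mk {N : Set X // IsEssentialClass f Y N}

end Classical

end HigherNielsen

end

universe u v

open scoped Manifold ContDiff Topology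
open Set

noncomputable section

/-! Let E(f) be the homotopy pullback of f and the inclusion of Y: triples of a point x of X, a
point y of Y and a path in Z from f(x) to y. The preimage C maps to E(f) by constant paths. The data
of a Nielsen equivalence, namely a map W → X, a map W → Y and a homotopy relative to the boundary,
amount by currying to a single map W → E(f) that extends the given maps on the boundary. So Nielsen
equivalence is bordism in E(f), and S'_p(f, Y) is the image of Ω_p(C) in Ω_p(E(f))
(`NielsenEquiv.bordant`, `NielsenEquiv.of_bordant`, `PreNielsenGroup.nielsenSubgroup_eq_ker`).

For (1), let F be a homotopy from f to g. A Nielsen equivalence for F between manifolds at time 0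
gives one for f, by projecting W → [0,1] × X to X and sliding the time coordinate to 0
(`NielsenEquiv.of_slice`). Hence i₀ is injective. It maps S_p(f, Y) into the image of i₁, which is a
quotient of Ω_p(g⁻¹(Y)), and the inequality of ranks follows. This argument needs equality of
bordism classes to mean that a bordism exists. That is transitivity of bordism, so two fillings have
to be glued along a common boundary part (`Filling.glue`, `Bordism.mk_eq_mk`).

For (2), Ω_0(A) is free on the path components of A: points generate, points in one component are
bordant, and the signed count of points in each component is a bordism invariant
(`Bordism.degree_injective`). The invariance says that the signed boundary of a compact oriented
1-manifold has zero points, weighted by any locally constant function. It is proved without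
classifying 1-manifolds: a step function on a compact oriented 1-manifold has total jump zero, by
cutting it into pieces that live in charts (`sum_jumps_eq_zero`).

Consequently S'_0(f, Y) is free on the components of E(f) that meet C, and these are the classical
Nielsen classes (`nielsenRel_iff`). A homotopy does not merge distinct classes of its initial map,
so no cancellation occurs, and a combination of classes survives all homotopies exactly when each
class in its support does (`mem_nielsenGroup_iff`). Thus S_0(f, Y) is free on the essential classes.
-/

namespace HigherNielsen

/-! ### Smooth structure and orientation on a quotient locally modelled on an oriented manifold. -/

section Quotients

variable {E H : Type*} [NormedAddCommGroup E] [NormedSpace ℝ E] [TopologicalSpace H]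
  {I : ModelWithCorners ℝ E H} {M N P Q : Type*}
  [TopologicalSpace M] [ChartedSpace H M] [TopologicalSpace N] [ChartedSpace H N]
  [TopologicalSpace P] [ChartedSpace H P] [TopologicalSpace Q]

theorem units_sq_cast (s : ℤˣ) : (((s : ℤˣ) : ℤ) : ℝ) * (((s : ℤˣ) : ℤ) : ℝ) = 1 := by
  rcases Int.units_eq_one_or s with rfl | rfl <;> simp

theorem jac_id (x : M) : jac I (id : M → M) x = 1 := (ChartEq.id x).jac

/-- The local inverse of a local diffeomorphism, as a germ. -/
theorem exists_inverse_germ {f : M → N} {x : M} (hf : IsLocalDiffeomorphAt I I ∞ f x) :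
    ∃ g : N → M, IsLocalDiffeomorphAt I I ∞ g (f x) ∧ g (f x) = x ∧
      (∀ᶠ y in 𝓝 (f x), f (g y) = y) ∧ jac I g (f x) * jac I f x = 1 := by
  have hg := hf.localInverse_isLocalDiffeomorphAt
  have hx : hf.localInverse (f x) = x := hf.localInverse_left_inv hf.localInverse_mem_target
  refine ⟨hf.localInverse, hg, hx, hf.localInverse_eventuallyEq_right, ?_⟩
  rw [← jac_localDiffeo_comp hf hg, jac_congr hf.localInverse_eventuallyEq_left, jac_id]

/-- The Jacobian determinants of a map and of the coordinate changes satisfy the chain rule. -/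
theorem ChartEq.det_tangentCoordChange [IsManifold I ∞ M] [IsManifold I ∞ N] {f : M → N} {x₀ : M}
    (h : ChartEq H f x₀) : ∀ᶠ x in 𝓝 x₀,
      LinearMap.det (tangentCoordChange I (f x) (f x₀) (f x) : E →ₗ[ℝ] E) * HigherNielsen.jac I f x =
        LinearMap.det (tangentCoordChange I x x₀ x : E →ₗ[ℝ] E) := by
  have : IsManifold I 1 M := .of_le (n := ∞) (by simp)
  have : IsManifold I 1 N := .of_le (n := ∞) (by simp)
  have h1 : ∀ᶠ x in 𝓝 x₀, x ∈ (chartAt H x₀).source :=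
    (chartAt H x₀).open_source.mem_nhds (mem_chart_source H x₀)
  obtain ⟨Φ, hx₀, hΦ⟩ := h.isLocalDiffeomorphAt (I := I)
  have h3 : ∀ᶠ x in 𝓝 x₀, x ∈ Φ.source := Φ.open_source.mem_nhds hx₀
  filter_upwards [h.eventually_nhds, h1, h3] with x hx hx1 hx3
  have hd : MDifferentiableAt I I f x := mdiffAt_of_localDiffeo ⟨Φ, hx3, hΦ⟩
  have hfx : f x ∈ (chartAt H (f x₀)).source := hx.self_of_nhds.1
  have hc := hasFDerivWithinAt_tangentCoordChange (I := I) (x := f x) (y := f x₀) (z := f x)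
    ⟨mem_extChartAt_source _, by rwa [extChartAt_source]⟩
  have hc' := hasFDerivWithinAt_tangentCoordChange (I := I) (x := x) (y := x₀) (z := x)
    ⟨mem_extChartAt_source _, by rwa [extChartAt_source]⟩
  have hm : HasFDerivWithinAt (writtenInExtChartAt I I x f)
      (show E →L[ℝ] E from mfderiv I I f x) (range I) (extChartAt I x x) := hd.hasMFDerivAt.2
  have hval : writtenInExtChartAt I I x f (extChartAt I x x) = extChartAt I (f x) (f x) := by
    simp [writtenInExtChartAt]
  have hmaps : MapsTo (writtenInExtChartAt I I x f) (range I) (range I) := by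
    intro z _
    simp [writtenInExtChartAt, extChartAt]
  rw [← hval] at hc
  have hcomp := hc.comp _ hm hmaps
  have hu : UniqueDiffWithinAt ℝ (range I) (extChartAt I x x) :=
    I.uniqueDiffOn _ (extChartAt_target_subset_range x (mem_extChartAt_target x))
  have hT : Filter.Tendsto (extChartAt I x).symm (𝓝[range I] (extChartAt I x x)) (𝓝 x) := by
    have := (continuousAt_extChartAt_symm (I := I) x).tendsto
    rw [extChartAt_to_inv] at this
    exact this.mono_left nhdsWithin_le_nhds
  -- Because `f` is the identity in the preferred charts at `x₀` and `f x₀`, following it by the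
  -- coordinate change on the target gives the coordinate change on the source. Equality of
  -- determinants then follows from uniqueness of the derivative.
  have hev : (extChartAt I (f x₀) ∘ (extChartAt I (f x)).symm) ∘ writtenInExtChartAt I I x f
      =ᶠ[𝓝[range I] (extChartAt I x x)] extChartAt I x₀ ∘ (extChartAt I x).symm := by
    have h4 : ∀ᶠ y in 𝓝 x, f y ∈ (extChartAt I (f x)).source :=
      hd.continuousAt.eventually (extChartAt_source_mem_nhds (I := I) (f x))
    filter_upwards [hT.eventually hx, hT.eventually h4] with z hz hz4
    simp only [Function.comp_apply, writtenInExtChartAt]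
    rw [(extChartAt I (f x)).left_inv hz4]
    simp only [extChartAt_coe, Function.comp_apply, hz.2]
  have hEq := hcomp.congr_of_eventuallyEq hev.symm
    (hev.self_of_nhdsWithin (extChartAt_target_subset_range x (mem_extChartAt_target x))).symm
  have := hu.eq hEq hc'
  unfold HigherNielsen.jac
  rw [← LinearMap.det_comp, ← this]
  rfl

/-- A space `Q` that is locally modelled on an oriented manifold `P`: a map `π` from `P` to `Q` that
is a local homeomorphism on an open subset `D` with `π D = Q`, such that any two points of `D` with
the same image are related by the germ of an orientation preserving diffeomorphism over `Q`. -/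
structure EtaleData (I : ModelWithCorners ℝ E H) (P Q : Type*)
    [TopologicalSpace P] [ChartedSpace H P] [IsManifold I ∞ P] [TopologicalSpace Q]
    (o : MOrientation I P) where
  D : Set P
  isOpen : IsOpen D
  π : P → Q
  isLocalHomeomorphOn : IsLocalHomeomorphOn π D
  -- A section without any continuity. It selects the preferred chart and the sign at each point of
  -- `Q`.
  σ : Q → P
  σ_mem : ∀ q, σ q ∈ D
  π_σ : ∀ q, π (σ q) = q
  transition : ∀ u ∈ D, ∀ v ∈ D, π u = π v → ∃ g : P → P, IsLocalDiffeomorphAt I I ∞ g u ∧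
    g u = v ∧ (∀ᶠ u' in 𝓝 u, π (g u') = π u') ∧
    0 < (((o.sign v * o.sign u : ℤˣ) : ℤ) : ℝ) * jac I g u

namespace EtaleData

variable [IsManifold I ∞ P] {o : MOrientation I P} (G : EtaleData I P Q o)

/-- A local homeomorphism that agrees with `π` near a point of `D`. -/
def germ (u : G.D) : OpenPartialHomeomorph P Q :=
  (Classical.choose (G.isLocalHomeomorphOn u u.2)).restrOpen G.D G.isOpen

theorem coe_germ (u : G.D) : (G.germ u : P → Q) = G.π :=
  (Classical.choose_spec (G.isLocalHomeomorphOn u u.2)).2.symm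

theorem mem_germ_source (u : G.D) : u.1 ∈ (G.germ u).source :=
  ⟨(Classical.choose_spec (G.isLocalHomeomorphOn u u.2)).1, u.2⟩

theorem germ_source_subset (u : G.D) : (G.germ u).source ⊆ G.D := fun _ h => h.2

/-- The preferred chart of the quotient. -/
def chart (q : Q) : OpenPartialHomeomorph Q H :=
  (G.germ ⟨G.σ q, G.σ_mem q⟩).symm.trans (chartAt H (G.σ q))

theorem mem_chart_source (q : Q) : q ∈ (G.chart q).source := by
  have h := G.mem_germ_source ⟨G.σ q, G.σ_mem q⟩
  have h1 : G.germ ⟨G.σ q, G.σ_mem q⟩ (G.σ q) = q := by rw [coe_germ, G.π_σ]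
  have h2 := (G.germ ⟨G.σ q, G.σ_mem q⟩).map_source h
  have h3 := (G.germ ⟨G.σ q, G.σ_mem q⟩).left_inv h
  simp only at h2 h3
  rw [h1] at h2 h3
  refine ⟨h2, ?_⟩
  change (G.germ ⟨G.σ q, G.σ_mem q⟩).symm q ∈ (chartAt H (G.σ q)).source
  rw [h3]
  exact _root_.mem_chart_source H _

/-- The charts of the quotient. -/
@[reducible]
def chartedSpace : ChartedSpace H Q where
  atlas := range G.chart
  chartAt := G.chart
  mem_chart_source := G.mem_chart_source
  chart_mem_atlas := mem_range_self

/-- The change of charts lifts a point of `Q` in two ways. Near the given point the second lift is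
the image of the first under a germ supplied by `transition`, so smoothness is that of the germ,
read in charts of `P`. -/
theorem contDiffOn_transition (a b : Q) : ContDiffOn ℝ ∞
    (I ∘ (G.chart a).symm.trans (G.chart b) ∘ I.symm)
    (I.symm ⁻¹' ((G.chart a).symm.trans (G.chart b)).source ∩ range I) := by
  rintro _ ⟨hz, h, rfl⟩
  rw [mem_preimage, I.left_inv] at hz
  set ea := G.germ ⟨G.σ a, G.σ_mem a⟩ with hea
  set eb := G.germ ⟨G.σ b, G.σ_mem b⟩ with heb
  set ca := chartAt H (G.σ a)
  set cb := chartAt H (G.σ b)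
  obtain ⟨⟨hz1, hz2⟩, hz3, hz4⟩ := hz
  set u := ca.symm h with hu
  have hz1 : h ∈ ca.target := hz1
  have hz2 : u ∈ ea.source := hz2
  have hz3 : ea u ∈ eb.target := hz3
  have hz4 : eb.symm (ea u) ∈ cb.source := hz4
  have hπ : G.π u = G.π (eb.symm (ea u)) := by
    have := eb.right_inv hz3
    have h1 : (ea : P → Q) = G.π := G.coe_germ _
    have h2 : (eb : P → Q) = G.π := G.coe_germ _
    rw [h1] at this ⊢
    rw [h2] at this
    exact this.symm
  obtain ⟨g, hg, hgu, hgπ, -⟩ := G.transition u (G.germ_source_subset _ hz2) _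
    (G.germ_source_subset _ (eb.map_target hz3)) hπ
  have hus : u ∈ ca.source := ca.map_target hz1
  have hcg := hg.contMDiffAt
  rw [contMDiffAt_iff_of_mem_source (x := G.σ a) (y := G.σ b) hus (by rw [hgu]; exact hz4)] at hcg
  have hzz : extChartAt I (G.σ a) u = I h := by
    simp [extChartAt, u, ca, ca.right_inv hz1]
  rw [hzz] at hcg
  refine ContDiffWithinAt.mono (hcg.2.congr_of_eventuallyEq_of_mem ?_ ⟨h, rfl⟩) inter_subset_right
  have hT : Filter.Tendsto (ca.symm ∘ I.symm) (𝓝[range I] (I h)) (𝓝 u) := by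
    refine Filter.Tendsto.mono_left ?_ nhdsWithin_le_nhds
    have h1 : ContinuousAt ca.symm (I.symm (I h)) := by
      rw [I.left_inv]
      exact ca.symm.continuousAt hz1
    have := h1.comp I.continuous_symm.continuousAt
    rw [ContinuousAt, Function.comp_apply, I.left_inv] at this
    exact this
  have hev : ∀ᶠ u' in 𝓝 u, eb.symm (ea u') = g u' := by
    have h1 : ∀ᶠ u' in 𝓝 u, g u' ∈ eb.source := by
      refine hg.contMDiffAt.continuousAt.eventually (eb.open_source.mem_nhds ?_)
      rw [hgu]
      exact eb.map_target hz3
    filter_upwards [h1, hgπ] with u' hu' hu2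
    have h3 : ea u' = eb (g u') := by
      rw [hea, heb, coe_germ, coe_germ, hu2]
    rw [h3, eb.left_inv hu']
  filter_upwards [hT.eventually hev] with z hz
  exact congrArg (fun w => I (cb w)) hz

theorem isManifold : letI := G.chartedSpace; IsManifold I ∞ Q := by
  let _ := G.chartedSpace
  apply isManifold_of_contDiffOn
  rintro _ _ ⟨a, rfl⟩ ⟨b, rfl⟩
  exact G.contDiffOn_transition a b

/-- The chart at `q` was defined through the lift `σ q`, so `π` has Jacobian 1 there. All other
points of `D` are compared with this one. -/
theorem chartEq_σ (q : Q) : letI := G.chartedSpace; ChartEq H G.π (G.σ q) := by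
  let _ := G.chartedSpace
  have h1 : chartAt H (G.π (G.σ q)) = G.chart q := by
    rw [G.π_σ]
    rfl
  unfold ChartEq
  rw [h1]
  set e := G.germ ⟨G.σ q, G.σ_mem q⟩ with he
  filter_upwards [e.open_source.mem_nhds (G.mem_germ_source _),
    (chartAt H (G.σ q)).open_source.mem_nhds (_root_.mem_chart_source H _)] with u hu hu'
  have h2 : e.symm (G.π u) = u := by
    have := e.left_inv hu
    rwa [he, coe_germ, ← he] at this
  refine ⟨⟨?_, ?_⟩, ?_⟩
  · have := e.map_source hu
    rwa [he, coe_germ, ← he] at this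
  · change e.symm (G.π u) ∈ (chartAt H (G.σ q)).source
    rwa [h2]
  · change chartAt H (G.σ q) (e.symm (G.π u)) = _
    rw [h2]

/-- A transition germ moves `u` to the chosen lift of the same point. Differentiability and the sign
of the Jacobian of `π` at `u` are thereby reduced to those of the germ. -/
theorem exists_factor {u : P} (hu : u ∈ G.D) :
    ∃ g : P → P, IsLocalDiffeomorphAt I I ∞ g u ∧ g u = G.σ (G.π u) ∧
      (G.π =ᶠ[𝓝 u] G.π ∘ g) ∧
      0 < (((o.sign (G.σ (G.π u)) * o.sign u : ℤˣ) : ℤ) : ℝ) * jac I g u := by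
  obtain ⟨g, h1, h2, h3, h4⟩ := G.transition u hu _ (G.σ_mem (G.π u)) (G.π_σ _).symm
  exact ⟨g, h1, h2, h3.mono fun _ h => h.symm, h4⟩

theorem isLocalDiffeomorphAt {u : P} (hu : u ∈ G.D) : letI := G.chartedSpace
    IsLocalDiffeomorphAt I I ∞ G.π u := by
  let _ := G.chartedSpace
  have := G.isManifold
  obtain ⟨g, h1, h2, h3, -⟩ := G.exists_factor hu
  refine localDiffeo_congr (localDiffeo_comp h1 ?_) h3
  rw [h2]
  exact (G.chartEq_σ _).isLocalDiffeomorphAt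

theorem jac_pos {u : P} (hu : u ∈ G.D) : letI := G.chartedSpace
    0 < (((o.sign (G.σ (G.π u)) * o.sign u : ℤˣ) : ℤ) : ℝ) * jac I G.π u := by
  let _ := G.chartedSpace
  have := G.isManifold
  obtain ⟨g, h1, h2, h3, h4⟩ := G.exists_factor hu
  have h5 : jac I G.π (g u) = 1 := by
    rw [h2]
    exact (G.chartEq_σ _).jac
  have h6 : IsLocalDiffeomorphAt I I ∞ G.π (g u) := by
    rw [h2]
    exact (G.chartEq_σ _).isLocalDiffeomorphAt
  rw [jac_congr h3, jac_localDiffeo_comp h1 h6, h5, one_mul]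
  exact h4

/-- The orientation of the quotient. -/
def orientation : letI := G.chartedSpace; haveI := G.isManifold; MOrientation I Q :=
  letI := G.chartedSpace
  haveI := G.isManifold
  { sign := fun q => o.sign (G.σ q)
    coherent := by
      intro q
      have h1 := (G.chartEq_σ q).det_tangentCoordChange (I := I)
      have h2 := o.coherent (G.σ q)
      have h3 : ∀ᶠ u in 𝓝 (G.σ q), u ∈ G.D := G.isOpen.mem_nhds (G.σ_mem q)
      set e := G.germ ⟨G.σ q, G.σ_mem q⟩ with he
      have h4 : Filter.map G.π (𝓝 (G.σ q)) = 𝓝 q := by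
        have := e.map_nhds_eq (G.mem_germ_source ⟨G.σ q, G.σ_mem q⟩)
        rwa [he, coe_germ, G.π_σ] at this
      rw [← h4, Filter.eventually_map]
      filter_upwards [h1, h2, h3] with u hu1 hu2 hu3
      have hu4 := G.jac_pos hu3
      simp only [tangentCoordChange_def] at hu1
      rw [← hu1, G.π_σ] at hu2
      have hsq := units_sq_cast (o.sign u)
      have hmul := mul_pos hu2 hu4
      push_cast at hmul ⊢
      have hj : jac I G.π u ≠ 0 := by
        rintro h0
        rw [h0] at hu4
        simp at hu4
      -- Multiplied by the square of the Jacobian of `π`, the quantity becomes the product of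
      -- coherence upstairs and `jac_pos`; the sign at `u` occurs squared.
      refine (mul_pos_iff_of_pos_right (mul_self_pos.2 hj)).1 (hmul.trans_eq ?_)
      linear_combination ((o.sign (G.σ q) : ℤ) : ℝ) * ((o.sign (G.σ (G.π u)) : ℤ) : ℝ) *
        LinearMap.det (fderivWithin ℝ (extChartAt I q ∘ (extChartAt I (G.π u)).symm) (range I)
        (extChartAt I (G.π u) (G.π u)) : E →ₗ[ℝ] E) * (jac I G.π u * jac I G.π u) * hsq }

end EtaleData

end Quotients

/-! ### Hausdorff quotients and a criterion for local homeomorphisms. -/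

section PointSet

/-- The image of a compact Hausdorff space under a continuous closed surjection is Hausdorff. -/
theorem t2Space_of_isClosedMap {X Y : Type*} [TopologicalSpace X] [TopologicalSpace Y]
    [CompactSpace X] [T2Space X] {f : X → Y} (hc : Continuous f) (hf : IsClosedMap f)
    (hs : Function.Surjective f) : T2Space Y := by
  have hcl : ∀ y : Y, IsClosed (f ⁻¹' {y}) := by
    intro y
    obtain ⟨x, rfl⟩ := hs y
    have := hf _ (isClosed_singleton (x := x))
    rw [image_singleton] at this
    exact this.preimage hc
  refine ⟨fun x y hxy => ?_⟩
  obtain ⟨U, V, hU, hV, hxU, hyV, hUV⟩ := SeparatedNhds.of_isCompact_isCompact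
    (hcl x).isCompact (hcl y).isCompact
    (Disjoint.preimage f (disjoint_singleton.2 hxy))
  -- The fibres are disjoint compact sets with separating neighbourhoods `U` and `V`; the points
  -- whose whole fibre lies in `U`, respectively in `V`, form open sets because `f` is closed.
  refine ⟨(f '' Uᶜ)ᶜ, (f '' Vᶜ)ᶜ, (hf _ hU.isClosed_compl).isOpen_compl,
    (hf _ hV.isClosed_compl).isOpen_compl, ?_, ?_, ?_⟩
  · rintro ⟨z, hz, hzx⟩
    exact hz (hxU hzx)
  · rintro ⟨z, hz, hzy⟩
    exact hz (hyV hzy)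
  · rw [disjoint_left]
    intro z hz hz'
    obtain ⟨w, rfl⟩ := hs z
    have h1 : w ∈ U := by
      by_contra h
      exact hz ⟨w, h, rfl⟩
    have h2 : w ∈ V := by
      by_contra h
      exact hz' ⟨w, h, rfl⟩
    exact disjoint_left.1 hUV h1 h2

theorem isLocalHomeomorphOn_of_injOn {X Y : Type*} [TopologicalSpace X] [TopologicalSpace Y]
    {f : X → Y} {D : Set X} (hD : ∀ x ∈ D, ∃ U, IsOpen U ∧ x ∈ U ∧ U ⊆ D ∧ InjOn f U)
    (hc : ContinuousOn f D) (ho : ∀ U ⊆ D, IsOpen U → IsOpen (f '' U)) :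
    IsLocalHomeomorphOn f D := by
  apply IsLocalHomeomorphOn.mk
  intro x hx
  obtain ⟨U, hU, hxU, hUD, hinj⟩ := hD x hx
  have : Nonempty X := ⟨x⟩
  refine ⟨OpenPartialHomeomorph.ofContinuousOpenRestrict (hinj.bijOn_image.toPartialEquiv f U (f '' U))
    (hc.mono hUD) ?_ hU, hxU, fun y _ => rfl⟩
  have h1 : IsOpenMap (U.domRestrict f) := by
    intro A hA
    rw [domRestrict_eq, image_comp]
    refine ho _ ?_ (hU.isOpenMap_subtype_val A hA)
    exact (Subtype.coe_image_subset U A).trans hUD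
  exact h1

end PointSet

/-! ### Affine maps of the half line and the half-open cylinder. -/

section HalfLine

local notation "ℍ¹" => EuclideanHalfSpace 1

local notation "𝔼¹" => EuclideanSpace ℝ (Fin 1)

/-- The point of the half line with coordinate `max r 0`. -/
def halfPoint (r : ℝ) : ℍ¹ := ⟨WithLp.toLp 2 fun _ => max r 0, le_max_right _ _⟩

theorem halfPoint_val (r : ℝ) : (halfPoint r).val 0 = max r 0 := rfl

theorem halfPoint_val_of_nonneg {r : ℝ} (hr : 0 ≤ r) : (halfPoint r).val 0 = r := max_eq_left hr

theorem halfPoint_zero : halfPoint 0 = 0 :=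
  halfSpace_ext (max_self 0)

theorem continuous_halfPoint : Continuous halfPoint := by
  unfold halfPoint
  fun_prop

theorem continuous_half_val : Continuous fun h : ℍ¹ => h.val 0 := by
  fun_prop

/-- The standard orientation of the half line. -/
def halfOrient : MOrientation (𝓡∂ 1) ℍ¹ where
  sign _ := 1
  coherent x₀ := by
    filter_upwards with x
    have h1 : extChartAt (𝓡∂ 1) x₀ = extChartAt (𝓡∂ 1) x := by
      rw [extChartAt, extChartAt, chartAt_self_eq, chartAt_self_eq]
    have h2 : fderivWithin ℝ (extChartAt (𝓡∂ 1) x ∘ (extChartAt (𝓡∂ 1) x).symm) (range (𝓡∂ 1))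
        (extChartAt (𝓡∂ 1) x x) = ContinuousLinearMap.id ℝ 𝔼¹ := by
      ext1 v
      exact tangentCoordChange_self (I := 𝓡∂ 1) (mem_extChartAt_source x)
    rw [h1, h2]
    simp

/-- Every preferred chart of the half line is the identity, so a locally affine map is affine in
charts; smoothness and the derivative `b` can be read off. It is applied to the translation and the
reflection from which the tube around a seam is built. -/
theorem writtenInExtChartAt_affine {f : ℍ¹ → ℍ¹} {h : ℍ¹} {a b : ℝ}
    (hf : ∀ᶠ h' in 𝓝 h, (f h').val 0 = a + b * h'.val 0) :
    writtenInExtChartAt (𝓡∂ 1) (𝓡∂ 1) h f =ᶠ[𝓝[range (𝓡∂ 1)] (extChartAt (𝓡∂ 1) h h)]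
      fun z => WithLp.toLp 2 (fun _ => a) + b • z := by
  have hT : Filter.Tendsto (extChartAt (𝓡∂ 1) h).symm
      (𝓝[range (𝓡∂ 1)] (extChartAt (𝓡∂ 1) h h)) (𝓝 h) := by
    have := (continuousAt_extChartAt_symm (I := 𝓡∂ 1) h).tendsto
    rw [extChartAt_to_inv] at this
    exact this.mono_left nhdsWithin_le_nhds
  filter_upwards [hT.eventually hf, self_mem_nhdsWithin] with z hz hz'
  obtain ⟨h', rfl⟩ := hz'
  have h1 : (extChartAt (𝓡∂ 1) h).symm ((𝓡∂ 1) h') = h' := by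
    rw [extChartAt, chartAt_self_eq]
    exact (𝓡∂ 1).left_inv h'
  rw [h1] at hz
  rw [writtenInExtChartAt, Function.comp_apply, Function.comp_apply, h1]
  ext i
  fin_cases i
  exact hz

theorem continuousAt_of_affine {f : ℍ¹ → ℍ¹} {h : ℍ¹} {a b : ℝ}
    (hf : ∀ᶠ h' in 𝓝 h, (f h').val 0 = a + b * h'.val 0) : ContinuousAt f h := by
  have h1 : f =ᶠ[𝓝 h] fun h' => halfPoint (a + b * h'.val 0) := by
    filter_upwards [hf] with h' hh
    apply halfSpace_ext
    rw [halfPoint_val, ← hh, max_eq_left (f h').2]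
  refine ContinuousAt.congr ?_ h1.symm
  exact (continuous_halfPoint.comp
    (continuous_const.add (continuous_const.mul continuous_half_val))).continuousAt

theorem contMDiffAt_of_affine {f : ℍ¹ → ℍ¹} {h : ℍ¹} {a b : ℝ}
    (hf : ∀ᶠ h' in 𝓝 h, (f h').val 0 = a + b * h'.val 0) :
    ContMDiffAt (𝓡∂ 1) (𝓡∂ 1) ∞ f h := by
  rw [contMDiffAt_iff]
  refine ⟨continuousAt_of_affine hf, ?_⟩
  have h1 : ContDiff ℝ ∞ fun z : 𝔼¹ => WithLp.toLp 2 (fun _ => a) + b • z := by fun_prop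
  refine h1.contDiffWithinAt.congr_of_eventuallyEq_of_mem (writtenInExtChartAt_affine hf) ?_
  exact extChartAt_target_subset_range h (mem_extChartAt_target h)

theorem hasMFDerivAt_of_affine {f : ℍ¹ → ℍ¹} {h : ℍ¹} {a b : ℝ}
    (hf : ∀ᶠ h' in 𝓝 h, (f h').val 0 = a + b * h'.val 0) :
    HasMFDerivAt (𝓡∂ 1) (𝓡∂ 1) f h (b • ContinuousLinearMap.id ℝ 𝔼¹) := by
  refine ⟨continuousAt_of_affine hf, ?_⟩
  have h1 : HasFDerivWithinAt (fun z : 𝔼¹ => WithLp.toLp 2 (fun _ => a) + b • z)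
      (b • ContinuousLinearMap.id ℝ 𝔼¹) (range (𝓡∂ 1)) (extChartAt (𝓡∂ 1) h h) :=
    ((hasFDerivWithinAt_id _ _).const_smul b).const_add _
  refine h1.congr_of_eventuallyEq (writtenInExtChartAt_affine hf) ?_
  exact (writtenInExtChartAt_affine hf).self_of_nhdsWithin
    (extChartAt_target_subset_range h (mem_extChartAt_target h))

variable {p : ℕ} (T : ClosedManifold p)

theorem isLocalDiffeomorphAt_of_affine {f g : ℍ¹ → ℍ¹} {q : ℍ¹ × T.M} {a b a' b' : ℝ}
    (hf : ∀ᶠ h in 𝓝 q.1, (f h).val 0 = a + b * h.val 0)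
    (hg : ∀ᶠ h in 𝓝 (f q.1), (g h).val 0 = a' + b' * h.val 0)
    (hgf : ∀ᶠ h in 𝓝 q.1, g (f h) = h) (hfg : ∀ᶠ h in 𝓝 (f q.1), f (g h) = h) :
    IsLocalDiffeomorphAt (halfModel p) (halfModel p) ∞
      (fun q : ℍ¹ × T.M => (f q.1, q.2)) q := by
  obtain ⟨A, hA, hAo, hqA⟩ := eventually_nhds_iff.1 (hf.eventually_nhds.and hgf)
  obtain ⟨B, hB, hBo, hqB⟩ := eventually_nhds_iff.1 (hg.eventually_nhds.and hfg)
  have hfc : ContinuousOn f A := fun h hh =>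
    (continuousAt_of_affine (hA h hh).1).continuousWithinAt
  have hgc : ContinuousOn g B := fun h hh =>
    (continuousAt_of_affine (hB h hh).1).continuousWithinAt
  let φ : OpenPartialHomeomorph ℍ¹ ℍ¹ :=
    { toFun := f
      invFun := g
      source := A ∩ f ⁻¹' B
      target := B ∩ g ⁻¹' A
      map_source' := fun h hh => ⟨hh.2, by
        rw [mem_preimage, (hA h hh.1).2]
        exact hh.1⟩
      map_target' := fun h hh => ⟨hh.2, by
        rw [mem_preimage, (hB h hh.1).2]
        exact hh.1⟩
      left_inv' := fun h hh => (hA h hh.1).2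
      right_inv' := fun h hh => (hB h hh.1).2
      open_source := hfc.isOpen_inter_preimage hAo hBo
      open_target := hgc.isOpen_inter_preimage hBo hAo
      continuousOn_toFun := hfc.mono inter_subset_left
      continuousOn_invFun := hgc.mono inter_subset_left }
  let ψ := φ.prod (OpenPartialHomeomorph.refl T.M)
  refine ⟨⟨ψ.toPartialEquiv, ψ.open_source, ψ.open_target, ?_, ?_⟩,
    ⟨⟨hqA, hqB⟩, mem_univ _⟩, fun _ _ => rfl⟩
  · exact ContMDiffOn.prodMap (f := f) (s := A ∩ f ⁻¹' B)
      (fun h hh => (contMDiffAt_of_affine (hA h hh.1).1).contMDiffWithinAt) contMDiffOn_id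
  · exact ContMDiffOn.prodMap (f := g) (s := B ∩ g ⁻¹' A)
      (fun h hh => (contMDiffAt_of_affine (hB h hh.1).1).contMDiffWithinAt) contMDiffOn_id

theorem jac_of_affine {f : ℍ¹ → ℍ¹} {q : ℍ¹ × T.M} {a b : ℝ}
    (hf : ∀ᶠ h in 𝓝 q.1, (f h).val 0 = a + b * h.val 0) :
    jac (halfModel p) (fun q : ℍ¹ × T.M => (f q.1, q.2)) q = b := by
  have hd : HasMFDerivAt (halfModel p) (halfModel p) (fun q : ℍ¹ × T.M => (f q.1, q.2)) q
      ((b • ContinuousLinearMap.id ℝ 𝔼¹ : 𝔼¹ →L[ℝ] 𝔼¹).prodMap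
        (ContinuousLinearMap.id ℝ (EuclideanSpace ℝ (Fin p)))) := by
    have h := HasMFDerivAt.prodMap (p := q) (hasMFDerivAt_of_affine hf)
      (hasMFDerivAt_id (I := 𝓡 p) q.2)
    rw [(hasMFDerivAt_of_affine hf).mfderiv, mfderiv_id] at h
    exact h
  have := congrArg (fun A : 𝔼¹ × EuclideanSpace ℝ (Fin p) →L[ℝ] 𝔼¹ × EuclideanSpace ℝ (Fin p) =>
    LinearMap.det A.toLinearMap) hd.mfderiv
  refine this.trans ?_
  refine (LinearMap.det_prodMap (b • ContinuousLinearMap.id ℝ 𝔼¹ : 𝔼¹ →L[ℝ] 𝔼¹).toLinearMap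
    (LinearMap.id : EuclideanSpace ℝ (Fin p) →ₗ[ℝ] _)).trans ?_
  have h2 : (b • ContinuousLinearMap.id ℝ 𝔼¹ : 𝔼¹ →L[ℝ] 𝔼¹).toLinearMap =
    b • (LinearMap.id : 𝔼¹ →ₗ[ℝ] 𝔼¹) := rfl
  rw [h2, LinearMap.det_smul]
  simp

/-- The translation by `-1` of the half-open cylinder. -/
def cylShift (q : ℍ¹ × T.M) : ℍ¹ × T.M := (halfPoint (q.1.val 0 - 1), q.2)

/-- The reflection at `1` of the first coordinate of the half-open cylinder. -/
def cylFlip (q : ℍ¹ × T.M) : ℍ¹ × T.M := (halfPoint (1 - q.1.val 0), q.2)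

theorem eventually_shift {h : ℍ¹} (hh : 1 < h.val 0) :
    ∀ᶠ h' in 𝓝 h, (halfPoint (h'.val 0 - 1)).val 0 = -1 + 1 * h'.val 0 := by
  filter_upwards [continuous_half_val.continuousAt.eventually (lt_mem_nhds hh)] with h' hh'
  rw [halfPoint_val_of_nonneg (by linarith)]
  ring

theorem eventually_flip {h : ℍ¹} (hh : h.val 0 < 1) :
    ∀ᶠ h' in 𝓝 h, (halfPoint (1 - h'.val 0)).val 0 = 1 + (-1) * h'.val 0 := by
  filter_upwards [continuous_half_val.continuousAt.eventually (gt_mem_nhds hh)] with h' hh'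
  rw [halfPoint_val_of_nonneg (by linarith)]
  ring

theorem isLocalDiffeomorphAt_cylShift {q : ℍ¹ × T.M} (hq : 1 < q.1.val 0) :
    IsLocalDiffeomorphAt (halfModel p) (halfModel p) ∞ (cylShift T) q := by
  refine isLocalDiffeomorphAt_of_affine T (f := fun h => halfPoint (h.val 0 - 1))
    (g := fun h => halfPoint (h.val 0 + 1)) (a' := 1) (b' := 1) (eventually_shift hq) ?_ ?_ ?_
  · filter_upwards with h
    rw [halfPoint_val_of_nonneg (by linarith [h.2])]
    ring
  · filter_upwards [eventually_shift hq] with h hh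
    apply halfSpace_ext
    rw [hh, halfPoint_val_of_nonneg (by linarith [h.2])]
    ring
  · filter_upwards with h
    apply halfSpace_ext
    rw [halfPoint_val_of_nonneg (r := h.val 0 + 1) (by linarith [h.2]),
      halfPoint_val_of_nonneg (by linarith [h.2])]
    ring

/-- Both bounds matter: at coordinate 0 a boundary point would go to an interior point, and from
coordinate 1 on `halfPoint` truncates and injectivity is lost. -/
theorem isLocalDiffeomorphAt_cylFlip {q : ℍ¹ × T.M} (h0 : 0 < q.1.val 0) (hq : q.1.val 0 < 1) :
    IsLocalDiffeomorphAt (halfModel p) (halfModel p) ∞ (cylFlip T) q := by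
  have h1 : (halfPoint (1 - q.1.val 0)).val 0 < 1 := by
    rw [halfPoint_val_of_nonneg (by linarith)]
    linarith
  refine isLocalDiffeomorphAt_of_affine T (f := fun h => halfPoint (1 - h.val 0))
    (g := fun h => halfPoint (1 - h.val 0)) (eventually_flip hq) (eventually_flip h1) ?_ ?_
  · filter_upwards [eventually_flip hq] with h hh
    apply halfSpace_ext
    rw [hh, halfPoint_val_of_nonneg (by linarith [h.2])]
    ring
  · filter_upwards [eventually_flip h1] with h hh
    apply halfSpace_ext
    rw [hh, halfPoint_val_of_nonneg (by linarith [h.2])]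
    ring

theorem jac_cylShift {q : ℍ¹ × T.M} (hq : 1 < q.1.val 0) :
    jac (halfModel p) (cylShift T) q = 1 :=
  jac_of_affine T (eventually_shift hq)

theorem jac_cylFlip {q : ℍ¹ × T.M} (hq : q.1.val 0 < 1) :
    jac (halfModel p) (cylFlip T) q = -1 :=
  jac_of_affine T (eventually_flip hq)

theorem half_isBoundaryPoint_iff {h : ℍ¹} : (𝓡∂ 1).IsBoundaryPoint h ↔ h.val 0 = 0 := by
  rw [ModelWithCorners.isBoundaryPoint_iff, extChartAt, chartAt_self_eq]
  change (𝓡∂ 1) h ∈ frontier (range (𝓡∂ 1)) ↔ _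
  rw [frontier_range_modelWithCornersEuclideanHalfSpace]
  exact eq_comm

end HalfLine

/-! ### Topology of gluing two opposite boundary parts. -/

section Gluing

local notation "ℍ¹" => EuclideanHalfSpace 1

namespace Filling

variable {p : ℕ} {S R : ClosedManifold p}

theorem continuousOn_collar (V : Filling S) : ContinuousOn V.collar (collarDomain S) :=
  V.collar_diffeo.contMDiffOn.continuousOn

theorem zero_mem_collarDomain (x : S.M) : ((0 : ℍ¹), x) ∈ collarDomain S :=
  show (0 : ℝ) < 1 from one_pos

theorem continuous_bdry (V : Filling S) : Continuous V.bdry :=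
  V.continuousOn_collar.comp_continuous (by fun_prop) fun x => zero_mem_collarDomain x

/-- The collar of a part `R` of the boundary. -/
def subcollar (V : Filling S) (ι : R.M → S.M) (q : ℍ¹ × R.M) : V.W := V.collar (q.1, ι q.2)

section Subcollar

variable (V : Filling S) {ι : R.M → S.M} (hι : ∀ x, ChartEq (EuclideanSpace ℝ (Fin p)) ι x)

include hι

theorem isLocalDiffeomorphAt_subcollar {q : ℍ¹ × R.M} (hq : q.1.val 0 < 1) :
    IsLocalDiffeomorphAt (halfModel p) (halfModel p) ∞ (V.subcollar ι) q :=
  localDiffeo_comp ((hι q.2).prod q.1).isLocalDiffeomorphAt (V.collar_diffeo ⟨(q.1, ι q.2), hq⟩)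

theorem subcollar_orient {q : ℍ¹ × R.M} (hq : q.1.val 0 < 1) :
    (((V.orient.sign (V.subcollar ι q) * S.orient.sign (ι q.2) : ℤˣ) : ℤ) : ℝ) *
      jac (halfModel p) (V.subcollar ι) q < 0 := by
  have h1 := V.collar_orient (q.1, ι q.2) hq
  have h2 : jac (halfModel p) (V.subcollar ι) q =
      jac (halfModel p) V.collar (q.1, ι q.2) * _ :=
    jac_localDiffeo_comp ((hι q.2).prod q.1).isLocalDiffeomorphAt
      (V.collar_diffeo ⟨(q.1, ι q.2), hq⟩)
  rw [h2, ((hι q.2).prod q.1).jac, mul_one]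
  exact h1

theorem isOpen_image_subcollar {U : Set (ℍ¹ × R.M)} (hU : IsOpen U)
    (hU1 : ∀ q ∈ U, q.1.val 0 < 1) : IsOpen (V.subcollar ι '' U) := by
  rw [isOpen_iff_mem_nhds]
  rintro _ ⟨q, hq, rfl⟩
  obtain ⟨Φ, hqΦ, hΦ⟩ := V.isLocalDiffeomorphAt_subcollar hι (hU1 q hq)
  have h1 := Φ.toOpenPartialHomeomorph.image_mem_nhds hqΦ
    ((hU.inter Φ.open_source).mem_nhds ⟨hq, hqΦ⟩)
  have h2 : Φ.toOpenPartialHomeomorph q = V.subcollar ι q := (hΦ hqΦ).symm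
  rw [h2] at h1
  refine Filter.mem_of_superset h1 ?_
  rintro _ ⟨q', ⟨hq', hq2⟩, rfl⟩
  exact ⟨q', hq', hΦ hq2⟩

omit hι in
theorem subcollar_injective {R' : ClosedManifold p} {ι' : R'.M → S.M} {q : ℍ¹ × R.M}
    {q' : ℍ¹ × R'.M} (hq : q.1.val 0 < 1) (hq' : q'.1.val 0 < 1)
    (h : V.subcollar ι q = V.subcollar ι' q') : q.1 = q'.1 ∧ ι q.2 = ι' q'.2 := by
  have := V.collar_injOn (show (q.1, ι q.2) ∈ collarDomain S from hq)
    (show (q'.1, ι' q'.2) ∈ collarDomain S from hq') h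
  exact ⟨congrArg Prod.fst this, congrArg Prod.snd this⟩

theorem continuousAt_subcollar {q : ℍ¹ × R.M} (hq : q.1.val 0 < 1) :
    ContinuousAt (V.subcollar ι) q :=
  (V.isLocalDiffeomorphAt_subcollar hι hq).contMDiffAt.continuousAt

end Subcollar

variable {T : ClosedManifold p}

/-- The inclusions of the three parts of `S ⊔ (T ⊔ -T)`. -/
def partS (S T : ClosedManifold p) (x : S.M) : (S.sum (T.sum T.neg)).M := Sum.inl x

def partL (S T : ClosedManifold p) (x : T.M) : (S.sum (T.sum T.neg)).M := Sum.inr (Sum.inl x)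

def partR (S T : ClosedManifold p) (x : T.M) : (S.sum (T.sum T.neg)).M := Sum.inr (Sum.inr x)

theorem chartEq_partS (x : S.M) : ChartEq (EuclideanSpace ℝ (Fin p)) (partS S T) x :=
  chartEq_inl S (T.sum T.neg) x

theorem chartEq_partL (x : T.M) : ChartEq (EuclideanSpace ℝ (Fin p)) (partL S T) x :=
  (chartEq_inr S (T.sum T.neg) _).comp (chartEq_inl T T.neg x)

theorem chartEq_partR (x : T.M) : ChartEq (EuclideanSpace ℝ (Fin p)) (partR S T) x :=
  (chartEq_inr S (T.sum T.neg) _).comp (chartEq_inr T T.neg x)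

variable (V : Filling (S.sum (T.sum T.neg)))

/-- The collars of the three parts of the boundary. -/
def cS : ℍ¹ × S.M → V.W := V.subcollar (R := S) (partS S T)

def cL : ℍ¹ × T.M → V.W := V.subcollar (R := T) (partL S T)

def cR : ℍ¹ × T.M → V.W := V.subcollar (R := T) (partR S T)

theorem cL_inj {q q' : ℍ¹ × T.M} (hq : q.1.val 0 < 1) (hq' : q'.1.val 0 < 1)
    (h : V.cL q = V.cL q') : q = q' := by
  obtain ⟨h1, h2⟩ := V.subcollar_injective hq hq' h
  exact Prod.ext h1 (Sum.inl_injective (Sum.inr_injective h2))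

theorem cR_inj {q q' : ℍ¹ × T.M} (hq : q.1.val 0 < 1) (hq' : q'.1.val 0 < 1)
    (h : V.cR q = V.cR q') : q = q' := by
  obtain ⟨h1, h2⟩ := V.subcollar_injective hq hq' h
  exact Prod.ext h1 (Sum.inr_injective (Sum.inr_injective h2))

theorem cS_inj {q q' : ℍ¹ × S.M} (hq : q.1.val 0 < 1) (hq' : q'.1.val 0 < 1)
    (h : V.cS q = V.cS q') : q = q' := by
  obtain ⟨h1, h2⟩ := V.subcollar_injective hq hq' h
  exact Prod.ext h1 (Sum.inl_injective h2)

theorem cL_ne_cR {q q' : ℍ¹ × T.M} (hq : q.1.val 0 < 1) (hq' : q'.1.val 0 < 1) :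
    V.cL q ≠ V.cR q' := by
  intro h
  have := Sum.inr_injective (V.subcollar_injective hq hq' h).2
  exact absurd this (by simp)

theorem cS_ne_cL {q : ℍ¹ × S.M} {q' : ℍ¹ × T.M} (hq : q.1.val 0 < 1) (hq' : q'.1.val 0 < 1) :
    V.cS q ≠ V.cL q' := by
  intro h
  have := (V.subcollar_injective hq hq' h).2
  exact absurd this (by simp [partS, partL])

theorem cS_ne_cR {q : ℍ¹ × S.M} {q' : ℍ¹ × T.M} (hq : q.1.val 0 < 1) (hq' : q'.1.val 0 < 1) :
    V.cS q ≠ V.cR q' := by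
  intro h
  have := (V.subcollar_injective hq hq' h).2
  exact absurd this (by simp [partS, partR])

theorem half_zero_lt : (0 : ℍ¹).val 0 < 1 := one_pos

/-- The relation that identifies the two copies of `T` in the boundary. -/
def GlueRel (w w' : V.W) : Prop :=
  w = w' ∨ ∃ t : T.M, (w = V.cL (0, t) ∧ w' = V.cR (0, t)) ∨ (w = V.cR (0, t) ∧ w' = V.cL (0, t))

theorem glueRel_equivalence : Equivalence V.GlueRel where
  refl _ := Or.inl rfl
  symm := by
    rintro w w' (rfl | ⟨t, h | h⟩)
    · exact Or.inl rfl
    · exact Or.inr ⟨t, Or.inr h.symm⟩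
    · exact Or.inr ⟨t, Or.inl h.symm⟩
  trans := by
    rintro a b c (rfl | ⟨t, ⟨h1, h2⟩ | ⟨h1, h2⟩⟩) (rfl | ⟨t', ⟨h3, h4⟩ | ⟨h3, h4⟩⟩)
    · exact Or.inl rfl
    · exact Or.inr ⟨t', Or.inl ⟨h3, h4⟩⟩
    · exact Or.inr ⟨t', Or.inr ⟨h3, h4⟩⟩
    · exact Or.inr ⟨t, Or.inl ⟨h1, h2⟩⟩
    · exact absurd (h3.symm.trans h2) (V.cL_ne_cR half_zero_lt half_zero_lt)
    · have := V.cR_inj half_zero_lt half_zero_lt (h2.symm.trans h3)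
      rw [this] at h1
      exact Or.inl (h1.trans h4.symm)
    · exact Or.inr ⟨t, Or.inr ⟨h1, h2⟩⟩
    · have := V.cL_inj half_zero_lt half_zero_lt (h2.symm.trans h3)
      rw [this] at h1
      exact Or.inl (h1.trans h4.symm)
    · exact absurd (h2.symm.trans h3) (V.cL_ne_cR half_zero_lt half_zero_lt)

/-- The result of gluing the two copies of `T` in the boundary. -/
def Glued := Quotient (⟨V.GlueRel, V.glueRel_equivalence⟩ : Setoid V.W)

instance : TopologicalSpace V.Glued := inferInstanceAs (TopologicalSpace (Quotient _))

instance : CompactSpace V.Glued := inferInstanceAs (CompactSpace (Quotient _))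

/-- The projection to the glued space. -/
def glueMk (w : V.W) : V.Glued := Quotient.mk _ w

theorem isQuotientMap_glueMk : Topology.IsQuotientMap V.glueMk := isQuotientMap_quotient_mk'

theorem glueMk_eq {w w' : V.W} : V.glueMk w = V.glueMk w' ↔ V.GlueRel w w' := Quotient.eq

theorem glueMk_cL_cR (t : T.M) : V.glueMk (V.cL (0, t)) = V.glueMk (V.cR (0, t)) :=
  V.glueMk_eq.2 (Or.inr ⟨t, Or.inl ⟨rfl, rfl⟩⟩)

theorem continuous_cL_zero : Continuous fun t : T.M => V.cL (0, t) :=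
  V.continuous_bdry.comp (continuous_inr.comp continuous_inl)

theorem continuous_cR_zero : Continuous fun t : T.M => V.cR (0, t) :=
  V.continuous_bdry.comp (continuous_inr.comp continuous_inr)

/-- The projection is closed: the saturation of a closed set `A` adds to it only the transfers of
its traces on the two copies of `T`, and these are compact. -/
instance : T2Space V.Glued := by
  refine t2Space_of_isClosedMap V.isQuotientMap_glueMk.continuous ?_
    V.isQuotientMap_glueMk.surjective
  intro A hA
  rw [← V.isQuotientMap_glueMk.isClosed_preimage]
  have h1 : V.glueMk ⁻¹' (V.glueMk '' A) = A ∪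
      (fun t : T.M => V.cR (0, t)) '' ((fun t : T.M => V.cL (0, t)) ⁻¹' A) ∪
      (fun t : T.M => V.cL (0, t)) '' ((fun t : T.M => V.cR (0, t)) ⁻¹' A) := by
    ext w
    constructor
    · rintro ⟨a, ha, haw⟩
      rcases V.glueMk_eq.1 haw with rfl | ⟨t, ⟨rfl, rfl⟩ | ⟨rfl, rfl⟩⟩
      · exact Or.inl (Or.inl ha)
      · exact Or.inl (Or.inr ⟨t, ha, rfl⟩)
      · exact Or.inr ⟨t, ha, rfl⟩
    · rintro ((hw | ⟨t, ht, rfl⟩) | ⟨t, ht, rfl⟩)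
      · exact ⟨w, hw, rfl⟩
      · exact ⟨_, ht, V.glueMk_cL_cR t⟩
      · exact ⟨_, ht, (V.glueMk_cL_cR t).symm⟩
  rw [h1]
  refine (hA.union ?_).union ?_
  · exact ((hA.preimage V.continuous_cL_zero).isCompact.image V.continuous_cR_zero).isClosed
  · exact ((hA.preimage V.continuous_cR_zero).isCompact.image V.continuous_cL_zero).isClosed

/-- The complement of the two copies of `T`. -/
def away : Set V.W := (range (fun t : T.M => V.cL (0, t)) ∪ range (fun t : T.M => V.cR (0, t)))ᶜ

theorem isOpen_away : IsOpen V.away :=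
  ((isCompact_range V.continuous_cL_zero).isClosed.union
    (isCompact_range V.continuous_cR_zero).isClosed).isOpen_compl

theorem eq_of_glueRel {w w' : V.W} (hw : w ∈ V.away) (h : V.GlueRel w w') : w = w' := by
  rcases h with rfl | ⟨t, ⟨rfl, -⟩ | ⟨rfl, -⟩⟩
  · rfl
  · exact absurd (Or.inl ⟨t, rfl⟩) hw
  · exact absurd (Or.inr ⟨t, rfl⟩) hw

theorem cS_mem_away {q : ℍ¹ × S.M} (hq : q.1.val 0 < 1) : V.cS q ∈ V.away := by
  rintro (⟨t, ht⟩ | ⟨t, ht⟩)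
  · exact V.cS_ne_cL hq half_zero_lt ht.symm
  · exact V.cS_ne_cR hq half_zero_lt ht.symm

/-- The tube around the image of `T` in the glued space, with coordinate in `(0, 2)`. -/
def tubeMap (q : ℍ¹ × T.M) : V.W :=
  -- The seam is at coordinate 1 and is assigned to the left collar. Above 1 the tube runs into the
  -- left collar, and below 1 it runs backwards through the right collar.
  if 1 ≤ q.1.val 0 then V.cL (cylShift T q) else V.cR (cylFlip T q)

theorem tubeMap_of_ge {q : ℍ¹ × T.M} (hq : 1 ≤ q.1.val 0) : V.tubeMap q = V.cL (cylShift T q) :=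
  if_pos hq

theorem tubeMap_of_lt {q : ℍ¹ × T.M} (hq : q.1.val 0 < 1) : V.tubeMap q = V.cR (cylFlip T q) :=
  if_neg hq.not_ge

theorem cylShift_fst {q : ℍ¹ × T.M} (hq : 1 ≤ q.1.val 0) :
    (cylShift T q).1.val 0 = q.1.val 0 - 1 := halfPoint_val_of_nonneg (sub_nonneg.2 hq)

theorem cylFlip_fst {q : ℍ¹ × T.M} (hq : q.1.val 0 ≤ 1) :
    (cylFlip T q).1.val 0 = 1 - q.1.val 0 := halfPoint_val_of_nonneg (sub_nonneg.2 hq)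

/-- The domain of the tube. -/
def tubeDomain (T : ClosedManifold p) : Set (ℍ¹ × T.M) := {q | 0 < q.1.val 0 ∧ q.1.val 0 < 2}

theorem isOpen_tubeDomain : IsOpen (tubeDomain T) :=
  (isOpen_lt continuous_const (continuous_half_val.comp continuous_fst)).inter
    (isOpen_lt (continuous_half_val.comp continuous_fst) continuous_const)

theorem tubeMap_injOn : InjOn (fun q => V.glueMk (V.tubeMap q)) (tubeDomain T) := by
  -- The two halves of the tube do not meet: the lower half has strictly positive collar coordinate,
  -- so it misses the seam, and the two collars are disjoint.
  have key : ∀ q ∈ tubeDomain T, ∀ q' ∈ tubeDomain T, 1 ≤ q.1.val 0 → q'.1.val 0 < 1 →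
      V.glueMk (V.tubeMap q) ≠ V.glueMk (V.tubeMap q') := by
    intro q hq q' hq' h h' heq
    rw [V.tubeMap_of_ge h, V.tubeMap_of_lt h', V.glueMk_eq] at heq
    have h1 : (cylShift T q).1.val 0 < 1 := by
      rw [cylShift_fst h]
      linarith [hq.2]
    have h2 : (cylFlip T q').1.val 0 < 1 := by
      rw [cylFlip_fst h'.le]
      linarith [hq'.1]
    rcases heq with heq | ⟨t, ⟨-, heq⟩ | ⟨heq, -⟩⟩
    · exact V.cL_ne_cR h1 h2 heq
    · have := congrArg (fun q => q.1.val 0) (V.cR_inj h2 half_zero_lt heq)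
      simp only [cylFlip_fst h'.le] at this
      have h3 : (0 : ℍ¹).val 0 = 0 := rfl
      rw [h3] at this
      linarith
    · exact V.cL_ne_cR h1 half_zero_lt heq
  intro q hq q' hq' heq
  simp only at heq
  rcases le_or_gt 1 (q.1.val 0) with h | h <;> rcases le_or_gt 1 (q'.1.val 0) with h' | h'
  · rw [V.tubeMap_of_ge h, V.tubeMap_of_ge h', V.glueMk_eq] at heq
    have h1 : (cylShift T q).1.val 0 < 1 := by
      rw [cylShift_fst h]
      linarith [hq.2]
    have h2 : (cylShift T q').1.val 0 < 1 := by
      rw [cylShift_fst h']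
      linarith [hq'.2]
    rcases heq with heq | ⟨t, ⟨-, heq⟩ | ⟨heq, -⟩⟩
    · have h3 := V.cL_inj h1 h2 heq
      have h4 := congrArg (fun q => q.1.val 0) h3
      simp only [cylShift_fst h, cylShift_fst h'] at h4
      have h5 : (cylShift T q).2 = (cylShift T q').2 := congrArg Prod.snd h3
      exact Prod.ext (halfSpace_ext (by linarith)) h5
    · exact absurd heq (V.cL_ne_cR h2 half_zero_lt)
    · exact absurd heq (V.cL_ne_cR h1 half_zero_lt)
  · exact absurd heq (key q hq q' hq' h h')
  · exact absurd heq.symm (key q' hq' q hq h' h)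
  · rw [V.tubeMap_of_lt h, V.tubeMap_of_lt h', V.glueMk_eq] at heq
    have h1 : (cylFlip T q).1.val 0 < 1 := by
      rw [cylFlip_fst h.le]
      linarith [hq.1]
    have h2 : (cylFlip T q').1.val 0 < 1 := by
      rw [cylFlip_fst h'.le]
      linarith [hq'.1]
    rcases heq with heq | ⟨t, ⟨heq, -⟩ | ⟨-, heq⟩⟩
    · have h3 := V.cR_inj h1 h2 heq
      have h4 := congrArg (fun q => q.1.val 0) h3
      simp only [cylFlip_fst h.le, cylFlip_fst h'.le] at h4
      have h5 : (cylFlip T q).2 = (cylFlip T q').2 := congrArg Prod.snd h3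
      exact Prod.ext (halfSpace_ext (by linarith)) h5
    · exact absurd heq.symm (V.cL_ne_cR half_zero_lt h1)
    · exact absurd heq.symm (V.cL_ne_cR half_zero_lt h2)

theorem continuous_cylShift : Continuous (cylShift T) :=
  (continuous_halfPoint.comp
    ((continuous_half_val.comp continuous_fst).sub continuous_const)).prodMk continuous_snd

theorem continuous_cylFlip : Continuous (cylFlip T) :=
  (continuous_halfPoint.comp
    (continuous_const.sub (continuous_half_val.comp continuous_fst))).prodMk continuous_snd

theorem cylShift_eq_zero {q : ℍ¹ × T.M} (hq : q.1.val 0 = 1) : cylShift T q = (0, q.2) :=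
  Prod.ext (halfSpace_ext ((cylShift_fst hq.ge).trans (by rw [hq]; exact sub_self _))) rfl

theorem cylFlip_eq_zero {q : ℍ¹ × T.M} (hq : q.1.val 0 = 1) : cylFlip T q = (0, q.2) :=
  Prod.ext (halfSpace_ext ((cylFlip_fst hq.le).trans (by rw [hq]; exact sub_self _))) rfl

/-- Projecting to the glued space is essential: at coordinate 1 the two branches tend to `cL (0, t)`
and `cR (0, t)`, which become equal only there. -/
theorem continuousOn_tubeMap : ContinuousOn (fun q => V.glueMk (V.tubeMap q)) (tubeDomain T) := by
  have h0 : (fun q => V.glueMk (V.tubeMap q)) = fun q : ℍ¹ × T.M =>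
      if 1 ≤ q.1.val 0 then V.glueMk (V.cL (cylShift T q)) else V.glueMk (V.cR (cylFlip T q)) := by
    ext q
    exact apply_ite V.glueMk _ _ _
  rw [h0]
  have hval : Continuous fun q : ℍ¹ × T.M => q.1.val 0 := continuous_half_val.comp continuous_fst
  apply ContinuousOn.if
  · rintro q ⟨hq, hf⟩
    have h1 : q.1.val 0 = 1 := by
      have := frontier_le_subset_eq continuous_const hval hf
      exact (show 1 = q.1.val 0 from this).symm
    rw [cylShift_eq_zero h1, cylFlip_eq_zero h1]
    exact V.glueMk_cL_cR q.2
  · rintro q ⟨hq, hq'⟩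
    have h1 : 1 ≤ q.1.val 0 := by
      rwa [(isClosed_le continuous_const hval).closure_eq] at hq'
    have h2 : (cylShift T q).1.val 0 < 1 := by
      rw [cylShift_fst h1]
      linarith [hq.2]
    exact (V.isQuotientMap_glueMk.continuous.continuousAt.comp
      (ContinuousAt.comp (V.continuousAt_subcollar chartEq_partL h2)
        continuous_cylShift.continuousAt)).continuousWithinAt
  · rintro q ⟨hq, hq'⟩
    have h1 : q.1.val 0 ≤ 1 := by
      simp only [not_le] at hq'
      exact closure_lt_subset_le hval continuous_const hq'
    have h2 : (cylFlip T q).1.val 0 < 1 := by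
      rw [cylFlip_fst h1]
      linarith [hq.1]
    exact (V.isQuotientMap_glueMk.continuous.continuousAt.comp
      (ContinuousAt.comp (V.continuousAt_subcollar chartEq_partR h2)
        continuous_cylFlip.continuousAt)).continuousWithinAt

theorem isOpen_image_away {U : Set V.W} (hU : IsOpen U) (hUa : U ⊆ V.away) :
    IsOpen (V.glueMk '' U) := by
  rw [← V.isQuotientMap_glueMk.isOpen_preimage]
  convert hU using 1
  ext w
  constructor
  · rintro ⟨w', hw', h⟩
    rwa [← V.eq_of_glueRel (hUa hw') (V.glueMk_eq.1 h)]
  · exact fun h => ⟨w, h, rfl⟩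

/-- The preimage in `W` of the image is the union of an open set in the left collar and one in the
right collar. If `U` meets the seam, both contain the corresponding boundary points, although
`tubeMap` reaches only those on the left. -/
theorem isOpen_image_tube {U : Set (ℍ¹ × T.M)} (hU : IsOpen U) (hUt : U ⊆ tubeDomain T) :
    IsOpen ((fun q => V.glueMk (V.tubeMap q)) '' U) := by
  rw [← V.isQuotientMap_glueMk.isOpen_preimage]
  have hval : Continuous fun q : ℍ¹ × T.M => q.1.val 0 := continuous_half_val.comp continuous_fst
  have hsc : Continuous fun q : ℍ¹ × T.M => ((halfPoint (1 + q.1.val 0), q.2) : ℍ¹ × T.M) :=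
    (continuous_halfPoint.comp (continuous_const.add hval)).prodMk continuous_snd
  have hA : IsOpen (V.cL '' ({q : ℍ¹ × T.M | q.1.val 0 < 1} ∩
      {q | (halfPoint (1 + q.1.val 0), q.2) ∈ U})) :=
    V.isOpen_image_subcollar chartEq_partL
      ((isOpen_lt hval continuous_const).inter (hU.preimage hsc)) fun q hq => hq.1
  have hB : IsOpen (V.cR '' ({q : ℍ¹ × T.M | q.1.val 0 < 1} ∩ cylFlip T ⁻¹' U)) :=
    V.isOpen_image_subcollar chartEq_partR
      ((isOpen_lt hval continuous_const).inter (hU.preimage continuous_cylFlip)) fun q hq => hq.1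
  convert hA.union hB using 1
  have hflip : ∀ q : ℍ¹ × T.M, q.1.val 0 ≤ 1 → cylFlip T (cylFlip T q) = q := by
    intro q hq
    have h1 := cylFlip_fst hq
    refine Prod.ext (halfSpace_ext ?_) rfl
    rw [cylFlip_fst (by rw [h1]; linarith [q.1.2]), h1]
    ring
  have hshift : ∀ q : ℍ¹ × T.M, 1 ≤ q.1.val 0 →
      ((halfPoint (1 + (cylShift T q).1.val 0), (cylShift T q).2) : ℍ¹ × T.M) = q := by
    intro q hq
    have h1 := cylShift_fst hq
    refine Prod.ext (halfSpace_ext ?_) rfl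
    rw [h1, halfPoint_val_of_nonneg (by linarith)]
    ring
  ext w
  constructor
  · rintro ⟨q, hq, hqw⟩
    simp only at hqw
    rcases le_or_gt 1 (q.1.val 0) with h | h
    · rw [V.tubeMap_of_ge h, V.glueMk_eq] at hqw
      have h1 : (cylShift T q).1.val 0 < 1 := by
        rw [cylShift_fst h]
        linarith [(hUt hq).2]
      rcases hqw with rfl | ⟨t, ⟨h2, rfl⟩ | ⟨h2, -⟩⟩
      · refine Or.inl ⟨_, ⟨h1, ?_⟩, rfl⟩
        rw [mem_ofPred_eq, hshift q h]
        exact hq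
      -- Here `q` lies on the seam, and `w` is the boundary point of the right collar identified
      -- with its image.
      · have h3 := V.cL_inj h1 half_zero_lt h2
        refine Or.inr ⟨(0, t), ⟨half_zero_lt, ?_⟩, rfl⟩
        have h4 := hshift q h
        rw [h3] at h4
        rw [mem_preimage]
        have h5 : cylFlip T (0, t) = q := by
          rw [← h4]
          refine Prod.ext (halfSpace_ext ?_) rfl
          rw [cylFlip_fst half_zero_lt.le, halfPoint_val_of_nonneg (by
            linarith [(0 : ℍ¹).2])]
          change (1 : ℝ) - 0 = 1 + 0
          norm_num
        rwa [h5]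
      · exact absurd h2 (V.cL_ne_cR h1 half_zero_lt)
    · rw [V.tubeMap_of_lt h, V.glueMk_eq] at hqw
      have h1 : (cylFlip T q).1.val 0 < 1 := by
        rw [cylFlip_fst h.le]
        linarith [(hUt hq).1]
      rcases hqw with rfl | ⟨t, ⟨h2, -⟩ | ⟨h2, -⟩⟩
      · refine Or.inr ⟨_, ⟨h1, ?_⟩, rfl⟩
        rw [mem_preimage, hflip q h.le]
        exact hq
      · exact absurd h2.symm (V.cL_ne_cR half_zero_lt h1)
      · have h3 := congrArg (fun q => q.1.val 0) (V.cR_inj h1 half_zero_lt h2)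
        simp only [cylFlip_fst h.le] at h3
        have h4 : (0 : ℍ¹).val 0 = 0 := rfl
        rw [h4] at h3
        linarith
  · rintro (⟨q, ⟨hq1, hq2⟩, rfl⟩ | ⟨q, ⟨hq1, hq2⟩, rfl⟩)
    · refine ⟨_, hq2, ?_⟩
      have h0 : 0 ≤ q.1.val 0 := q.1.2
      have h1 : (halfPoint (1 + q.1.val 0)).val 0 = 1 + q.1.val 0 :=
        halfPoint_val_of_nonneg (by linarith)
      simp only
      rw [V.tubeMap_of_ge (by simp only [h1]; linarith)]
      congr 2
      refine Prod.ext (halfSpace_ext ?_) rfl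
      rw [cylShift_fst (by simp only [h1]; linarith)]
      simp only [h1]
      ring
    · refine ⟨_, hq2, ?_⟩
      have h0 : 0 ≤ q.1.val 0 := q.1.2
      have hq1 : q.1.val 0 < 1 := hq1
      simp only
      have h1 := cylFlip_fst hq1.le
      rcases h0.eq_or_lt with h | h
      · have h2 : q = (0, q.2) := Prod.ext (halfSpace_ext h.symm) rfl
        have h3 : (cylFlip T q).1.val 0 = 1 := by rw [h1, ← h, sub_zero]
        rw [V.tubeMap_of_ge h3.ge, cylShift_eq_zero h3, h2]
        exact V.glueMk_cL_cR q.2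
      · rw [V.tubeMap_of_lt (by rw [h1]; linarith), hflip q hq1.le]

end Filling

end Gluing

/-! ### Smooth structure of the glued manifold, and transitivity of bordism. -/

section Gluing

local notation "ℍ¹" => EuclideanHalfSpace 1

namespace Filling

variable {p : ℕ} {S T : ClosedManifold p} (V : Filling (S.sum (T.sum T.neg)))

/-- The disjoint union of which the glued manifold is an étale quotient. -/
abbrev Pieces := V.W ⊕ (ℍ¹ × T.M)

/-- The orientation of the pieces. -/
def piecesOrient : MOrientation (halfModel p) V.Pieces :=
  -- The sign is forced by the convention for collars. Above the seam the translation preserves and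
  -- the collar of `T` reverses orientation. Below it the reflection reverses, and the collar of
  -- `-T` preserves the orientation of the product with `T`. So the tube reverses the product
  -- orientation on both sides, which is why the boundary parts must be `T` and `-T`.
  V.orient.sum (halfOrient.prod T.orient).neg

/-- The projection of the pieces to the glued space. -/
def piecesMap : V.Pieces → V.Glued := Sum.elim V.glueMk fun q => V.glueMk (V.tubeMap q)

/-- The part of the pieces on which the projection is a local homeomorphism. -/
def piecesDomain : Set V.Pieces := Sum.inl '' V.away ∪ Sum.inr '' tubeDomain T

theorem isOpen_piecesDomain : IsOpen V.piecesDomain :=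
  (isOpenMap_inl _ V.isOpen_away).union (isOpenMap_inr _ isOpen_tubeDomain)

theorem piecesMap_isLocalHomeomorphOn : IsLocalHomeomorphOn V.piecesMap V.piecesDomain := by
  apply isLocalHomeomorphOn_of_injOn
  · rintro _ (⟨w, hw, rfl⟩ | ⟨q, hq, rfl⟩)
    · refine ⟨_, isOpenMap_inl _ V.isOpen_away, ⟨w, hw, rfl⟩, subset_union_left, ?_⟩
      rintro _ ⟨a, ha, rfl⟩ _ ⟨b, -, rfl⟩ h
      exact congrArg _ (V.eq_of_glueRel ha (V.glueMk_eq.1 h))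
    · refine ⟨_, isOpenMap_inr _ isOpen_tubeDomain, ⟨q, hq, rfl⟩, subset_union_right, ?_⟩
      rintro _ ⟨a, ha, rfl⟩ _ ⟨b, hb, rfl⟩ h
      exact congrArg _ (V.tubeMap_injOn ha hb h)
  · rintro _ (⟨w, hw, rfl⟩ | ⟨q, hq, rfl⟩)
    · have h1 : ContinuousAt V.piecesMap (Sum.inl w) := by
        rw [ContinuousAt, nhds_inl, Filter.tendsto_map'_iff]
        exact V.isQuotientMap_glueMk.continuous.continuousAt
      exact h1.continuousWithinAt
    · have h1 : ContinuousAt V.piecesMap (Sum.inr q) := by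
        rw [ContinuousAt, nhds_inr, Filter.tendsto_map'_iff]
        exact (V.continuousOn_tubeMap q hq).continuousAt (isOpen_tubeDomain.mem_nhds hq)
      exact h1.continuousWithinAt
  · intro U hU hUo
    have h1 : V.piecesMap '' U = V.glueMk '' (Sum.inl ⁻¹' U) ∪
        (fun q => V.glueMk (V.tubeMap q)) '' (Sum.inr ⁻¹' U) := by
      ext z
      constructor
      · rintro ⟨w | q, hw, rfl⟩
        · exact Or.inl ⟨w, hw, rfl⟩
        · exact Or.inr ⟨q, hw, rfl⟩
      · rintro (⟨w, hw, rfl⟩ | ⟨w, hw, rfl⟩)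
        · exact ⟨_, hw, rfl⟩
        · exact ⟨_, hw, rfl⟩
    rw [h1]
    refine (V.isOpen_image_away (hUo.preimage continuous_inl) ?_).union
      (V.isOpen_image_tube (hUo.preimage continuous_inr) ?_)
    · intro w hw
      obtain ⟨w', hw', h⟩ | ⟨q, -, h⟩ := hU hw
      · exact Sum.inl_injective h ▸ hw'
      · exact absurd h (by simp)
    · intro w hw
      obtain ⟨w', -, h⟩ | ⟨q, hq, h⟩ := hU hw
      · exact absurd h (by simp)
      · exact Sum.inr_injective h ▸ hq

theorem exists_mem_piecesDomain (z : V.Glued) : ∃ u ∈ V.piecesDomain, V.piecesMap u = z := by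
  obtain ⟨w, rfl⟩ := V.isQuotientMap_glueMk.surjective z
  have h1 : ∀ t : T.M, ((⟨halfPoint 1, t⟩ : ℍ¹ × T.M)).1.val 0 = 1 := fun t =>
    halfPoint_val_of_nonneg zero_le_one
  have h2 : ∀ t : T.M, ∃ u ∈ V.piecesDomain, V.piecesMap u = V.glueMk (V.cL (0, t)) := by
    intro t
    refine ⟨Sum.inr (halfPoint 1, t), Or.inr ⟨_, ⟨?_, ?_⟩, rfl⟩, ?_⟩
    · rw [h1]
      exact one_pos
    · rw [h1]
      exact one_lt_two
    · change V.glueMk (V.tubeMap _) = _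
      rw [V.tubeMap_of_ge (h1 t).ge, cylShift_eq_zero (h1 t)]
  by_cases hw : w ∈ V.away
  · exact ⟨Sum.inl w, Or.inl ⟨w, hw, rfl⟩, rfl⟩
  · rw [away, notMem_compl_iff] at hw
    rcases hw with ⟨t, rfl⟩ | ⟨t, rfl⟩
    · exact h2 t
    · simp only
      rw [← V.glueMk_cL_cR]
      exact h2 t

theorem tubeMap_eventuallyEq_of_gt {q : ℍ¹ × T.M} (hq : 1 < q.1.val 0) :
    V.tubeMap =ᶠ[𝓝 q] V.cL ∘ cylShift T := by
  have hval : Continuous fun q : ℍ¹ × T.M => q.1.val 0 := continuous_half_val.comp continuous_fst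
  filter_upwards [hval.continuousAt.eventually (lt_mem_nhds hq)] with q' hq'
  exact V.tubeMap_of_ge hq'.le

theorem tubeMap_eventuallyEq_of_lt {q : ℍ¹ × T.M} (hq : q.1.val 0 < 1) :
    V.tubeMap =ᶠ[𝓝 q] V.cR ∘ cylFlip T := by
  have hval : Continuous fun q : ℍ¹ × T.M => q.1.val 0 := continuous_half_val.comp continuous_fst
  filter_upwards [hval.continuousAt.eventually (gt_mem_nhds hq)] with q' hq'
  exact V.tubeMap_of_lt hq'

/-- Away from the middle, the tube is an orientation preserving local diffeomorphism. -/
theorem tubeMap_localDiffeo {q : ℍ¹ × T.M} (hq : q ∈ tubeDomain T) (h1 : q.1.val 0 ≠ 1) :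
    IsLocalDiffeomorphAt (halfModel p) (halfModel p) ∞ V.tubeMap q ∧
      0 < (((V.orient.sign (V.tubeMap q) * -T.orient.sign q.2 : ℤˣ) : ℤ) : ℝ) *
        jac (halfModel p) V.tubeMap q := by
  rcases h1.lt_or_gt with h | h
  · have h2 : (cylFlip T q).1.val 0 < 1 := by
      rw [cylFlip_fst h.le]
      linarith [hq.1]
    have hd := isLocalDiffeomorphAt_cylFlip T hq.1 h
    have hc : IsLocalDiffeomorphAt (halfModel p) (halfModel p) ∞ V.cR (cylFlip T q) :=
      V.isLocalDiffeomorphAt_subcollar chartEq_partR h2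
    refine ⟨localDiffeo_congr (localDiffeo_comp hd hc) (V.tubeMap_eventuallyEq_of_lt h), ?_⟩
    rw [jac_congr (V.tubeMap_eventuallyEq_of_lt h), jac_localDiffeo_comp hd hc, jac_cylFlip T h,
      V.tubeMap_of_lt h]
    have h3 : (((V.orient.sign (V.cR (cylFlip T q)) * -T.orient.sign q.2 : ℤˣ) : ℤ) : ℝ) *
      jac (halfModel p) V.cR (cylFlip T q) < 0 := V.subcollar_orient chartEq_partR h2
    linarith
  · have h2 : (cylShift T q).1.val 0 < 1 := by
      rw [cylShift_fst h.le]
      linarith [hq.2]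
    have hd := isLocalDiffeomorphAt_cylShift T h
    have hc : IsLocalDiffeomorphAt (halfModel p) (halfModel p) ∞ V.cL (cylShift T q) :=
      V.isLocalDiffeomorphAt_subcollar chartEq_partL h2
    refine ⟨localDiffeo_congr (localDiffeo_comp hd hc) (V.tubeMap_eventuallyEq_of_gt h), ?_⟩
    rw [jac_congr (V.tubeMap_eventuallyEq_of_gt h), jac_localDiffeo_comp hd hc, jac_cylShift T h,
      V.tubeMap_of_ge h.le]
    have h3 : (((V.orient.sign (V.cL (cylShift T q)) * T.orient.sign q.2 : ℤˣ) : ℤ) : ℝ) *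
      jac (halfModel p) V.cL (cylShift T q) < 0 := V.subcollar_orient chartEq_partL h2
    push_cast at h3 ⊢
    linarith

theorem tubeMap_mem_or {q : ℍ¹ × T.M} {w : V.W} (hw : w ∈ V.away)
    (h : V.glueMk w = V.glueMk (V.tubeMap q)) : w = V.tubeMap q ∧ q.1.val 0 ≠ 1 := by
  have h1 := V.eq_of_glueRel hw (V.glueMk_eq.1 h)
  refine ⟨h1, fun h2 => hw (Or.inl ⟨q.2, ?_⟩)⟩
  rw [h1, V.tubeMap_of_ge h2.ge, cylShift_eq_zero h2]

/-- The overlap of the tube with the rest of `W` avoids the seam, and there `tubeMap` itself is the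
required germ. -/
theorem pieces_transition_tube {q : ℍ¹ × T.M} {w : V.W} (hq : q ∈ tubeDomain T) (hw : w ∈ V.away)
    (h : V.glueMk w = V.glueMk (V.tubeMap q)) :
    ∃ g : V.Pieces → V.Pieces, IsLocalDiffeomorphAt (halfModel p) (halfModel p) ∞ g (Sum.inr q) ∧
    g (Sum.inr q) = Sum.inl w ∧ (∀ᶠ u' in 𝓝 (Sum.inr q), V.piecesMap (g u') = V.piecesMap u') ∧
    0 < (((V.piecesOrient.sign (Sum.inl w) * V.piecesOrient.sign (Sum.inr q) : ℤˣ) : ℤ) : ℝ) *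
      jac (halfModel p) g (Sum.inr q) := by
  obtain ⟨rfl, h1⟩ := V.tubeMap_mem_or hw h
  obtain ⟨hd, ho⟩ := V.tubeMap_localDiffeo hq h1
  have hp : ChartEq (HalfModel p) (Sum.elim (fun _ => q) id : V.Pieces → ℍ¹ × T.M) (Sum.inr q) :=
    ChartEq.elim_inr q
  have hi : ChartEq (HalfModel p) (Sum.inl : V.W → V.Pieces) (V.tubeMap q) := ChartEq.inl _
  refine ⟨Sum.inl ∘ V.tubeMap ∘ Sum.elim (fun _ => q) id, ?_, rfl, ?_, ?_⟩
  · exact localDiffeo_comp (localDiffeo_comp hp.isLocalDiffeomorphAt hd) hi.isLocalDiffeomorphAt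
  · rw [nhds_inr, Filter.eventually_map]
    exact Filter.Eventually.of_forall fun _ => rfl
  · rw [jac_sandwich hp hd hi]
    have : V.piecesOrient.sign (Sum.inr q) = -T.orient.sign q.2 := by
      change -(1 * T.orient.sign q.2) = _
      rw [one_mul]
    rw [this]
    exact ho

/-- Inside one piece the projection is injective, so the identity serves. Between the pieces
`tubeMap` or its local inverse does. -/
theorem pieces_transition (u : V.Pieces) (hu : u ∈ V.piecesDomain) (v : V.Pieces)
    (hv : v ∈ V.piecesDomain) (h : V.piecesMap u = V.piecesMap v) :
    ∃ g : V.Pieces → V.Pieces, IsLocalDiffeomorphAt (halfModel p) (halfModel p) ∞ g u ∧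
    g u = v ∧ (∀ᶠ u' in 𝓝 u, V.piecesMap (g u') = V.piecesMap u') ∧
    0 < (((V.piecesOrient.sign v * V.piecesOrient.sign u : ℤˣ) : ℤ) : ℝ) *
      jac (halfModel p) g u := by
  have hid : ∀ u : V.Pieces, ∃ g : V.Pieces → V.Pieces,
      IsLocalDiffeomorphAt (halfModel p) (halfModel p) ∞ g u ∧
      g u = u ∧ (∀ᶠ u' in 𝓝 u, V.piecesMap (g u') = V.piecesMap u') ∧
      0 < (((V.piecesOrient.sign u * V.piecesOrient.sign u : ℤˣ) : ℤ) : ℝ) *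
        jac (halfModel p) g u := by
    intro u
    refine ⟨id, (ChartEq.id u).isLocalDiffeomorphAt, rfl,
      Filter.Eventually.of_forall fun _ => rfl, ?_⟩
    rw [jac_id]
    simp
  obtain ⟨w, hw, rfl⟩ | ⟨q, hq, rfl⟩ := hu <;> obtain ⟨w', hw', rfl⟩ | ⟨q', hq', rfl⟩ := hv
  · rw [← V.eq_of_glueRel hw (V.glueMk_eq.1 h)]
    exact hid _
  · obtain ⟨g, hg, hgu, hgπ, ho⟩ := V.pieces_transition_tube hq' hw h
    obtain ⟨k, hk, hku, hkg, hj⟩ := exists_inverse_germ hg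
    rw [hgu] at hk hku hkg hj
    refine ⟨k, hk, hku, ?_, ?_⟩
    · have hkc := hk.contMDiffAt.continuousAt.tendsto
      rw [hku] at hkc
      filter_upwards [hkc.eventually hgπ, hkg] with y hy hy'
      rw [← hy, hy']
    · rw [mul_comm]
      have h0 : jac (halfModel p) g (Sum.inr q') ≠ 0 := right_ne_zero_of_mul_eq_one hj
      -- The Jacobian of the inverse germ times the square of that of `g` is the Jacobian of `g`,
      -- whose sign is known.
      refine (mul_pos_iff_of_pos_right (mul_self_pos.2 h0)).1 (ho.trans_eq ?_)
      rw [mul_comm (V.piecesOrient.sign (Sum.inr q'))]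
      linear_combination -((((V.piecesOrient.sign (Sum.inl w) * V.piecesOrient.sign (Sum.inr q') :
        ℤˣ) : ℤ) : ℝ)) * jac (halfModel p) g (Sum.inr q') * hj
  · exact V.pieces_transition_tube hq hw' h.symm
  · rw [← V.tubeMap_injOn hq hq' h]
    exact hid _

/-- The glued space as an étale quotient of its pieces. -/
def glueData : EtaleData (halfModel p) V.Pieces V.Glued V.piecesOrient where
  D := V.piecesDomain
  isOpen := V.isOpen_piecesDomain
  π := V.piecesMap
  isLocalHomeomorphOn := V.piecesMap_isLocalHomeomorphOn
  σ z := Classical.choose (V.exists_mem_piecesDomain z)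
  σ_mem z := (Classical.choose_spec (V.exists_mem_piecesDomain z)).1
  π_σ z := (Classical.choose_spec (V.exists_mem_piecesDomain z)).2
  transition u hu v hv h := V.pieces_transition u hu v hv h

instance : ChartedSpace (HalfModel p) V.Glued := V.glueData.chartedSpace

instance : IsManifold (halfModel p) ∞ V.Glued := V.glueData.isManifold

theorem glueMk_localDiffeo {w : V.W} (hw : w ∈ V.away) :
    IsLocalDiffeomorphAt (halfModel p) (halfModel p) ∞ V.glueMk w ∧
      0 < (((V.glueData.orientation.sign (V.glueMk w) * V.orient.sign w : ℤˣ) : ℤ) : ℝ) *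
        jac (halfModel p) V.glueMk w := by
  have hu : (Sum.inl w : V.Pieces) ∈ V.glueData.D := Or.inl ⟨w, hw, rfl⟩
  have hi : ChartEq (HalfModel p) (Sum.inl : V.W → V.Pieces) w := ChartEq.inl _
  have h1 : IsLocalDiffeomorphAt (halfModel p) (halfModel p) ∞ V.glueData.π (Sum.inl w) :=
    V.glueData.isLocalDiffeomorphAt hu
  have h2 : 0 < (((V.glueData.orientation.sign (V.glueMk w) * V.orient.sign w : ℤˣ) : ℤ) : ℝ) *
    jac (halfModel p) V.glueData.π (Sum.inl w) := V.glueData.jac_pos hu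
  have h3 : V.glueMk = V.glueData.π ∘ Sum.inl := rfl
  refine ⟨localDiffeo_comp (f := Sum.inl) (g := V.glueData.π) hi.isLocalDiffeomorphAt h1, ?_⟩
  have h4 : jac (halfModel p) V.glueMk w =
      jac (halfModel p) V.glueData.π (Sum.inl w) * jac (halfModel p) (Sum.inl : V.W → V.Pieces) w :=
    jac_localDiffeo_comp hi.isLocalDiffeomorphAt h1
  rw [h4, hi.jac, mul_one]
  exact h2

/-- Local diffeomorphisms preserve and reflect boundary points. The tube has positive coordinate and
so contributes none, and `away` omits exactly the boundary parts that were glued. -/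
theorem glued_boundary : (halfModel p).boundary V.Glued =
    range fun x : S.M => V.glueMk (V.cS (0, x)) := by
  ext z
  constructor
  · intro hz
    obtain ⟨u, hu, rfl⟩ := V.exists_mem_piecesDomain z
    have h1 : IsLocalDiffeomorphAt (halfModel p) (halfModel p) ∞ V.piecesMap u :=
      V.glueData.isLocalDiffeomorphAt hu
    have h2 : u ∈ (halfModel p).boundary V.Pieces := (h1.isBoundaryPoint_iff (by simp)).2 hz
    rw [ModelWithCorners.boundary_disjointUnion, V.collar_boundary] at h2
    rcases h2 with ⟨w, ⟨x, rfl⟩, rfl⟩ | ⟨q, hq, rfl⟩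
    · have hx : V.collar (0, x) ∈ V.away := by
        rcases hu with ⟨w, hw, h⟩ | ⟨q, -, h⟩
        · have h3 : w = V.collar (0, x) := Sum.inl_injective h
          exact h3 ▸ hw
        · exact absurd h (by simp)
      rcases x with x | x | x
      · exact ⟨x, rfl⟩
      · exact absurd (Or.inl ⟨x, rfl⟩) hx
      · exact absurd (Or.inr ⟨x, rfl⟩) hx
    · rw [ModelWithCorners.boundary_of_boundaryless_right] at hq
      have h3 := half_isBoundaryPoint_iff.1 hq.1
      rcases hu with ⟨w, hw, h⟩ | ⟨q', hq', h⟩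
      · exact absurd h (by simp)
      · rw [← Sum.inr_injective h] at h3
        exact absurd h3 hq'.1.ne'
  · rintro ⟨x, rfl⟩
    have h1 := (V.glueMk_localDiffeo (V.cS_mem_away (q := ((0 : ℍ¹), x)) half_zero_lt)).1
    refine (h1.isBoundaryPoint_iff (by simp)).1 ?_
    change _ ∈ (halfModel p).boundary V.W
    rw [V.collar_boundary]
    exact ⟨Sum.inl x, rfl⟩

/-- The filling that results from gluing the two copies of `T` in the boundary. -/
def glue : Filling S where
  W := V.Glued
  orient := V.glueData.orientation
  collar q := V.glueMk (V.cS q)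
  collar_diffeo q := localDiffeo_comp (V.isLocalDiffeomorphAt_subcollar chartEq_partS q.2)
    (V.glueMk_localDiffeo (V.cS_mem_away q.2)).1
  collar_injOn q hq q' hq' h :=
    V.cS_inj hq hq' (V.eq_of_glueRel (V.cS_mem_away hq) (V.glueMk_eq.1 h))
  collar_boundary := V.glued_boundary
  collar_orient q hq := by
    have hc : IsLocalDiffeomorphAt (halfModel p) (halfModel p) ∞ V.cS q :=
      V.isLocalDiffeomorphAt_subcollar chartEq_partS hq
    have h1 : (((V.orient.sign (V.cS q) * S.orient.sign q.2 : ℤˣ) : ℤ) : ℝ) *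
      jac (halfModel p) V.cS q < 0 := V.subcollar_orient chartEq_partS hq
    obtain ⟨h2, h3⟩ := V.glueMk_localDiffeo (V.cS_mem_away hq)
    have h4 : jac (halfModel p) (fun q => V.glueMk (V.cS q)) q =
        jac (halfModel p) V.glueMk (V.cS q) * jac (halfModel p) V.cS q :=
      jac_localDiffeo_comp hc h2
    rw [h4]
    have h5 := mul_neg_of_pos_of_neg h3 h1
    have hsq := units_sq_cast (V.orient.sign (V.cS q))
    push_cast at h5 ⊢
    refine h5.trans_eq' ?_
    linear_combination ((V.glueData.orientation.sign (V.glueMk (V.cS q)) : ℤ) : ℝ) *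
      ((S.orient.sign q.2 : ℤ) : ℝ) * jac (halfModel p) V.glueMk (V.cS q) *
      jac (halfModel p) V.cS q * hsq

end Filling

namespace SingularMfd

variable {p : ℕ} {A : Type*} [TopologicalSpace A]

/-- The pair `t`, `-t` cancels by gluing. The map on the filling descends to the glued space because
it takes the same values on both copies. -/
theorem Bounds.of_sum {s t : SingularMfd p A} (h : (s.sum (t.sum t.neg)).Bounds) : s.Bounds := by
  obtain ⟨V, k, hk⟩ := h
  let V' : Filling (s.dom.sum (t.dom.sum t.dom.neg)) := V
  have hL : ∀ x, k (V'.cL (0, x)) = t.map x := fun x => hk (Sum.inr (Sum.inl x))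
  have hR : ∀ x, k (V'.cR (0, x)) = t.map x := fun x => hk (Sum.inr (Sum.inr x))
  have hlift : ∀ a b : V'.W, V'.GlueRel a b → k a = k b := by
    rintro a b (rfl | ⟨x, ⟨rfl, rfl⟩ | ⟨rfl, rfl⟩⟩)
    · rfl
    · rw [hL, hR]
    · rw [hL, hR]
  refine ⟨V'.glue, ⟨Quotient.lift k hlift, Continuous.quotient_lift k.continuous hlift⟩, ?_⟩
  exact fun x => hk (Sum.inl x)

/-- The disjoint union of the two bordisms has the parts `s`, `-t`, `t`, `-r` in its boundary; after
rearrangement the middle pair cancels. -/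
theorem Bordant.trans {s t r : SingularMfd p A} (h : Bordant s t) (h' : Bordant t r) :
    Bordant s r := by
  refine Bounds.of_sum (t := t) ((Bounds.sum h h').congr
    (((ChartIso.refl (s.dom.sum r.dom.neg)).sum (ChartIso.comm t.dom t.dom.neg)).trans
      ((ChartIso.exchange s.dom r.dom.neg t.dom.neg t.dom).trans
        ((ChartIso.refl (s.dom.sum t.dom.neg)).sum (ChartIso.comm r.dom.neg t.dom)))) ?_)
  rintro ((x | x) | (x | x)) <;> rfl

theorem Bordant.symm {s t : SingularMfd p A} (h : Bordant s t) : Bordant t s := by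
  refine h.neg.congr (ChartIso.comm t.dom s.dom.neg |>.trans
    ((ChartIso.refl s.dom.neg).sum ⟨Homeomorph.refl t.dom.M, fun x => ChartEq.id x, fun x => ?_⟩)) ?_
  · exact neg_neg (t.dom.orient.sign x)
  · rintro (x | x) <;> rfl

end SingularMfd

/-- `Quot` only remembers the generated equivalence relation. Gluing makes bordism an equivalence
relation itself, so that equal classes yield an actual bordism. -/
theorem Bordism.mk_eq_mk {p : ℕ} {A : Type*} [TopologicalSpace A] {s t : SingularMfd p A} :
    Bordism.mk s = Bordism.mk t ↔ s.Bordant t :=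
  ⟨fun h => Equivalence.eqvGen_iff ⟨SingularMfd.bordant_refl, SingularMfd.Bordant.symm,
    SingularMfd.Bordant.trans⟩ |>.1 (Quot.eqvGen_exact h), fun h => Quot.sound h⟩

end Gluing

/-! ### Nielsen equivalence as bordism in the homotopy pullback, and the bound on the rank. -/

section Injectivity

variable {p : ℕ} {X X' Z : Type*} [TopologicalSpace X] [TopologicalSpace X'] [TopologicalSpace Z]

/-- The homotopy pullback of `f : X → Z` and the inclusion `Y → Z`. -/
abbrev HPullback (f : C(X, Z)) (Y : Set Z) :=
  {e : X × Y × C(unitInterval, Z) // e.2.2 0 = f e.1 ∧ e.2.2 1 = e.2.1}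

/-- The map from the preimage of `Y` to the homotopy pullback given by the constant paths. -/
def toHPullback (f : C(X, Z)) (Y : Set Z) : C(f ⁻¹' Y, HPullback f Y) where
  toFun x := ⟨(x, ⟨f x, x.2⟩, ContinuousMap.const _ (f x)), rfl, rfl⟩
  continuous_toFun := by
    refine Continuous.subtype_mk (continuous_subtype_val.prodMk (Continuous.prodMk ?_ ?_)) _
    · fun_prop
    · exact ContinuousMap.continuous_const'.comp (f.continuous.comp continuous_subtype_val)

/-- The maps `K`, `G` and the curried homotopy are the three coordinates of one map from `W` to the
homotopy pullback. The homotopy being relative to the boundary means that its paths over the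
boundary are constant, as `toHPullback` demands. -/
theorem NielsenEquiv.bordant {f : C(X, Z)} {Y : Set Z} {s t : SingularMfd p (f ⁻¹' Y)}
    (h : NielsenEquiv f Y s t) :
    (s.push (toHPullback f Y)).Bordant (t.push (toHPullback f Y)) := by
  obtain ⟨V, K, G, hK, hG, ⟨H⟩⟩ := h
  let k : C(V.W, C(unitInterval, Z)) := (H.toContinuousMap.comp ContinuousMap.prodSwap).curry
  have hk : ∀ w u, k w u = H (u, w) := fun _ _ => rfl
  refine ⟨V, ⟨fun w => ⟨(K w, G w, k w), ?_, ?_⟩, ?_⟩, ?_⟩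
  · exact H.apply_zero w
  · exact H.apply_one w
  · exact Continuous.subtype_mk (by fun_prop) _
  · have key : ∀ x, (⟨(K (V.bdry x), G (V.bdry x), k (V.bdry x)), H.apply_zero _, H.apply_one _⟩ :
        HPullback f Y) = toHPullback f Y ((s.sum t.neg).map x) := by
      intro x
      refine Subtype.ext (Prod.ext (hK x) (Prod.ext (Subtype.ext (hG x)) ?_))
      ext u
      have h1 := H.eq_fst u (mem_range_self x)
      rw [hk, h1, ContinuousMap.comp_apply, hK]
      rfl
    rintro (x | x)
    · exact key (Sum.inl x)
    · exact key (Sum.inr x)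

/-- The same correspondence read backwards, by uncurrying the path coordinate. -/
theorem NielsenEquiv.of_bordant {f : C(X, Z)} {Y : Set Z} {s t : SingularMfd p (f ⁻¹' Y)}
    (h : (s.push (toHPullback f Y)).Bordant (t.push (toHPullback f Y))) :
    NielsenEquiv f Y s t := by
  obtain ⟨V, k, hk⟩ := h
  have key : ∀ x, k (V.bdry x) = toHPullback f Y ((s.sum t.neg).map x) := by
    rintro (x | x)
    · exact hk (Sum.inl x)
    · exact hk (Sum.inr x)
  refine ⟨V, ⟨fun w => (k w).1.1, by fun_prop⟩, ⟨fun w => (k w).1.2.1, by fun_prop⟩, ?_, ?_, ⟨?_⟩⟩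
  · intro x
    exact congrArg (fun e => e.1.1) (key x)
  · intro x
    exact congrArg (fun e => (e.1.2.1 : Z)) (key x)
  · refine
      { toFun := fun q => (k q.2).1.2.2 q.1
        continuous_toFun := by fun_prop
        map_zero_left := fun w => (k w).2.1
        map_one_left := fun w => (k w).2.2
        prop' := ?_ }
    rintro u _ ⟨x, rfl⟩
    change (k (V.bdry x)).1.2.2 u = f (k (V.bdry x)).1.1
    rw [key x]
    rfl

/-- Nielsen equivalence with respect to a homotopy implies Nielsen equivalence with respect to its
initial map. -/
theorem NielsenEquiv.of_slice {F : C(unitInterval × X, Z)} {f : C(X, Z)} (hF : slice F 0 = f)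
    {Y : Set Z} {s t : SingularMfd p (f ⁻¹' Y)}
    (h : NielsenEquiv F Y (s.push (preimageMap Y (inclAt X 0) hF))
      (t.push (preimageMap Y (inclAt X 0) hF))) : NielsenEquiv f Y s t := by
  subst hF
  obtain ⟨V, K, G, hK, hG, hrel⟩ := h
  have hK' : ∀ x, K (V.bdry x) = (0, ((s.sum t.neg).map x : X)) := by
    rintro (x | x)
    · exact hK (Sum.inl x)
    · exact hK (Sum.inr x)
  refine ⟨V, ⟨fun w => (K w).2, by fun_prop⟩, G, ?_, ?_, ?_⟩
  · intro x
    exact congrArg Prod.snd (hK' x)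
  · rintro (x | x)
    · exact hG (Sum.inl x)
    · exact hG (Sum.inr x)
  · refine ContinuousMap.HomotopicRel.trans ⟨?_⟩ hrel
    refine
      -- The time coordinate of `K` is scaled from 0 to its actual value. On the boundary it is 0
      -- throughout, so the homotopy is relative to the boundary.
      { toFun := fun q => F (q.1 * (K q.2).1, (K q.2).2)
        continuous_toFun := by fun_prop
        map_zero_left := fun w => ?_
        map_one_left := fun w => ?_
        prop' := ?_ }
    · rw [zero_mul]
      rfl
    · rw [one_mul]
      rfl
    · rintro u _ ⟨x, rfl⟩
      change F (u * (K (V.bdry x)).1, (K (V.bdry x)).2) = F (0, (K (V.bdry x)).2)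
      have h1 : (K (V.bdry x)).1 = 0 := congrArg Prod.fst (hK' x)
      have h2 : u * (K (V.bdry x)).1 = 0 := (congrArg (u * ·) h1).trans (mul_zero u)
      exact congrArg (fun a => F (a, (K (V.bdry x)).2)) h2

theorem nielsenSubgroup_le_ker (f : C(X, Z)) (Y : Set Z) :
    nielsenSubgroup p f Y ≤ (Bordism.push (p := p) (toHPullback f Y)).ker := by
  rw [nielsenSubgroup, AddSubgroup.closure_le]
  rintro _ ⟨s, t, hst, rfl⟩
  rw [SetLike.mem_coe, AddMonoidHom.mem_ker, map_sub, sub_eq_zero]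
  exact Bordism.mk_eq_mk.2 hst.bordant

/-- The inclusion of the initial end of a homotopy is injective on Nielsen classes. -/
theorem PreNielsenGroup.map_inclAt_zero_injective {F : C(unitInterval × X, Z)} {f : C(X, Z)}
    (hF : slice F 0 = f) (Y : Set Z) : Function.Injective
      (PreNielsenGroup.map (p := p) (f' := F) Y (inclAt X 0) hF) := by
  rw [injective_iff_map_eq_zero]
  intro a ha
  obtain ⟨b, rfl⟩ := QuotientAddGroup.mk_surjective a
  obtain ⟨s, rfl⟩ : ∃ s, Bordism.mk s = b := Quot.exists_rep b
  let i := preimageMap (f' := F) Y (inclAt X 0) hF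
  have h1 : Bordism.push i (Bordism.mk s) ∈ nielsenSubgroup p F Y :=
    (QuotientAddGroup.eq_zero_iff _).1 ha
  -- Membership in the generated subgroup is hard to use directly, but it puts the class of `s` in
  -- the kernel of a map of bordism groups. So `s` is bordant in the homotopy pullback of `F` to the
  -- empty manifold, and hence Nielsen equivalent to it.
  have h2 := nielsenSubgroup_le_ker F Y h1
  rw [AddMonoidHom.mem_ker] at h2
  have h3 : Bordism.push (toHPullback F Y) (Bordism.push i
      (Bordism.mk (SingularMfd.empty p (f ⁻¹' Y)))) = 0 := by
    have : Bordism.mk (SingularMfd.empty p (f ⁻¹' Y)) = 0 := rfl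
    rw [this, map_zero, map_zero]
  have h4 : NielsenEquiv F Y (s.push i) ((SingularMfd.empty p (f ⁻¹' Y)).push i) :=
    NielsenEquiv.of_bordant (Bordism.mk_eq_mk.1 (h2.trans h3.symm))
  rw [QuotientAddGroup.eq_zero_iff]
  refine AddSubgroup.subset_closure ⟨s, SingularMfd.empty p _, h4.of_slice hF, ?_⟩
  exact (sub_zero _).symm

/-- For a single homotopy from `f` to `g`, the Nielsen group embeds through `i₀` in the range of
`i₁`, and the bordism group of the preimage under `g` maps onto that range. -/
theorem nielsenNumber_le_rank (Y : Set Z) {f g : C(X, Z)} (h : f.Homotopic g) :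
    nielsenNumber p f Y ≤ Module.rank ℤ (Bordism p (g ⁻¹' Y)) := by
  obtain ⟨H⟩ := h
  obtain ⟨F, h0, rfl⟩ : ∃ F : C(unitInterval × X, Z), slice F 0 = f ∧ slice F 1 = g :=
    ⟨H.toContinuousMap, ContinuousMap.ext fun x => H.apply_zero x,
      ContinuousMap.ext fun x => H.apply_one x⟩
  let i₀ : PreNielsenGroup p f Y →+ PreNielsenGroup p F Y :=
    PreNielsenGroup.map Y (inclAt X 0) h0
  let i₁ : PreNielsenGroup p (slice F 1) Y →+ PreNielsenGroup p F Y :=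
    PreNielsenGroup.map Y (inclAt X 1) rfl
  have hmem : ∀ a ∈ nielsenGroup p f Y, i₀ a ∈ i₁.range := by
    intro a ha
    exact (AddSubgroup.mem_comap.1 (AddSubgroup.mem_iInf.1 (AddSubgroup.mem_iInf.1 ha F) h0)).2
  let φ : nielsenGroup p f Y →+ i₁.range :=
    (i₀.comp (nielsenGroup p f Y).subtype).codRestrict i₁.range fun a => hmem a a.2
  have hφ : Function.Injective φ := by
    intro a b hab
    exact Subtype.ext (PreNielsenGroup.map_inclAt_zero_injective h0 Y (congrArg Subtype.val hab))
  let ψ : Bordism p (slice F 1 ⁻¹' Y) →+ i₁.range :=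
    i₁.rangeRestrict.comp (QuotientAddGroup.mk' (nielsenSubgroup p (slice F 1) Y))
  have hψ : Function.Surjective ψ :=
    i₁.rangeRestrict_surjective.comp (QuotientAddGroup.mk'_surjective _)
  exact (LinearMap.rank_le_of_injective φ.toIntLinearMap hφ).trans
    (ψ.toIntLinearMap.rank_le_of_surjective hψ)

end Injectivity

/-! ### Jumps of step functions on the line and on spaces with ordered charts. -/

section StepFunctions

open Filter

variable {W : Type*}

/-- `a x` is the limit of `g` along the filter `A x`, and is zero if this filter is trivial. -/
def OneSidedLimit (A : W → Filter W) (g a : W → ℤ) : Prop :=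
  -- At an end of a 1-manifold one side is missing. The value 0 there makes the end count as a jump
  -- by the full value of the function.
  ∀ x, (∀ᶠ w in A x, g w = a x) ∧ (A x = ⊥ → a x = 0)

theorem OneSidedLimit.eq_of_eventually {A : W → Filter W} {g a : W → ℤ} (h : OneSidedLimit A g a)
    {x : W} [(A x).NeBot] {c : ℤ} (hc : ∀ᶠ w in A x, g w = c) : a x = c := by
  obtain ⟨w, h1, h2⟩ := ((h x).1.and hc).exists
  exact h1.symm.trans h2

theorem OneSidedLimit.eq_zero {A : W → Filter W} {g a : W → ℤ} (h : OneSidedLimit A g a)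
    {x : W} (hc : ∀ᶠ w in A x, g w = 0) : a x = 0 := by
  rcases (A x).eq_or_neBot with h0 | h0
  · exact (h x).2 h0
  · exact h.eq_of_eventually hc

theorem OneSidedLimit.sub {A : W → Filter W} {g a g' a' : W → ℤ} (h : OneSidedLimit A g a)
    (h' : OneSidedLimit A g' a') : OneSidedLimit A (g - g') (a - a') := fun x =>
  ⟨by
    filter_upwards [(h x).1, (h' x).1] with w hw hw'
    rw [Pi.sub_apply, Pi.sub_apply, hw, hw'], fun h0 => by
    rw [Pi.sub_apply, (h x).2 h0, (h' x).2 h0, sub_zero]⟩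

open Classical in
theorem exists_oneSidedLimit {A : W → Filter W} {g : W → ℤ}
    (h : ∀ x, ∃ c, ∀ᶠ w in A x, g w = c) : ∃ a, OneSidedLimit A g a := by
  choose c hc using h
  refine ⟨fun x => if A x = ⊥ then 0 else c x, fun x => ⟨?_, fun h0 => if_pos h0⟩⟩
  by_cases h0 : A x = ⊥
  · rw [h0]
    exact eventually_bot
  · simpa only [if_neg h0] using hc x

variable [TopologicalSpace W]

/-- A local coordinate near `x₀` on a one-dimensional space such that `A x` and `B x` are the filters
of neighbourhoods to the right and to the left of `x`. -/
structure OrderChart (A B : W → Filter W) (x₀ : W) where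
  v : W → ℝ
  V : Set W
  isOpen : IsOpen V
  ψ : ℝ → W
  c : ℝ
  d : ℝ
  mem_V : x₀ ∈ V
  continuousOn_v : ContinuousOn v V
  injOn : InjOn v V
  continuousOn_ψ : ContinuousOn ψ (Icc c d)
  mapsTo : MapsTo ψ (Icc c d) V
  v_ψ : ∀ r ∈ Icc c d, v (ψ r) = r
  image_mem : ψ '' Icc c d ∈ 𝓝 x₀
  right_eq : ∀ x ∈ V, A x = 𝓝 x ⊓ 𝓟 {w | v x < v w}
  left_eq : ∀ x ∈ V, B x = 𝓝 x ⊓ 𝓟 {w | v w < v x}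
  -- Only the centre `x₀` can be an end.
  right_neBot : ∀ x ∈ V, x ≠ x₀ → (A x).NeBot
  left_neBot : ∀ x ∈ V, x ≠ x₀ → (B x).NeBot

namespace OrderChart

variable {A B : W → Filter W} {x₀ : W} (Φ : OrderChart A B x₀)

theorem right_le {x : W} (hx : x ∈ Φ.V) : A x ≤ 𝓝 x := (Φ.right_eq x hx).trans_le inf_le_left

theorem left_le {x : W} (hx : x ∈ Φ.V) : B x ≤ 𝓝 x := (Φ.left_eq x hx).trans_le inf_le_left

include Φ in
/-- The jumps of a step function are isolated. -/
theorem eventually_eq {g a b : W → ℤ} (ha : OneSidedLimit A g a) (hb : OneSidedLimit B g b) :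
    ∀ᶠ x in 𝓝 x₀, x ≠ x₀ → a x = b x := by
  have h1 := (ha x₀).1
  have h2 := (hb x₀).1
  rw [Φ.right_eq _ Φ.mem_V, eventually_inf_principal] at h1
  rw [Φ.left_eq _ Φ.mem_V, eventually_inf_principal] at h2
  filter_upwards [(h1.and h2).eventually_nhds, Φ.isOpen.mem_nhds Φ.mem_V] with x hx hxV hne
  have hR := Φ.right_neBot x hxV hne
  have hL := Φ.left_neBot x hxV hne
  have hc : ContinuousAt Φ.v x := Φ.continuousOn_v.continuousAt (Φ.isOpen.mem_nhds hxV)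
  have hv : Φ.v x ≠ Φ.v x₀ := fun h => hne (Φ.injOn hxV Φ.mem_V h)
  have key : ∃ c, ∀ᶠ w in 𝓝 x, g w = c := by
    rcases hv.lt_or_gt with h | h
    · refine ⟨b x₀, ?_⟩
      filter_upwards [hx, hc.eventually (gt_mem_nhds h)] with w hw hw' using hw.2 hw'
    · refine ⟨a x₀, ?_⟩
      filter_upwards [hx, hc.eventually (lt_mem_nhds h)] with w hw hw' using hw.1 hw'
  obtain ⟨c, hc⟩ := key
  rw [ha.eq_of_eventually (hc.filter_mono (Φ.right_le hxV)),
    hb.eq_of_eventually (hc.filter_mono (Φ.left_le hxV))]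

end OrderChart

theorem finite_support_of_eventually [CompactSpace W] {j : W → ℤ}
    (h : ∀ x₀, ∀ᶠ x in 𝓝 x₀, x ≠ x₀ → j x = 0) : j.support.Finite := by
  obtain ⟨t, -, ht⟩ := isCompact_univ.elim_nhds_subcover
    (fun x₀ => {x | x ≠ x₀ → j x = 0}) fun x₀ _ => h x₀
  refine t.finite_toSet.subset fun x hx => ?_
  obtain ⟨x₀, hx₀, hxx⟩ := mem_iUnion₂.1 (ht (mem_univ x))
  by_contra hxt
  exact hx (hxx fun h => hxt (h ▸ hx₀))

/-- The sum of the jumps of a compactly supported step function on the line is zero. -/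
theorem sum_jumps_real {g a b : ℝ → ℤ} {c d : ℝ} (ha : ∀ r, ∀ᶠ s in 𝓝[>] r, g s = a r)
    (hb : ∀ r, ∀ᶠ s in 𝓝[<] r, g s = b r) (h0 : ∀ r, r ∉ Icc c d → g r = 0) :
    ∑ᶠ r, (a r - b r) = 0 := by
  have hout : ∀ r, r ∉ Icc c d → a r = 0 ∧ b r = 0 := by
    intro r hr
    have h1 : ∀ᶠ s in 𝓝 r, g s = 0 := by
      filter_upwards [isClosed_Icc.isOpen_compl.mem_nhds hr] with s hs using h0 s hs
    constructor
    · obtain ⟨s, hs, hs'⟩ := ((ha r).and (h1.filter_mono nhdsWithin_le_nhds)).exists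
      exact hs.symm.trans hs'
    · obtain ⟨s, hs, hs'⟩ := ((hb r).and (h1.filter_mono nhdsWithin_le_nhds)).exists
      exact hs.symm.trans hs'
  have hright : ∀ r, ∀ᶠ s in 𝓝[>] r, a s = a r ∧ b s = a r := by
    intro r
    obtain ⟨u, hu, hru⟩ := mem_nhdsGT_iff_exists_Ioo_subset.1 (ha r)
    filter_upwards [Ioo_mem_nhdsGT hu] with s hs
    have h1 : ∀ᶠ s' in 𝓝 s, g s' = a r := by
      filter_upwards [Ioo_mem_nhds hs.1 hs.2] with s' hs' using hru hs'
    constructor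
    · obtain ⟨s', h2, h3⟩ := ((ha s).and (h1.filter_mono nhdsWithin_le_nhds)).exists
      exact h2.symm.trans h3
    · obtain ⟨s', h2, h3⟩ := ((hb s).and (h1.filter_mono nhdsWithin_le_nhds)).exists
      exact h2.symm.trans h3
  have hleft : ∀ r, ∀ᶠ s in 𝓝[<] r, a s = b r ∧ b s = b r := by
    intro r
    obtain ⟨u, hu, hru⟩ := mem_nhdsLT_iff_exists_Ioo_subset.1 (hb r)
    filter_upwards [Ioo_mem_nhdsLT hu] with s hs
    have h1 : ∀ᶠ s' in 𝓝 s, g s' = b r := by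
      filter_upwards [Ioo_mem_nhds hs.1 hs.2] with s' hs' using hru hs'
    constructor
    · obtain ⟨s', h2, h3⟩ := ((ha s).and (h1.filter_mono nhdsWithin_le_nhds)).exists
      exact h2.symm.trans h3
    · obtain ⟨s', h2, h3⟩ := ((hb s).and (h1.filter_mono nhdsWithin_le_nhds)).exists
      exact h2.symm.trans h3
  have hfin : (fun r => a r - b r).support.Finite := by
    obtain ⟨t, -, ht⟩ := isCompact_Icc.elim_nhds_subcover (s := Icc c d)
      (fun r => {s | s ≠ r → a s - b s = 0}) fun r _ => by
        have h1 := hright r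
        have h2 := hleft r
        rw [eventually_nhdsWithin_iff] at h1 h2
        filter_upwards [h1, h2] with s hs hs' hne
        rcases hne.lt_or_gt with h | h
        · rw [(hs' h).1, (hs' h).2, sub_self]
        · rw [(hs h).1, (hs h).2, sub_self]
    refine t.finite_toSet.subset fun r hr => ?_
    by_cases hrc : r ∈ Icc c d
    · obtain ⟨r', hr', hrr⟩ := mem_iUnion₂.1 (ht hrc)
      by_contra hrt
      exact hr (hrr fun h => hrt (h ▸ hr'))
    · exact absurd (by simp [hout r hrc]) hr
  let F := hfin.toFinset
  have hF : ∀ r, r ∉ F → a r = b r := by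
    intro r hr
    by_contra h
    exact hr (hfin.mem_toFinset.2 (sub_ne_zero.2 h))
  -- The sum of the jumps before `t`, minus the left limit at `t`. Passing `t` changes both terms by
  -- the jump at `t`, so this function is locally constant, hence constant. Far to the left it is 0,
  -- and far to the right it is the sum of all jumps.
  let Ψ : ℝ → ℤ := fun t => ∑ r ∈ F with r < t, (a r - b r) - b t
  have hsum : ∀ s t : ℝ, s ≤ t → (∑ r ∈ F with r < t, (a r - b r)) =
      (∑ r ∈ F with r < s, (a r - b r)) + ∑ r ∈ F with s ≤ r ∧ r < t, (a r - b r) := by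
    intro s t hst
    rw [← Finset.sum_union]
    · congr 1
      ext r
      simp only [Finset.mem_filter, Finset.mem_union]
      constructor
      · rintro ⟨h1, h2⟩
        rcases lt_or_ge r s with h | h
        · exact Or.inl ⟨h1, h⟩
        · exact Or.inr ⟨h1, h, h2⟩
      · rintro (⟨h1, h2⟩ | ⟨h1, h2, h3⟩)
        · exact ⟨h1, h2.trans_le hst⟩
        · exact ⟨h1, h3⟩
    · rw [Finset.disjoint_left]
      intro r hr hr'
      simp only [Finset.mem_filter] at hr hr'
      exact absurd hr.2 (not_lt.2 hr'.2.1)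
  have hloc : IsLocallyConstant Ψ := by
    rw [IsLocallyConstant.iff_eventually_eq]
    intro t
    have hisol : ∀ᶠ s in 𝓝 t, s ≠ t → ∀ r ∈ F, r ≠ t → (r < s ↔ r < t) := by
      have : ∀ r ∈ F, ∀ᶠ s in 𝓝 t, r ≠ t → (r < s ↔ r < t) := by
        intro r _
        rcases lt_trichotomy r t with h | h | h
        · filter_upwards [lt_mem_nhds h] with s hs _ using ⟨fun _ => h, fun _ => hs⟩
        · exact Eventually.of_forall fun s hs => absurd h hs
        · filter_upwards [gt_mem_nhds h] with s hs _
          exact ⟨fun h' => absurd h' hs.not_gt, fun h' => absurd h' h.not_gt⟩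
      filter_upwards [(Finset.eventually_all F).2 this] with s hs _ r hr using hs r hr
    have h1 := hright t
    have h2 := hleft t
    rw [eventually_nhdsWithin_iff] at h1 h2
    filter_upwards [hisol, h1, h2] with s hs hs1 hs2
    rcases lt_trichotomy s t with h | rfl | h
    · have h4 : ∑ r ∈ F with s ≤ r ∧ r < t, (a r - b r) = 0 := by
        rw [Finset.sum_filter]
        refine Finset.sum_eq_zero fun r hr => ?_
        split_ifs with h5
        · have := (hs h.ne r hr h5.2.ne).2 h5.2
          exact absurd this (not_lt.2 h5.1)
        · rfl
      simp only [Ψ]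
      rw [hsum s t h.le, h4, (hs2 h).2, add_zero]
    · rfl
    · have h4 : ∑ r ∈ F with t ≤ r ∧ r < s, (a r - b r) = a t - b t := by
        rw [Finset.sum_filter]
        by_cases htF : t ∈ F
        · rw [Finset.sum_eq_single_of_mem t htF]
          · rw [if_pos ⟨le_rfl, h⟩]
          · intro r hr hrt
            rw [if_neg]
            rintro ⟨h5, h6⟩
            exact absurd ((hs h.ne' r hr hrt).1 h6) (not_lt.2 h5)
        · rw [hF t htF, sub_self]
          refine Finset.sum_eq_zero fun r hr => if_neg ?_
          rintro ⟨h5, h6⟩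
          have hrt : r ≠ t := fun h => htF (h ▸ hr)
          exact absurd ((hs h.ne' r hr hrt).1 h6) (not_lt.2 h5)
      simp only [Ψ]
      rw [hsum t s h.le, h4, (hs1 h).2]
      ring
  obtain ⟨t₀, ht₀⟩ : ∃ t₀, t₀ < c ∧ t₀ < d ∧ ∀ r ∈ F, t₀ < r := by
    obtain ⟨m, hm⟩ := F.bddBelow
    refine ⟨min (min c d) m - 1, ?_, ?_, fun r hr => ?_⟩
    · linarith [min_le_left (min c d) m, min_le_left c d]
    · linarith [min_le_left (min c d) m, min_le_right c d]
    · linarith [min_le_right (min c d) m, hm hr]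
  obtain ⟨t₁, ht₁⟩ : ∃ t₁, c < t₁ ∧ d < t₁ ∧ ∀ r ∈ F, r < t₁ := by
    obtain ⟨m, hm⟩ := F.bddAbove
    refine ⟨max (max c d) m + 1, ?_, ?_, fun r hr => ?_⟩
    · linarith [le_max_left (max c d) m, le_max_left c d]
    · linarith [le_max_left (max c d) m, le_max_right c d]
    · linarith [le_max_right (max c d) m, hm hr]
  have h1 : Ψ t₀ = 0 := by
    simp only [Ψ]
    rw [(hout t₀ fun h => absurd h.1 (not_le.2 ht₀.1)).2, sub_zero, Finset.sum_filter]
    exact Finset.sum_eq_zero fun r hr => if_neg (not_lt.2 (ht₀.2.2 r hr).le)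
  have h2 : Ψ t₁ = ∑ r ∈ F, (a r - b r) := by
    simp only [Ψ]
    rw [(hout t₁ fun h => absurd h.2 (not_le.2 ht₁.2.1)).2, sub_zero, Finset.sum_filter]
    exact Finset.sum_congr rfl fun r hr => if_pos (ht₁.2.2 r hr)
  rw [finsum_eq_sum_of_support_subset (s := F) _ (by simp [F]), ← h2, ← h1]
  exact hloc.apply_eq_of_preconnectedSpace _ _

end StepFunctions

/-! ### The total jump on a compact one-dimensional space. -/

section StepFunctions

open Filter

variable {W : Type*} [TopologicalSpace W]

namespace OrderChart

variable {A B : W → Filter W} {x₀ : W} (Φ : OrderChart A B x₀)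

/-- The compact neighbourhood on which the coordinate takes values in `[c, d]`. -/
def interval : Set W := Φ.ψ '' Icc Φ.c Φ.d

theorem isClosed_interval [T2Space W] : IsClosed Φ.interval :=
  (isCompact_Icc.image_of_continuousOn Φ.continuousOn_ψ).isClosed

theorem mem_interval_iff {w : W} (hw : w ∈ Φ.V) : w ∈ Φ.interval ↔ Φ.v w ∈ Icc Φ.c Φ.d := by
  constructor
  · rintro ⟨r, hr, rfl⟩
    rwa [Φ.v_ψ r hr]
  · intro h
    exact ⟨_, h, Φ.injOn (Φ.mapsTo h) hw (Φ.v_ψ _ h)⟩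

/-- The chart with the opposite coordinate. -/
def reverse : OrderChart B A x₀ where
  v w := -Φ.v w
  V := Φ.V
  isOpen := Φ.isOpen
  ψ r := Φ.ψ (-r)
  c := -Φ.d
  d := -Φ.c
  mem_V := Φ.mem_V
  continuousOn_v := Φ.continuousOn_v.neg
  injOn _ hx _ hy h := Φ.injOn hx hy (neg_injective h)
  continuousOn_ψ := Φ.continuousOn_ψ.comp continuous_neg.continuousOn fun r hr =>
    ⟨le_neg.1 hr.2, neg_le.1 hr.1⟩
  mapsTo r hr := Φ.mapsTo ⟨le_neg.1 hr.2, neg_le.1 hr.1⟩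
  v_ψ r hr := by rw [Φ.v_ψ _ ⟨le_neg.1 hr.2, neg_le.1 hr.1⟩, neg_neg]
  image_mem := by
    refine mem_of_superset Φ.image_mem ?_
    rintro _ ⟨r, hr, rfl⟩
    exact ⟨-r, ⟨neg_le_neg hr.2, neg_le_neg hr.1⟩, congrArg Φ.ψ (neg_neg r)⟩
  right_eq x hx := by simpa only [neg_lt_neg_iff] using Φ.left_eq x hx
  left_eq x hx := by simpa only [neg_lt_neg_iff] using Φ.right_eq x hx
  right_neBot := Φ.left_neBot
  left_neBot := Φ.right_neBot

theorem interval_reverse : Φ.reverse.interval = Φ.interval := by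
  ext w
  constructor
  · rintro ⟨r, hr, rfl⟩
    exact ⟨-r, ⟨le_neg.1 hr.2, neg_le.1 hr.1⟩, rfl⟩
  · rintro ⟨r, hr, rfl⟩
    exact ⟨-r, ⟨neg_le_neg hr.2, neg_le_neg hr.1⟩, congrArg Φ.ψ (neg_neg r)⟩

/-- This is what allows a step function to be cut off by the indicator of the interval: one-sided
limits still exist, also at the two ends. -/
theorem eventually_mem_interval_or [T2Space W] (hA : ∀ x, A x ≤ 𝓝 x) (x : W) :
    (∀ᶠ w in A x, w ∈ Φ.interval) ∨ ∀ᶠ w in A x, w ∉ Φ.interval := by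
  by_cases hx : x ∈ Φ.interval
  · obtain ⟨r, hr, rfl⟩ := hx
    have hV := Φ.mapsTo hr
    have h1 : ∀ᶠ w in 𝓝 (Φ.ψ r), w ∈ Φ.V := Φ.isOpen.mem_nhds hV
    rw [Φ.right_eq _ hV, Φ.v_ψ r hr, eventually_inf_principal, eventually_inf_principal]
    rcases hr.2.lt_or_eq with h | rfl
    · left
      have hc : ContinuousAt Φ.v (Φ.ψ r) := Φ.continuousOn_v.continuousAt (Φ.isOpen.mem_nhds hV)
      have h2 : ∀ᶠ w in 𝓝 (Φ.ψ r), Φ.v w < Φ.d :=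
        hc.eventually (gt_mem_nhds (by rwa [Φ.v_ψ r hr]))
      filter_upwards [h1, h2] with w hw hw2 hw3
      exact (Φ.mem_interval_iff hw).2 ⟨hr.1.trans hw3.le, hw2.le⟩
    · right
      filter_upwards [h1] with w hw hw3 hwK
      exact absurd ((Φ.mem_interval_iff hw).1 hwK).2 (not_le.2 hw3)
  · right
    exact hA x (Φ.isClosed_interval.isOpen_compl.mem_nhds hx)

theorem limit_eq_zero [T2Space W] (hA : ∀ x, A x ≤ 𝓝 x) {g a : W → ℤ} (ha : OneSidedLimit A g a)
    (hg : ∀ x, x ∉ Φ.interval → g x = 0) {x : W} (hx : x ∉ Φ.interval) : a x = 0 := by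
  refine ha.eq_zero (Eventually.filter_mono (hA x) ?_)
  filter_upwards [Φ.isClosed_interval.isOpen_compl.mem_nhds hx] with w hw using hg w hw

/-- Extended by zero, the function becomes a step function on the line with the same one-sided
limits. At `d` this holds because `g` vanishes beyond the interval. -/
theorem eventually_right {g a : W → ℤ} (ha : OneSidedLimit A g a)
    (hg : ∀ x, x ∉ Φ.interval → g x = 0) (r : ℝ) :
    ∀ᶠ s in 𝓝[>] r, (Icc Φ.c Φ.d).indicator (g ∘ Φ.ψ) s =
      (Icc Φ.c Φ.d).indicator (a ∘ Φ.ψ) r := by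
  by_cases hr : r ∈ Icc Φ.c Φ.d
  · have hV := Φ.mapsTo hr
    rcases hr.2.lt_or_eq with h | rfl
    · have h1 : Tendsto Φ.ψ (𝓝[>] r) (A (Φ.ψ r)) := by
        rw [Φ.right_eq _ hV, Φ.v_ψ r hr, tendsto_inf, tendsto_principal]
        constructor
        · refine (Φ.continuousOn_ψ r hr).mono_left ?_
          rw [← nhdsWithin_Ioc_eq_nhdsGT h]
          exact nhdsWithin_mono _ fun s hs => ⟨hr.1.trans hs.1.le, hs.2⟩
        · filter_upwards [Ioo_mem_nhdsGT h] with s hs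
          rw [Φ.v_ψ s ⟨hr.1.trans hs.1.le, hs.2.le⟩]
          exact hs.1
      filter_upwards [h1.eventually (ha (Φ.ψ r)).1, Ioo_mem_nhdsGT h] with s hs hs'
      rw [indicator_of_mem hr, indicator_of_mem (show s ∈ Icc Φ.c Φ.d from
        ⟨hr.1.trans hs'.1.le, hs'.2.le⟩)]
      exact hs
    · have h1 : a (Φ.ψ Φ.d) = 0 := by
        apply ha.eq_zero
        rw [Φ.right_eq _ hV, Φ.v_ψ _ hr, eventually_inf_principal]
        filter_upwards [Φ.isOpen.mem_nhds hV] with w hw hw'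
        exact hg w fun hwK => absurd ((Φ.mem_interval_iff hw).1 hwK).2 (not_le.2 hw')
      filter_upwards [self_mem_nhdsWithin] with s hs
      rw [indicator_of_mem hr, indicator_of_notMem fun h => absurd h.2 (not_le.2 hs)]
      exact h1.symm
  · refine Eventually.filter_mono nhdsWithin_le_nhds ?_
    filter_upwards [isClosed_Icc.isOpen_compl.mem_nhds hr] with s hs
    rw [indicator_of_notMem hr, indicator_of_notMem hs]

theorem eventually_left {g b : W → ℤ} (hb : OneSidedLimit B g b)
    (hg : ∀ x, x ∉ Φ.interval → g x = 0) (r : ℝ) :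
    ∀ᶠ s in 𝓝[<] r, (Icc Φ.c Φ.d).indicator (g ∘ Φ.ψ) s =
      (Icc Φ.c Φ.d).indicator (b ∘ Φ.ψ) r := by
  have h1 := Φ.reverse.eventually_right hb (by rwa [Φ.interval_reverse]) (-r)
  have h2 : Tendsto (fun s : ℝ => -s) (𝓝[<] r) (𝓝[>] (-r)) := tendsto_neg_nhdsLT
  have h3 : ∀ (k : W → ℤ) (s : ℝ), (Icc Φ.reverse.c Φ.reverse.d).indicator (k ∘ Φ.reverse.ψ) (-s) =
      (Icc Φ.c Φ.d).indicator (k ∘ Φ.ψ) s := by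
    intro k s
    by_cases hs : s ∈ Icc Φ.c Φ.d
    · rw [indicator_of_mem hs, indicator_of_mem]
      · exact congrArg (fun s => k (Φ.ψ s)) (neg_neg s)
      · exact ⟨neg_le_neg hs.2, neg_le_neg hs.1⟩
    · rw [indicator_of_notMem hs, indicator_of_notMem]
      exact fun h => hs ⟨neg_le_neg_iff.1 h.2, neg_le_neg_iff.1 h.1⟩
  filter_upwards [h2.eventually h1] with s hs
  rwa [h3, h3] at hs

theorem sum_jumps [T2Space W] (hA : ∀ x, A x ≤ 𝓝 x) (hB : ∀ x, B x ≤ 𝓝 x) {g a b : W → ℤ}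
    (ha : OneSidedLimit A g a) (hb : OneSidedLimit B g b)
    (hg : ∀ x, x ∉ Φ.interval → g x = 0) : ∑ᶠ x, (a x - b x) = 0 := by
  have h0 := sum_jumps_real (Φ.eventually_right ha hg) (Φ.eventually_left hb hg)
    fun r hr => indicator_of_notMem hr _
  have h1 : (fun r => (Icc Φ.c Φ.d).indicator (a ∘ Φ.ψ) r - (Icc Φ.c Φ.d).indicator (b ∘ Φ.ψ) r) =
      (Icc Φ.c Φ.d).indicator fun r => a (Φ.ψ r) - b (Φ.ψ r) := by
    ext r
    by_cases hr : r ∈ Icc Φ.c Φ.d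
    · simp [indicator_of_mem hr]
    · simp [indicator_of_notMem hr]
  rw [h1, ← finsum_mem_def] at h0
  -- All jumps lie in the interval, on which the coordinate identifies them with the jumps on the
  -- line.
  have h2 : (fun x => a x - b x) = Φ.interval.indicator fun x => a x - b x := by
    ext x
    by_cases hx : x ∈ Φ.interval
    · rw [indicator_of_mem hx]
    · rw [indicator_of_notMem hx, Φ.limit_eq_zero hA ha hg hx,
        Φ.reverse.limit_eq_zero hB hb (by rwa [Φ.interval_reverse]) (by rwa [Φ.interval_reverse]),
        sub_self]
  rw [h2, ← finsum_mem_def, ← h0]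
  refine (finsum_mem_eq_of_bijOn Φ.ψ ⟨mapsTo_image _ _, ?_, surjOn_image _ _⟩ fun _ _ => rfl).symm
  intro r hr s hs h
  rw [← Φ.v_ψ r hr, h, Φ.v_ψ s hs]

end OrderChart

omit [TopologicalSpace W] in
theorem OneSidedLimit.exists_indicator {A : W → Filter W} {g a : W → ℤ} (ha : OneSidedLimit A g a)
    {U : Set W} (hU : ∀ x, (∀ᶠ w in A x, w ∈ U) ∨ ∀ᶠ w in A x, w ∉ U) :
    ∃ a', OneSidedLimit A (U.indicator g) a' := by
  refine exists_oneSidedLimit fun x => ?_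
  rcases hU x with h | h
  · refine ⟨a x, ?_⟩
    filter_upwards [h, (ha x).1] with w hw hw'
    rw [indicator_of_mem hw, hw']
  · refine ⟨0, ?_⟩
    filter_upwards [h] with w hw
    rw [indicator_of_notMem hw]

/-- The sum of the jumps of a step function on a compact one-dimensional space is zero. -/
theorem sum_jumps_eq_zero [CompactSpace W] [T2Space W] {A B : W → Filter W}
    (hΦ : ∀ x, Nonempty (OrderChart A B x)) {g a b : W → ℤ}
    (ha : OneSidedLimit A g a) (hb : OneSidedLimit B g b) : ∑ᶠ x, (a x - b x) = 0 := by
  have hA : ∀ x, A x ≤ 𝓝 x := fun x => (hΦ x).elim fun Φ => Φ.right_le Φ.mem_V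
  have hB : ∀ x, B x ≤ 𝓝 x := fun x => (hΦ x).elim fun Φ => Φ.left_le Φ.mem_V
  have hfin : ∀ {g a b : W → ℤ}, OneSidedLimit A g a → OneSidedLimit B g b →
      (fun x => a x - b x).support.Finite := by
    intro g a b ha hb
    refine finite_support_of_eventually fun x₀ => ?_
    obtain ⟨Φ⟩ := hΦ x₀
    filter_upwards [Φ.eventually_eq ha hb] with x hx hne
    rw [hx hne, sub_self]
  -- Induction over a compact cover. The property carried along is that a set lies in some `U` whose
  -- indicator preserves one-sided limits and for which step functions vanishing off `U` have total
  -- jump zero.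
  have key : ∃ U : Set W, univ ⊆ U ∧
      ((∀ x, (∀ᶠ w in A x, w ∈ U) ∨ ∀ᶠ w in A x, w ∉ U) ∧
        ∀ x, (∀ᶠ w in B x, w ∈ U) ∨ ∀ᶠ w in B x, w ∉ U) ∧
      ∀ g a b : W → ℤ, OneSidedLimit A g a → OneSidedLimit B g b → (∀ x, x ∉ U → g x = 0) →
        ∑ᶠ x, (a x - b x) = 0 := by
    refine IsCompact.induction_on isCompact_univ ?_ ?_ ?_ ?_
    · refine ⟨∅, Subset.rfl, ⟨fun x => Or.inr (by simp), fun x => Or.inr (by simp)⟩, ?_⟩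
      intro g a b ha hb hg
      have h1 : ∀ x, a x - b x = 0 := by
        intro x
        rw [ha.eq_zero (Eventually.of_forall fun w => hg w (notMem_empty w)),
          hb.eq_zero (Eventually.of_forall fun w => hg w (notMem_empty w)), sub_self]
      simp [h1]
    · rintro s t hst ⟨U, hU, h⟩
      exact ⟨U, hst.trans hU, h⟩
    · rintro s t ⟨U, hU, ⟨hUA, hUB⟩, hU0⟩ ⟨U', hU', ⟨hUA', hUB'⟩, hU0'⟩
      have hunion : ∀ l : Filter W, ((∀ᶠ w in l, w ∈ U) ∨ ∀ᶠ w in l, w ∉ U) →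
          ((∀ᶠ w in l, w ∈ U') ∨ ∀ᶠ w in l, w ∉ U') →
          (∀ᶠ w in l, w ∈ U ∪ U') ∨ ∀ᶠ w in l, w ∉ U ∪ U' := by
        rintro l (h | h) h'
        · exact Or.inl (h.mono fun w hw => Or.inl hw)
        · rcases h' with h' | h'
          · exact Or.inl (h'.mono fun w hw => Or.inr hw)
          · exact Or.inr ((h.and h').mono fun w hw hw' => hw'.elim hw.1 hw.2)
      refine ⟨U ∪ U', union_subset_union hU hU', ⟨fun x => hunion _ (hUA x) (hUA' x),
        fun x => hunion _ (hUB x) (hUB' x)⟩, ?_⟩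
      intro g a b ha hb hg
      obtain ⟨a', ha'⟩ := ha.exists_indicator hUA
      obtain ⟨b', hb'⟩ := hb.exists_indicator hUB
      have h1 := hU0 _ a' b' ha' hb' fun x hx => indicator_of_notMem hx g
      -- For a union the function is split into its restriction to `U` and the remainder, which
      -- vanishes off `U'`; jumps are additive.
      have h2 := hU0' _ _ _ (ha.sub ha') (hb.sub hb') fun x hx => by
        rw [Pi.sub_apply]
        by_cases hxU : x ∈ U
        · rw [indicator_of_mem hxU, sub_self]
        · rw [indicator_of_notMem hxU, hg x fun h => h.elim hxU hx, sub_self]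
      have h3 : ∀ x, a x - b x = (a' x - b' x) + ((a - a') x - (b - b') x) := by
        intro x
        simp only [Pi.sub_apply]
        ring
      rw [finsum_congr h3, finsum_add_distrib (hfin ha' hb') (hfin (ha.sub ha') (hb.sub hb')),
        h1, h2, add_zero]
    · intro x _
      obtain ⟨Φ⟩ := hΦ x
      refine ⟨Φ.interval, mem_nhdsWithin_of_mem_nhds Φ.image_mem, Φ.interval, Subset.rfl,
        ⟨Φ.eventually_mem_interval_or hA, fun x => ?_⟩, fun g a b ha hb hg => Φ.sum_jumps hA hB ha hb hg⟩
      rw [← Φ.interval_reverse]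
      exact Φ.reverse.eventually_mem_interval_or hB x
  obtain ⟨U, hU, -, h⟩ := key
  exact h g a b ha hb fun x hx => absurd (hU (mem_univ x)) hx

end StepFunctions

/-! ### Compact oriented 1-manifolds: the signed count of boundary points. -/

section OneManifolds

open Filter

local notation "𝔼¹" => EuclideanSpace ℝ (Fin 1)

local notation "𝔼⁰" => EuclideanSpace ℝ (Fin 0)

theorem norm_eq_abs_coord (z : 𝔼¹ × 𝔼⁰) : ‖z‖ = |z.1 0| := by
  rw [Prod.norm_def, Subsingleton.elim z.2 0, norm_zero, max_eq_left (norm_nonneg _),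
    EuclideanSpace.norm_eq]
  simp [Real.sqrt_sq_eq_abs]

theorem apply_eq_det_smul (D : 𝔼¹ × 𝔼⁰ →L[ℝ] 𝔼¹ × 𝔼⁰) (z : 𝔼¹ × 𝔼⁰) :
    D z = LinearMap.det (D : 𝔼¹ × 𝔼⁰ →ₗ[ℝ] 𝔼¹ × 𝔼⁰) • z := by
  have h1 : Module.finrank ℝ (𝔼¹ × 𝔼⁰) = 1 := by simp
  let v : 𝔼¹ × 𝔼⁰ := (WithLp.toLp 2 fun _ => 1, 0)
  have hv : ∀ z : 𝔼¹ × 𝔼⁰, z = z.1 0 • v := by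
    intro z
    refine Prod.ext ?_ (Subsingleton.elim _ _)
    ext i
    fin_cases i
    simp [v]
  obtain ⟨c, hc⟩ : ∃ c : ℝ, (D : 𝔼¹ × 𝔼⁰ →ₗ[ℝ] 𝔼¹ × 𝔼⁰) = c • LinearMap.id := by
    refine ⟨(D v).1 0, LinearMap.ext fun z => ?_⟩
    change D z = (D v).1 0 • z
    conv_lhs => rw [hv z, map_smul, hv (D v), smul_comm, ← hv z]
  have h2 : LinearMap.det (D : 𝔼¹ × 𝔼⁰ →ₗ[ℝ] 𝔼¹ × 𝔼⁰) = c := by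
    rw [hc, LinearMap.det_smul, h1]
    simp
  rw [h2]
  exact congrArg (fun A => A z) hc

/-- The sign of the derivative controls the sign of difference quotients. -/
theorem eventually_sign {φ : 𝔼¹ × 𝔼⁰ → 𝔼¹ × 𝔼⁰} {D : 𝔼¹ × 𝔼⁰ →L[ℝ] 𝔼¹ × 𝔼⁰} {s : Set (𝔼¹ × 𝔼⁰)}
    {z₀ : 𝔼¹ × 𝔼⁰} (h : HasFDerivWithinAt φ D s z₀)
    (hD : LinearMap.det (D : 𝔼¹ × 𝔼⁰ →ₗ[ℝ] 𝔼¹ × 𝔼⁰) ≠ 0) :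
    ∀ᶠ z in 𝓝[s] z₀, z.1 0 ≠ z₀.1 0 →
      0 < LinearMap.det (D : 𝔼¹ × 𝔼⁰ →ₗ[ℝ] 𝔼¹ × 𝔼⁰) *
        (((φ z).1 0 - (φ z₀).1 0) * (z.1 0 - z₀.1 0)) := by
  set c := LinearMap.det (D : 𝔼¹ × 𝔼⁰ →ₗ[ℝ] 𝔼¹ × 𝔼⁰) with hc
  -- With this tolerance the error of the linear approximation is at most half of the main term, so
  -- the main term decides the sign.
  have hpos : 0 < |c| / 2 := by positivity
  filter_upwards [h.isLittleO.def hpos] with z hz hne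
  rw [apply_eq_det_smul D, ← hc, norm_eq_abs_coord, norm_eq_abs_coord] at hz
  have hz' : |(φ z).1 0 - (φ z₀).1 0 - c * (z.1 0 - z₀.1 0)| ≤ |c| / 2 * |z.1 0 - z₀.1 0| := hz
  set a := (φ z).1 0 - (φ z₀).1 0
  set t := z.1 0 - z₀.1 0
  have ht : t ≠ 0 := sub_ne_zero.2 hne
  have h1 : |c * t * (a - c * t)| ≤ (c * t) ^ 2 / 2 := by
    rw [abs_mul, ← sq_abs (c * t), abs_mul]
    have := mul_le_mul_of_nonneg_left hz' (by positivity : 0 ≤ |c| * |t|)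
    linarith
  have h2 : 0 < (c * t) ^ 2 := by positivity
  have h3 := (abs_le.1 h1).1
  linarith

theorem halfModel_isBoundaryPoint_iff {W : Type*} [TopologicalSpace W] [ChartedSpace (HalfModel 0) W]
    {x : W} : (halfModel 0).IsBoundaryPoint x ↔ (chartAt (HalfModel 0) x x).1.val 0 = 0 := by
  rw [ModelWithCorners.isBoundaryPoint_iff, ModelWithCorners.range_prod]
  have h1 : range (𝓡 0) = univ := ModelWithCorners.range_eq_univ _
  rw [h1, frontier_prod_univ_eq, frontier_range_modelWithCornersEuclideanHalfSpace]
  constructor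
  · rintro ⟨h, -⟩
    exact h.symm
  · intro h
    exact ⟨h.symm, mem_univ _⟩

section Coordinates

variable {W : Type*} [TopologicalSpace W] [ChartedSpace (HalfModel 0) W]

/-- The first coordinate in the preferred chart at `x`. -/
def coordAt (x w : W) : ℝ := (chartAt (HalfModel 0) x w).1.val 0

theorem coordAt_nonneg (x w : W) : 0 ≤ coordAt x w := (chartAt (HalfModel 0) x w).1.2

/-- The point of the model space with a given coordinate. -/
def modelPoint (r : ℝ) : HalfModel 0 := (halfPoint r, 0)

theorem continuous_modelPoint : Continuous modelPoint :=
  continuous_halfPoint.prodMk continuous_const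

theorem modelPoint_coord (h : HalfModel 0) : modelPoint (h.1.val 0) = h :=
  Prod.ext (halfSpace_ext (halfPoint_val_of_nonneg h.1.2)) (Subsingleton.elim _ _)

theorem coordAt_symm {x : W} {r : ℝ} (hr : 0 ≤ r)
    (ht : modelPoint r ∈ (chartAt (HalfModel 0) x).target) :
    coordAt x ((chartAt (HalfModel 0) x).symm (modelPoint r)) = r := by
  rw [coordAt, (chartAt (HalfModel 0) x).right_inv ht]
  exact halfPoint_val_of_nonneg hr

theorem symm_coordAt {x w : W} (hw : w ∈ (chartAt (HalfModel 0) x).source) :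
    (chartAt (HalfModel 0) x).symm (modelPoint (coordAt x w)) = w := by
  rw [coordAt, modelPoint_coord, (chartAt (HalfModel 0) x).left_inv hw]

theorem coordAt_injOn (x : W) : InjOn (coordAt x) (chartAt (HalfModel 0) x).source := by
  intro w hw w' hw' h
  rw [← symm_coordAt hw, h, symm_coordAt hw']

theorem continuousOn_coordAt (x : W) : ContinuousOn (coordAt x) (chartAt (HalfModel 0) x).source :=
  (continuous_half_val.comp continuous_fst).comp_continuousOn (chartAt (HalfModel 0) x).continuousOn

theorem eventually_modelPoint_mem {x w : W} (hw : w ∈ (chartAt (HalfModel 0) x).source) :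
    ∀ᶠ r in 𝓝 (coordAt x w), modelPoint r ∈ (chartAt (HalfModel 0) x).target := by
  refine continuous_modelPoint.continuousAt.eventually
    ((chartAt (HalfModel 0) x).open_target.mem_nhds ?_)
  rw [coordAt, modelPoint_coord]
  exact (chartAt (HalfModel 0) x).map_source hw

theorem tendsto_symm_modelPoint {x w : W} (hw : w ∈ (chartAt (HalfModel 0) x).source) :
    Tendsto (fun r => (chartAt (HalfModel 0) x).symm (modelPoint r)) (𝓝 (coordAt x w)) (𝓝 w) := by
  have h1 : ContinuousAt (chartAt (HalfModel 0) x).symm (modelPoint (coordAt x w)) := by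
    rw [coordAt, modelPoint_coord]
    exact (chartAt (HalfModel 0) x).continuousAt_symm ((chartAt (HalfModel 0) x).map_source hw)
  have h2 := h1.tendsto.comp (continuous_modelPoint.tendsto (coordAt x w))
  rwa [symm_coordAt hw] at h2

theorem coordAt_right_neBot {x w : W} (hw : w ∈ (chartAt (HalfModel 0) x).source) :
    (𝓝 w ⊓ 𝓟 {w' | coordAt x w < coordAt x w'}).NeBot := by
  refine (Tendsto.neBot (x := 𝓝[>] (coordAt x w))
    (f := fun r => (chartAt (HalfModel 0) x).symm (modelPoint r)) ?_)
  rw [tendsto_inf, tendsto_principal]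
  refine ⟨(tendsto_symm_modelPoint hw).mono_left nhdsWithin_le_nhds, ?_⟩
  filter_upwards [(eventually_modelPoint_mem hw).filter_mono nhdsWithin_le_nhds,
    self_mem_nhdsWithin] with r hr hr'
  have hr' : coordAt x w < r := hr'
  rwa [coordAt_symm ((coordAt_nonneg x w).trans hr'.le) hr]

theorem coordAt_left_neBot {x w : W} (hw : w ∈ (chartAt (HalfModel 0) x).source)
    (h0 : 0 < coordAt x w) : (𝓝 w ⊓ 𝓟 {w' | coordAt x w' < coordAt x w}).NeBot := by
  refine (Tendsto.neBot (x := 𝓝[<] (coordAt x w))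
    (f := fun r => (chartAt (HalfModel 0) x).symm (modelPoint r)) ?_)
  rw [tendsto_inf, tendsto_principal]
  refine ⟨(tendsto_symm_modelPoint hw).mono_left nhdsWithin_le_nhds, ?_⟩
  filter_upwards [(eventually_modelPoint_mem hw).filter_mono nhdsWithin_le_nhds,
    (lt_mem_nhds h0).filter_mono nhdsWithin_le_nhds, self_mem_nhdsWithin] with r hr hr0 hr'
  rwa [coordAt_symm hr0.le hr]

theorem coordAt_left_eq_bot {x w : W} (h0 : coordAt x w = 0) :
    𝓝 w ⊓ 𝓟 {w' | coordAt x w' < coordAt x w} = ⊥ := by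
  have : {w' | coordAt x w' < coordAt x w} = ∅ := by
    ext w'
    simpa [h0] using coordAt_nonneg x w'
  rw [this, principal_empty, inf_bot_eq]

/-- The preferred chart at `x₀` is an order chart if it induces the given filters. -/
theorem nonempty_orderChart {A B : W → Filter W} {x₀ : W}
    (hA : ∀ᶠ x in 𝓝 x₀, A x = 𝓝 x ⊓ 𝓟 {w | coordAt x₀ x < coordAt x₀ w})
    (hB : ∀ᶠ x in 𝓝 x₀, B x = 𝓝 x ⊓ 𝓟 {w | coordAt x₀ w < coordAt x₀ x}) :
    Nonempty (OrderChart A B x₀) := by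
  set e := chartAt (HalfModel 0) x₀ with he
  have hx₀ : x₀ ∈ e.source := mem_chart_source _ x₀
  have hcont : ContinuousAt (coordAt x₀) x₀ :=
    (continuousOn_coordAt x₀).continuousAt (e.open_source.mem_nhds hx₀)
  have hpos : ∀ᶠ x in 𝓝 x₀, 0 < coordAt x₀ x₀ → 0 < coordAt x₀ x := by
    rcases (coordAt_nonneg x₀ x₀).eq_or_lt with h | h
    · exact Eventually.of_forall fun x hx => absurd h hx.ne
    · filter_upwards [hcont.eventually (lt_mem_nhds h)] with x hx _ using hx
  obtain ⟨V, hV, hVo, hxV⟩ := eventually_nhds_iff.1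
    ((hA.and hB).and ((e.open_source.eventually_mem hx₀).and hpos))
  have hVs : V ⊆ e.source := fun x hx => (hV x hx).2.1
  have hO : ∀ᶠ r in 𝓝 (coordAt x₀ x₀), modelPoint r ∈ e.target ∧ e.symm (modelPoint r) ∈ V :=
    (eventually_modelPoint_mem hx₀).and ((tendsto_symm_modelPoint hx₀).eventually (hVo.mem_nhds hxV))
  obtain ⟨δ, hδ, hδO⟩ := Metric.nhds_basis_closedBall.eventually_iff.1 hO
  -- The truncation at 0 keeps the interval inside the half line when `x₀` is on or near the
  -- boundary.
  have hI : ∀ r ∈ Icc (max (coordAt x₀ x₀ - δ) 0) (coordAt x₀ x₀ + δ),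
      0 ≤ r ∧ modelPoint r ∈ e.target ∧ e.symm (modelPoint r) ∈ V := by
    intro r hr
    refine ⟨(le_max_right _ _).trans hr.1, @hδO r ?_⟩
    rw [Real.closedBall_eq_Icc]
    exact ⟨(le_max_left _ _).trans hr.1, hr.2⟩
  -- If `x₀` has coordinate 0, no other point of the chart does, by injectivity; otherwise `V` was
  -- chosen to avoid coordinate 0.
  have hgt : ∀ x ∈ V, x ≠ x₀ → 0 < coordAt x₀ x := by
    intro x hx hne
    rcases (coordAt_nonneg x₀ x₀).eq_or_lt with h | h
    · refine (coordAt_nonneg x₀ x).lt_of_ne fun h' => hne ?_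
      exact coordAt_injOn x₀ (hVs hx) hx₀ (h'.symm.trans h)
    · exact (hV x hx).2.2 h
  refine ⟨{
    v := coordAt x₀
    V := V
    isOpen := hVo
    ψ := fun r => e.symm (modelPoint r)
    c := max (coordAt x₀ x₀ - δ) 0
    d := coordAt x₀ x₀ + δ
    mem_V := hxV
    continuousOn_v := (continuousOn_coordAt x₀).mono hVs
    injOn := (coordAt_injOn x₀).mono hVs
    continuousOn_ψ := e.continuousOn_symm.comp continuous_modelPoint.continuousOn
      fun r hr => (hI r hr).2.1
    mapsTo := fun r hr => (hI r hr).2.2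
    v_ψ := fun r hr => coordAt_symm (hI r hr).1 (hI r hr).2.1
    image_mem := ?_
    right_eq := fun x hx => (hV x hx).1.1
    left_eq := fun x hx => (hV x hx).1.2
    right_neBot := fun x hx _ => by
      rw [(hV x hx).1.1]
      exact coordAt_right_neBot (hVs hx)
    left_neBot := fun x hx hne => by
      rw [(hV x hx).1.2]
      exact coordAt_left_neBot (hVs hx) (hgt x hx hne) }⟩
  filter_upwards [hVo.mem_nhds hxV, hcont.eventually (Metric.closedBall_mem_nhds _ hδ)] with w hw hw'
  have h1 : coordAt x₀ w ∈ Metric.closedBall (coordAt x₀ x₀) δ := hw'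
  rw [Real.closedBall_eq_Icc] at h1
  exact ⟨coordAt x₀ w, ⟨max_le h1.1 (coordAt_nonneg x₀ w), h1.2⟩, symm_coordAt (hVs hw)⟩

variable [IsManifold (halfModel 0) ∞ W] (o : MOrientation (halfModel 0) W)

/-- The filter of neighbourhoods of `x` after `x`. -/
def MOrientation.after (x : W) : Filter W :=
  𝓝 x ⊓ 𝓟 {w | ((o.sign x : ℤ) : ℝ) * coordAt x x < ((o.sign x : ℤ) : ℝ) * coordAt x w}

/-- The filter of neighbourhoods of `x` before `x`. -/
def MOrientation.before (x : W) : Filter W :=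
  𝓝 x ⊓ 𝓟 {w | ((o.sign x : ℤ) : ℝ) * coordAt x w < ((o.sign x : ℤ) : ℝ) * coordAt x x}

theorem nhds_inf_principal_congr {X : Type*} [TopologicalSpace X] {x : X} {s t : Set X}
    (h : ∀ᶠ w in 𝓝 x, w ∈ s ↔ w ∈ t) : 𝓝 x ⊓ 𝓟 s = 𝓝 x ⊓ 𝓟 t := by
  ext u
  rw [mem_inf_principal, mem_inf_principal]
  constructor
  · intro hu
    filter_upwards [h, hu] with w hw hw' hwt using hw' (hw.2 hwt)
  · intro hu
    filter_upwards [h, hu] with w hw hw' hws using hw' (hw.1 hws)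

/-- Coherence says that the coordinate change from `x` to `x₀`, corrected by the two signs, has
positive derivative. So around `x` the signed coordinates of both charts order points in the same
way. -/
theorem MOrientation.eventually_coord (x₀ : W) : ∀ᶠ x in 𝓝 x₀, ∀ᶠ w in 𝓝 x,
    coordAt x w ≠ coordAt x x →
      0 < (((o.sign x : ℤ) : ℝ) * (coordAt x w - coordAt x x)) *
        (((o.sign x₀ : ℤ) : ℝ) * (coordAt x₀ w - coordAt x₀ x)) := by
  have : IsManifold (halfModel 0) 1 W := .of_le (n := ∞) (by simp)
  filter_upwards [o.coherent x₀, extChartAt_source_mem_nhds (I := halfModel 0) x₀] with x hx hxs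
  have hd := hasFDerivWithinAt_tangentCoordChange (I := halfModel 0) (x := x) (y := x₀) (z := x)
    ⟨mem_extChartAt_source x, hxs⟩
  rw [← tangentCoordChange_def] at hx
  set c := LinearMap.det (tangentCoordChange (halfModel 0) x x₀ x : 𝔼¹ × 𝔼⁰ →ₗ[ℝ] 𝔼¹ × 𝔼⁰) with hc
  have hc0 : c ≠ 0 := by
    rintro h0
    rw [h0, mul_zero] at hx
    exact hx.false
  have h1 := eventually_sign hd hc0
  have hT : Tendsto (extChartAt (halfModel 0) x) (𝓝 x)
      (𝓝[range (halfModel 0)] (extChartAt (halfModel 0) x x)) :=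
    tendsto_nhdsWithin_iff.2 ⟨(continuousAt_extChartAt x).tendsto,
      Eventually.of_forall fun w => mem_range_self (chartAt (HalfModel 0) x w)⟩
  filter_upwards [hT.eventually h1, extChartAt_source_mem_nhds (I := halfModel 0) x] with w hw hws hne
  have h2 := hw hne
  simp only [Function.comp_apply] at h2
  rw [(extChartAt (halfModel 0) x).left_inv hws, extChartAt_to_inv] at h2
  have h3 : 0 < c * ((coordAt x₀ w - coordAt x₀ x) * (coordAt x w - coordAt x x)) := h2
  have h4 := mul_pos hx h3
  push_cast at h4
  refine (mul_pos_iff_of_pos_right (mul_self_pos.2 hc0)).1 (h4.trans_eq ?_)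
  ring

/-- The filters at `x` are defined by the preferred chart at `x`, which changes with `x`. Near `x₀`
the single chart at `x₀` computes them all, as an order chart requires. -/
theorem MOrientation.eventually_after (x₀ : W) : ∀ᶠ x in 𝓝 x₀,
    o.after x = 𝓝 x ⊓ 𝓟 {w | ((o.sign x₀ : ℤ) : ℝ) * coordAt x₀ x <
      ((o.sign x₀ : ℤ) : ℝ) * coordAt x₀ w} ∧
    o.before x = 𝓝 x ⊓ 𝓟 {w | ((o.sign x₀ : ℤ) : ℝ) * coordAt x₀ w <
      ((o.sign x₀ : ℤ) : ℝ) * coordAt x₀ x} := by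
  filter_upwards [o.eventually_coord x₀] with x hx
  have key : ∀ᶠ w in 𝓝 x, w = x ∨
      (((o.sign x : ℤ) : ℝ) * coordAt x x < ((o.sign x : ℤ) : ℝ) * coordAt x w ∧
        ((o.sign x₀ : ℤ) : ℝ) * coordAt x₀ x < ((o.sign x₀ : ℤ) : ℝ) * coordAt x₀ w) ∨
      (((o.sign x : ℤ) : ℝ) * coordAt x w < ((o.sign x : ℤ) : ℝ) * coordAt x x ∧
        ((o.sign x₀ : ℤ) : ℝ) * coordAt x₀ w < ((o.sign x₀ : ℤ) : ℝ) * coordAt x₀ x) := by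
    filter_upwards [hx, (chartAt (HalfModel 0) x).open_source.mem_nhds (mem_chart_source _ x)]
      with w hw hws
    by_cases h : coordAt x w = coordAt x x
    · exact Or.inl (coordAt_injOn x hws (mem_chart_source _ x) h)
    · right
      have h1 := hw h
      rw [mul_sub, mul_sub] at h1
      rcases mul_pos_iff.1 h1 with ⟨h2, h3⟩ | ⟨h2, h3⟩
      · exact Or.inl ⟨sub_pos.1 h2, sub_pos.1 h3⟩
      · exact Or.inr ⟨sub_neg.1 h2, sub_neg.1 h3⟩
  constructor
  · refine nhds_inf_principal_congr ?_
    filter_upwards [key] with w hw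
    rcases hw with rfl | ⟨h1, h2⟩ | ⟨h1, h2⟩
    · simp
    · exact ⟨fun _ => h2, fun _ => h1⟩
    · exact ⟨fun h => absurd h h1.not_gt, fun h => absurd h h2.not_gt⟩
  · refine nhds_inf_principal_congr ?_
    filter_upwards [key] with w hw
    rcases hw with rfl | ⟨h1, h2⟩ | ⟨h1, h2⟩
    · simp
    · exact ⟨fun h => absurd h h1.not_gt, fun h => absurd h h2.not_gt⟩
    · exact ⟨fun _ => h2, fun _ => h1⟩

theorem MOrientation.nonempty_orderChart (x₀ : W) :
    Nonempty (OrderChart o.after o.before x₀) := by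
  have h := o.eventually_after x₀
  rcases Int.units_eq_one_or (o.sign x₀) with h0 | h0
  · simp only [h0, Units.val_one, Int.cast_one, one_mul] at h
    exact HigherNielsen.nonempty_orderChart (h.mono fun x hx => hx.1) (h.mono fun x hx => hx.2)
  · simp only [h0, Units.val_neg, Units.val_one, Int.cast_neg, Int.cast_one, neg_mul, one_mul,
      neg_lt_neg_iff] at h
    -- With negative sign the coordinate runs against the orientation, so the two filters trade
    -- places and the chart is reversed afterwards.
    obtain ⟨Φ⟩ := HigherNielsen.nonempty_orderChart (A := o.before) (B := o.after) (x₀ := x₀)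
      (h.mono fun x hx => hx.2) (h.mono fun x hx => hx.1)
    exact ⟨Φ.reverse⟩

/-- The jump at a point of a locally constant function. -/
theorem MOrientation.jump_eq {φ a b : W → ℤ} (hφ : IsLocallyConstant φ)
    (ha : OneSidedLimit o.after φ a) (hb : OneSidedLimit o.before φ b) (x : W) [Decidable (coordAt x x = 0)] :
    a x - b x = if coordAt x x = 0 then (o.sign x : ℤ) * φ x else 0 := by
  have hc : ∀ᶠ w in 𝓝 x, φ w = φ x := hφ.eventually_eq x
  have hxs := mem_chart_source (HalfModel 0) x
  have hA : o.after x ≤ 𝓝 x := inf_le_left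
  have hB : o.before x ≤ 𝓝 x := inf_le_left
  have hR := coordAt_right_neBot hxs
  have ha' : (o.after x).NeBot → a x = φ x := fun _ => ha.eq_of_eventually (hc.filter_mono hA)
  have hb' : (o.before x).NeBot → b x = φ x := fun _ => hb.eq_of_eventually (hc.filter_mono hB)
  rcases Int.units_eq_one_or (o.sign x) with h0 | h0
  · have h1 : o.after x = 𝓝 x ⊓ 𝓟 {w | coordAt x x < coordAt x w} := by
      simp [MOrientation.after, h0]
    have h2 : o.before x = 𝓝 x ⊓ 𝓟 {w | coordAt x w < coordAt x x} := by
      simp [MOrientation.before, h0]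
    -- The side of larger coordinate always exists. The other side is missing exactly at a boundary
    -- point, and the sign tells whether it lies before or after the point.
    rw [ha' (h1 ▸ hR)]
    split_ifs with h
    · rw [(hb x).2 (h2.trans (coordAt_left_eq_bot h)), h0]
      simp
    · rw [hb' (h2 ▸ coordAt_left_neBot hxs ((coordAt_nonneg x x).lt_of_ne' h)), sub_self]
  · have h1 : o.before x = 𝓝 x ⊓ 𝓟 {w | coordAt x x < coordAt x w} := by
      simp [MOrientation.before, h0]
    have h2 : o.after x = 𝓝 x ⊓ 𝓟 {w | coordAt x w < coordAt x x} := by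
      simp [MOrientation.after, h0]
    rw [hb' (h1 ▸ hR)]
    split_ifs with h
    · rw [(ha x).2 (h2.trans (coordAt_left_eq_bot h)), h0]
      simp
    · rw [ha' (h2 ▸ coordAt_left_neBot hxs ((coordAt_nonneg x x).lt_of_ne' h)), sub_self]

end Coordinates

namespace Filling

variable {S : ClosedManifold 0} (V : Filling S)

theorem bdry_injective : Function.Injective V.bdry := by
  intro x y h
  exact congrArg Prod.snd (V.collar_injOn (zero_mem_collarDomain x) (zero_mem_collarDomain y) h)

theorem coordAt_bdry (x : S.M) : coordAt (V.bdry x) (V.bdry x) = 0 := by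
  refine halfModel_isBoundaryPoint_iff.1 ?_
  change V.bdry x ∈ (halfModel 0).boundary V.W
  rw [V.collar_boundary]
  exact ⟨x, rfl⟩

/-- The collar sends coordinate 0 to coordinate 0 and takes values in nonnegative coordinates, so
its derivative there cannot be negative; it is nonzero by `collar_orient`. -/
theorem jac_collar_pos (x : S.M) : 0 < jac (halfModel 0) V.collar (0, x) := by
  have h1 := V.collar_orient (0, x) (zero_mem_collarDomain x)
  set q : EuclideanHalfSpace 1 × S.M := (0, x) with hq
  have hd : MDifferentiableAt (halfModel 0) (halfModel 0) V.collar q :=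
    mdiffAt_of_localDiffeo (V.collar_diffeo ⟨q, zero_mem_collarDomain x⟩)
  set D : 𝔼¹ × 𝔼⁰ →L[ℝ] 𝔼¹ × 𝔼⁰ := mfderiv (halfModel 0) (halfModel 0) V.collar q with hD
  have hj : jac (halfModel 0) V.collar q = LinearMap.det (D : 𝔼¹ × 𝔼⁰ →ₗ[ℝ] 𝔼¹ × 𝔼⁰) := rfl
  rw [hj] at h1 ⊢
  have hc0 : LinearMap.det (D : 𝔼¹ × 𝔼⁰ →ₗ[ℝ] 𝔼¹ × 𝔼⁰) ≠ 0 := by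
    rintro h0
    rw [h0, mul_zero] at h1
    exact h1.false
  set φ := writtenInExtChartAt (halfModel 0) (halfModel 0) q V.collar with hφ
  have hm : HasFDerivWithinAt φ D (range (halfModel 0)) (extChartAt (halfModel 0) q q) :=
    hd.hasMFDerivAt.2
  have h2 := eventually_sign hm hc0
  have h3 : extChartAt (halfModel 0) q q = (halfModel 0) (modelPoint 0) := by
    refine Prod.ext ?_ (Subsingleton.elim (α := 𝔼⁰) _ _)
    change (𝓡∂ 1) 0 = (𝓡∂ 1) (halfPoint 0)
    rw [halfPoint_zero]
  have h6 : (φ (extChartAt (halfModel 0) q q)).1 0 = 0 := by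
    have h7 : φ (extChartAt (halfModel 0) q q) =
        extChartAt (halfModel 0) (V.collar q) (V.collar q) := by
      rw [hφ, writtenInExtChartAt, Function.comp_apply, Function.comp_apply, extChartAt_to_inv]
    rw [h7]
    exact V.coordAt_bdry x
  have hval : ∀ r : ℝ, 0 ≤ r → ((halfModel 0) (modelPoint r)).1 0 = r := fun r hr =>
    halfPoint_val_of_nonneg hr
  rw [h6, h3, hval 0 le_rfl] at h2
  have hT : Tendsto (fun r : ℝ => (halfModel 0) (modelPoint r)) (𝓝[>] 0)
      (𝓝[range (halfModel 0)] ((halfModel 0) (modelPoint 0))) :=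
    tendsto_nhdsWithin_iff.2
      ⟨(((halfModel 0).continuous.comp continuous_modelPoint).tendsto 0).mono_left
        nhdsWithin_le_nhds, Eventually.of_forall fun r => mem_range_self _⟩
  obtain ⟨r, hr, hr0⟩ := ((hT.eventually h2).and self_mem_nhdsWithin).exists
  have hr0 : 0 < r := hr0
  rw [hval r hr0.le] at hr
  have h8 := hr hr0.ne'
  rw [sub_zero, sub_zero] at h8
  have h9 : 0 ≤ (φ ((halfModel 0) (modelPoint r))).1 0 :=
    (chartAt (HalfModel 0) (V.collar q) (V.collar
      ((extChartAt (halfModel 0) q).symm ((halfModel 0) (modelPoint r))))).1.2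
  by_contra hn
  exact absurd h8 (not_lt.2
    (mul_nonpos_of_nonpos_of_nonneg (not_lt.1 hn) (mul_nonneg h9 hr0.le)))

/-- As the Jacobian of the collar is positive, the sign in `collar_orient` is carried entirely by
the two orientations. -/
theorem sign_bdry (x : S.M) : V.orient.sign (V.bdry x) = -S.orient.sign x := by
  have h1 := V.collar_orient (0, x) (zero_mem_collarDomain x)
  have h2 := neg_of_mul_neg_left h1 (V.jac_collar_pos x).le
  have h3 : (((V.orient.sign (V.bdry x) * S.orient.sign x : ℤˣ) : ℤ) : ℝ) < 0 := h2
  rcases Int.units_eq_one_or (V.orient.sign (V.bdry x)) with h | h <;>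
    rcases Int.units_eq_one_or (S.orient.sign x) with h' | h' <;> rw [h, h'] at h3 <;>
    simp [h, h'] at h3 ⊢
  all_goals linarith

/-- The signed number of boundary points of a compact oriented one-dimensional manifold, weighted by
a locally constant function, is zero. -/
theorem sum_sign_bdry {φ : V.W → ℤ} (hφ : IsLocallyConstant φ) :
    ∑ᶠ x : S.M, (S.orient.sign x : ℤ) * φ (V.bdry x) = 0 := by
  classical
  obtain ⟨a, ha⟩ := exists_oneSidedLimit (A := V.orient.after) (g := φ) fun x =>
    ⟨φ x, (hφ.eventually_eq x).filter_mono inf_le_left⟩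
  obtain ⟨b, hb⟩ := exists_oneSidedLimit (A := V.orient.before) (g := φ) fun x =>
    ⟨φ x, (hφ.eventually_eq x).filter_mono inf_le_left⟩
  -- A locally constant function has jumps only at the boundary points, where a side is missing.
  have h0 := sum_jumps_eq_zero V.orient.nonempty_orderChart ha hb
  have h1 : (fun x => a x - b x) = (range V.bdry).indicator
      fun x => (V.orient.sign x : ℤ) * φ x := by
    ext x
    have h3 : coordAt x x = 0 ↔ x ∈ range V.bdry := by
      have h4 : range V.bdry = (halfModel 0).boundary V.W := V.collar_boundary.symm
      rw [h4]
      exact halfModel_isBoundaryPoint_iff.symm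
    rw [V.orient.jump_eq hφ ha hb x, indicator_apply]
    simp only [h3]
  rw [h1, ← finsum_mem_def, finsum_mem_range V.bdry_injective] at h0
  rw [← neg_eq_zero, ← finsum_neg_distrib, ← h0]
  refine finsum_congr fun x => ?_
  rw [V.sign_bdry, Units.val_neg, neg_mul]

end Filling

end OneManifolds

/-! ### Bordism in dimension 0: generation by points. -/

section Points

variable {S T : ClosedManifold 0}

instance (S : ClosedManifold 0) : DiscreteTopology S.M := by
  rw [discreteTopology_iff_isOpen_singleton]
  intro x
  let c := chartAt (EuclideanSpace ℝ (Fin 0)) x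
  have h : {x} = c.source := Subset.antisymm (singleton_subset_iff.2 (mem_chart_source _ x))
    fun y hy => c.injOn hy (mem_chart_source _ x) (Subsingleton.elim _ _)
  rw [h]
  exact c.open_source

instance (S : ClosedManifold 0) : Finite S.M := finite_of_compact_of_discrete

/-- A bijection of closed `0`-manifolds that preserves the signs is an isomorphism. -/
def ChartIso.ofEquiv (e : S.M ≃ T.M) (h : ∀ x, T.orient.sign (e x) = S.orient.sign x) :
    ChartIso S T where
  e := e.toHomeomorphOfDiscrete
  chart x := by
    unfold ChartEq
    rw [nhds_discrete, Filter.eventually_pure]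
    exact ⟨mem_chart_source _ _, Subsingleton.elim _ _⟩
  orient := h

/-- The closed `0`-manifold given by finitely many signed points. -/
def ClosedManifold.ofSigns {ι : Type} [Finite ι] (ε : ι → ℤˣ) : ClosedManifold 0 :=
  letI : TopologicalSpace ι := ⊥
  haveI : DiscreteTopology ι := ⟨rfl⟩
  letI : ChartedSpace (EuclideanSpace ℝ (Fin 0)) ι := ChartedSpace.ofDiscreteTopology
  haveI : IsManifold (𝓡 0) ∞ ι :=
    isManifold_of_contDiffOn _ _ _ fun _ _ _ _ => contDiff_of_subsingleton.contDiffOn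
  { M := ι
    orient :=
      { sign := ε
        coherent := fun x => by
          rw [nhds_discrete, Filter.eventually_pure, LinearMap.det_eq_one_of_subsingleton]
          simp } }

namespace SingularMfd

variable {A : Type*} [TopologicalSpace A]

/-- The singular `0`-manifold given by finitely many signed points. -/
def ofSigns {ι : Type} [Finite ι] (ε : ι → ℤˣ) (a : ι → A) : SingularMfd 0 A where
  dom := ClosedManifold.ofSigns ε
  map := ⟨a, continuous_of_discreteTopology (α := (ClosedManifold.ofSigns ε).M)⟩

/-- A positively oriented point. -/
def point (a : A) : SingularMfd 0 A := ofSigns (ι := Unit) (fun _ => 1) fun _ => a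

theorem bordant_of_equiv {s t : SingularMfd 0 A} (e : t.dom.M ≃ s.dom.M)
    (h : ∀ x, s.dom.orient.sign (e x) = t.dom.orient.sign x) (ha : ∀ x, s.map (e x) = t.map x) :
    Bordant s t :=
  bordant_of_iso (ChartIso.ofEquiv e h) ha

end SingularMfd

namespace Bordism

variable {A : Type*} [TopologicalSpace A]

open SingularMfd

theorem mk_eq_of_equiv {s t : SingularMfd 0 A} (e : t.dom.M ≃ s.dom.M)
    (h : ∀ x, s.dom.orient.sign (e x) = t.dom.orient.sign x) (ha : ∀ x, s.map (e x) = t.map x) :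
    mk s = mk t :=
  Quot.sound (bordant_of_equiv e h ha)

/-- Induction on the number of points: one point is split off, and its class is that of a positive
point or its negative. -/
theorem mk_ofSigns_mem {ι : Type} [Finite ι] : ∀ (ε : ι → ℤˣ) (a : ι → A),
    mk (ofSigns ε a) ∈ AddSubgroup.closure (range fun a : A => mk (point a)) := by
  refine Finite.induction_empty_option (P := fun ι => ∀ [Finite ι] (ε : ι → ℤˣ) (a : ι → A),
    mk (ofSigns ε a) ∈ AddSubgroup.closure (range fun a : A => mk (point a))) ?_ ?_ ?_ ι
  · intro ι κ e h _ ε a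
    have : Finite ι := Finite.of_equiv κ e.symm
    have h1 : mk (ofSigns ε a) = mk (ofSigns (ε ∘ e) (a ∘ e)) :=
      mk_eq_of_equiv (t := ofSigns (ε ∘ e) (a ∘ e)) e (fun _ => rfl) fun _ => rfl
    rw [h1]
    exact h _ _
  · intro _ ε a
    have h1 : mk (ofSigns ε a) = 0 :=
      mk_eq_of_equiv (s := ofSigns ε a) (t := SingularMfd.empty 0 A)
        (Equiv.equivOfIsEmpty Empty PEmpty) (fun x : Empty => x.elim) fun x : Empty => x.elim
    rw [h1]
    exact zero_mem _
  · intro ι _ h _ ε a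
    have h1 : mk (ofSigns ε a) = mk (ofSigns (fun i => ε (some i)) fun i => a (some i)) +
        mk (ofSigns (fun _ : Unit => ε none) fun _ => a none) :=
      mk_eq_of_equiv (t := (ofSigns (fun i => ε (some i)) fun i => a (some i)).sum
        (ofSigns (fun _ : Unit => ε none) fun _ => a none))
        (Equiv.optionEquivSumPUnit ι).symm (by rintro (x | x) <;> rfl) (by rintro (x | x) <;> rfl)
    rw [h1]
    refine add_mem (h _ _) ?_
    rcases Int.units_eq_one_or (ε none) with h2 | h2
    · rw [h2]
      exact AddSubgroup.subset_closure ⟨a none, rfl⟩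
    · have h3 : mk (ofSigns (fun _ : Unit => ε none) fun _ => a none) = - mk (point (a none)) :=
        mk_eq_of_equiv (t := (point (a none)).neg) (Equiv.refl Unit) (fun _ => h2) fun _ => rfl
      rw [h3]
      exact neg_mem (AddSubgroup.subset_closure ⟨a none, rfl⟩)

/-- The bordism group of order `0` is generated by points. -/
theorem closure_points : AddSubgroup.closure (range fun a : A => mk (point a)) = ⊤ := by
  rw [eq_top_iff]
  rintro ⟨s⟩ -
  have h1 : mk s = mk (ofSigns s.dom.orient.sign s.map) :=
    mk_eq_of_equiv (t := ofSigns s.dom.orient.sign s.map) (Equiv.refl s.dom.M) (fun _ => rfl)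
      fun _ => rfl
  change mk s ∈ _
  rw [h1]
  exact mk_ofSigns_mem _ _

theorem mk_point_eq {a b : A} (h : Joined a b) : mk (point a) = mk (point b) := by
  obtain ⟨γ⟩ := h
  let c : C(Icc (0 : ℝ) 2 × (point a).dom.M, A) :=
    -- The cylinder has length 2, so the path is run at half speed.
    ⟨fun w => γ.extend (w.1 / 2), by fun_prop⟩
  refine Quot.sound ⟨Filling.cylinder (point a).dom, c, ?_⟩
  rintro (x | x)
  · have h := cylLeft_fst (point a).dom (q := (0, x)) one_pos
    change γ.extend ((cylLeft (point a).dom (0, x)).1.val / 2) = a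
    rw [h]
    change γ.extend (0 / 2) = a
    rw [zero_div, γ.extend_zero]
  · have h := cylRight_fst (point a).dom (q := (0, x)) one_pos
    change γ.extend ((cylRight (point a).dom (0, x)).1.val / 2) = b
    rw [h]
    change γ.extend ((2 - 0) / 2) = b
    rw [sub_zero, div_self two_ne_zero, γ.extend_one]

end Bordism

/-- Makes path components of the filling open, so that functions constant on them are locally
constant. -/
instance (V : Filling S) : LocallyPathConnectedSpace V.W := by
  have : LocallyPathConnectedSpace (HalfModel 0) :=
    inferInstanceAs (LocallyPathConnectedSpace (EuclideanHalfSpace 1 × EuclideanSpace ℝ (Fin 0)))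
  exact ChartedSpace.locallyPathConnectedSpace (HalfModel 0) V.W

end Points

/-! ### Counting points by path components. -/

section Degree

variable {A : Type*} [TopologicalSpace A]

namespace SingularMfd

/-- The number of points in each path component, counted with signs. -/
def degree (s : SingularMfd 0 A) : ZerothHomotopy A →₀ ℤ :=
  ∑ᶠ x : s.dom.M, Finsupp.single (ZerothHomotopy.mk (s.map x)) (s.dom.orient.sign x : ℤ)

theorem degree_sum (s t : SingularMfd 0 A) : (s.sum t).degree = s.degree + t.degree := by
  have := Fintype.ofFinite s.dom.M
  have := Fintype.ofFinite t.dom.M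
  unfold degree
  change ∑ᶠ x : s.dom.M ⊕ t.dom.M, _ = _
  rw [finsum_eq_sum_of_fintype, finsum_eq_sum_of_fintype, finsum_eq_sum_of_fintype,
    Fintype.sum_sum_type]
  rfl

theorem degree_neg (s : SingularMfd 0 A) : s.neg.degree = -s.degree := by
  unfold degree
  rw [← finsum_neg_distrib]
  refine finsum_congr fun x => ?_
  rw [← Finsupp.single_neg]
  rfl

theorem degree_point (a : A) : (point a).degree = Finsupp.single (ZerothHomotopy.mk a) 1 := by
  unfold degree
  change ∑ᶠ x : Unit, _ = _
  rw [finsum_unique]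
  rfl

/-- The coefficient at a component `n` is the signed count of boundary points weighted by the
indicator of the part of `W` mapped into `n`. This weight is locally constant because `W` is locally
path connected; nothing is needed of `A`. -/
theorem Bounds.degree {s : SingularMfd 0 A} (hs : s.Bounds) : s.degree = 0 := by
  classical
  obtain ⟨V, h, hh⟩ := hs
  ext n
  let φ : V.W → ℤ := fun w => if ZerothHomotopy.mk (h w) = n then 1 else 0
  have hφ : IsLocallyConstant φ := by
    refine (IsLocallyConstant.iff_eventually_eq φ).2 fun w => ?_
    filter_upwards [(IsOpen.pathComponent w).mem_nhds (mem_pathComponent_self w)] with w' hw'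
    have : ZerothHomotopy.mk (h w') = ZerothHomotopy.mk (h w) :=
      Quotient.sound (Joined.map (Joined.symm hw') h.continuous)
    exact congrArg (fun m => if m = n then (1 : ℤ) else 0) this
  have h1 := V.sum_sign_bdry hφ
  have h2 : (Finsupp.applyAddHom n) s.degree = 0 := by
    rw [SingularMfd.degree, AddMonoidHom.map_finsum _ (toFinite _), ← h1]
    refine finsum_congr fun x => ?_
    change (Finsupp.single _ _ : ZerothHomotopy A →₀ ℤ) n = _
    rw [Finsupp.single_apply]
    change _ = _ * (if ZerothHomotopy.mk (h (V.bdry x)) = n then (1 : ℤ) else 0)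
    rw [hh, mul_ite, mul_one, mul_zero]
  exact h2

end SingularMfd

namespace Bordism

open SingularMfd

/-- The homomorphism counting the points in each path component. -/
def degree : Bordism 0 A →+ (ZerothHomotopy A →₀ ℤ) :=
  AddMonoidHom.mk' (Quot.lift SingularMfd.degree fun s t h => by
    have := h.degree
    rwa [degree_sum, degree_neg, add_neg_eq_zero] at this) <| by
  rintro ⟨s⟩ ⟨t⟩
  exact degree_sum s t

@[simp]
theorem degree_mk_point (a : A) :
    degree (mk (point a)) = Finsupp.single (ZerothHomotopy.mk a) 1 := degree_point a

/-- Two homomorphisms on the bordism group of order `0` agree if they agree on points. -/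
theorem hom_ext {G : Type*} [AddGroup G] {φ ψ : Bordism 0 A →+ G}
    (h : ∀ a, φ (mk (point a)) = ψ (mk (point a))) : φ = ψ :=
  AddMonoidHom.eq_of_eqOn_dense closure_points <| by
    rintro _ ⟨a, rfl⟩
    exact h a

/-- The bordism group of order `0` is free on the path components. -/
theorem degree_injective : Function.Injective (degree (A := A)) := by
  -- A left inverse, sending a component to the class of any of its points. Being a left inverse has
  -- to be checked only on points, which generate.
  let inv : (ZerothHomotopy A →₀ ℤ) →+ Bordism 0 A :=
    Finsupp.liftAddHom fun n => (zmultiplesHom _)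
      (ZerothHomotopy.lift (fun a => mk (point a)) (fun _ _ γ => mk_point_eq ⟨γ⟩) n)
  have h : inv.comp degree = AddMonoidHom.id _ := hom_ext fun a => by
    rw [AddMonoidHom.comp_apply, degree_mk_point, Finsupp.liftAddHom_apply_single]
    exact one_zsmul _
  exact Function.LeftInverse.injective (g := inv) (DFunLike.congr_fun h)

end Bordism

end Degree

/-! ### Classical Nielsen classes as path components of the homotopy pullback. -/

section Relation

variable {X Z : Type*} [TopologicalSpace X] [TopologicalSpace Z]

/-- The analogue for paths of the description of Nielsen equivalence: `α`, `β` and the curried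
homotopy are the coordinates of one path between the constant-path points. -/
theorem nielsenRel_iff {f : C(X, Z)} {Y : Set Z} {x y : X} :
    NielsenRel f Y x y ↔ ∃ (hx : f x ∈ Y) (hy : f y ∈ Y),
      Joined (toHPullback f Y ⟨x, hx⟩) (toHPullback f Y ⟨y, hy⟩) := by
  refine exists_congr fun hx => exists_congr fun hy => ⟨?_, ?_⟩
  · rintro ⟨α, β, ⟨H⟩⟩
    let k : C(unitInterval, C(unitInterval, Z)) :=
      (H.toContinuousMap.comp ContinuousMap.prodSwap).curry
    have hk : ∀ t u, k t u = H (u, t) := fun _ _ => rfl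
    refine ⟨⟨⟨fun t => ⟨(α t, β t, k t), H.apply_zero t, H.apply_one t⟩, ?_⟩, ?_, ?_⟩⟩
    · exact Continuous.subtype_mk (by fun_prop) _
    · refine Subtype.ext (Prod.ext α.source (Prod.ext β.source ?_))
      ext u
      exact H.source u
    · refine Subtype.ext (Prod.ext α.target (Prod.ext β.target ?_))
      ext u
      exact H.target u
  · rintro ⟨γ⟩
    refine ⟨γ.map (f := fun e => e.1.1) (by fun_prop), γ.map (f := fun e => e.1.2.1) (by fun_prop),
      ⟨?_⟩⟩
    refine
      { toFun := fun q => (γ q.2).1.2.2 q.1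
        continuous_toFun := by fun_prop
        map_zero_left := fun t => (γ t).2.1
        map_one_left := fun t => (γ t).2.2
        prop' := ?_ }
    rintro u t (rfl | rfl)
    · change (γ 0).1.2.2 u = f (γ 0).1.1
      rw [γ.source]
      rfl
    · change (γ 1).1.2.2 u = f (γ 1).1.1
      rw [γ.target]
      rfl

end Relation

/-! ### Naturality of components and of the Nielsen relation. -/

section Components

variable {X X' Z : Type*} [TopologicalSpace X] [TopologicalSpace X'] [TopologicalSpace Z]

/-- The map of homotopy pullbacks induced by a map over `Z`. -/
def HPullback.map {f : C(X, Z)} {f' : C(X', Z)} (Y : Set Z) (k : C(X, X')) (hk : f'.comp k = f) :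
    C(HPullback f Y, HPullback f' Y) where
  toFun e := ⟨(k e.1.1, e.1.2.1, e.1.2.2), e.2.1.trans (DFunLike.congr_fun hk e.1.1).symm, e.2.2⟩
  continuous_toFun := Continuous.subtype_mk (by fun_prop) _

theorem HPullback.map_toHPullback {f : C(X, Z)} {f' : C(X', Z)} (Y : Set Z) (k : C(X, X'))
    (hk : f'.comp k = f) (x : f ⁻¹' Y) :
    HPullback.map Y k hk (toHPullback f Y x) = toHPullback f' Y (preimageMap Y k hk x) := by
  subst hk
  rfl

/-- The path component of the homotopy pullback that contains a point of the preimage of `Y`. -/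
def component (f : C(X, Z)) (Y : Set Z) (x : f ⁻¹' Y) : ZerothHomotopy (HPullback f Y) :=
  ZerothHomotopy.mk (toHPullback f Y x)

/-- The map of path components of homotopy pullbacks induced by a map over `Z`. -/
def componentMap {f : C(X, Z)} {f' : C(X', Z)} (Y : Set Z) (k : C(X, X')) (hk : f'.comp k = f) :
    ZerothHomotopy (HPullback f Y) → ZerothHomotopy (HPullback f' Y) :=
  ZerothHomotopy.lift (fun e => ZerothHomotopy.mk (HPullback.map Y k hk e)) fun _ _ γ =>
    ZerothHomotopy.sound (γ.map (HPullback.map Y k hk).continuous)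

theorem componentMap_component {f : C(X, Z)} {f' : C(X', Z)} (Y : Set Z) (k : C(X, X'))
    (hk : f'.comp k = f) (x : f ⁻¹' Y) :
    componentMap Y k hk (component f Y x) = component f' Y (preimageMap Y k hk x) :=
  congrArg ZerothHomotopy.mk (HPullback.map_toHPullback Y k hk x)

theorem nielsenRel_iff_component {f : C(X, Z)} {Y : Set Z} {x y : X} :
    NielsenRel f Y x y ↔ ∃ (hx : f x ∈ Y) (hy : f y ∈ Y),
      component f Y ⟨x, hx⟩ = component f Y ⟨y, hy⟩ :=
  nielsenRel_iff.trans (exists_congr fun _ => exists_congr fun _ =>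
    (Quotient.eq (r := pathSetoid _)).symm)

theorem NielsenRel.refl {f : C(X, Z)} {Y : Set Z} {x : X} (hx : f x ∈ Y) : NielsenRel f Y x x :=
  nielsenRel_iff_component.2 ⟨hx, hx, rfl⟩

theorem NielsenRel.symm {f : C(X, Z)} {Y : Set Z} {x y : X} (h : NielsenRel f Y x y) :
    NielsenRel f Y y x := by
  obtain ⟨hx, hy, h⟩ := nielsenRel_iff_component.1 h
  exact nielsenRel_iff_component.2 ⟨hy, hx, h.symm⟩

theorem NielsenRel.trans {f : C(X, Z)} {Y : Set Z} {x y z : X} (h : NielsenRel f Y x y)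
    (h' : NielsenRel f Y y z) : NielsenRel f Y x z := by
  obtain ⟨hx, hy, h⟩ := nielsenRel_iff_component.1 h
  obtain ⟨_, hz, h'⟩ := nielsenRel_iff_component.1 h'
  exact nielsenRel_iff_component.2 ⟨hx, hz, h.trans h'⟩

theorem NielsenRel.map {f : C(X, Z)} {f' : C(X', Z)} {Y : Set Z} {x y : X}
    (h : NielsenRel f Y x y) (k : C(X, X')) (hk : f'.comp k = f) :
    NielsenRel f' Y (k x) (k y) := by
  subst hk
  obtain ⟨hx, hy, h⟩ := nielsenRel_iff_component.1 h
  have h1 := congrArg (componentMap Y k rfl) h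
  rw [componentMap_component, componentMap_component] at h1
  exact nielsenRel_iff_component.2 ⟨hx, hy, h1⟩

/-- Points of a slice that are related with respect to a homotopy are related with respect to the
slice. -/
theorem NielsenRel.of_slice {F : C(unitInterval × X, Z)} {Y : Set Z} {t : unitInterval} {x y : X}
    (h : NielsenRel F Y (t, x) (t, y)) : NielsenRel (slice F t) Y x y := by
  obtain ⟨hx, hy, α, β, h⟩ := h
  refine ⟨hx, hy, α.map continuous_snd, β, Path.Homotopic.trans ⟨?_⟩ h⟩
  -- The time coordinate of `α` is moved on a straight line from `t` to its actual value. Both end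
  -- points of `α` have time `t` and stay fixed. Any `t` is allowed because the relation is needed
  -- at both ends of a homotopy.
  have hc : ∀ u s : unitInterval, (1 - u : ℝ) * t + u * s ∈ Icc (0 : ℝ) 1 := fun u s =>
    convex_Icc (0 : ℝ) 1 t.2 s.2 (sub_nonneg.2 u.2.2) u.2.1 (by ring)
  let c : C(unitInterval × unitInterval, unitInterval) :=
    ⟨fun q => ⟨(1 - q.1 : ℝ) * t + q.1 * q.2, hc q.1 q.2⟩, by fun_prop⟩
  have hc' : ∀ u, c (u, t) = t := fun u =>
    Subtype.ext (by change (1 - u : ℝ) * t + u * t = t; ring)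
  refine
    { toFun := fun q => F (c (q.1, (α q.2).1), (α q.2).2)
      continuous_toFun := by fun_prop
      map_zero_left := fun s => ?_
      map_one_left := fun s => ?_
      prop' := ?_ }
  · have : c (0, (α s).1) = t := Subtype.ext (by simp [c])
    exact congrArg (fun a => F (a, (α s).2)) this
  · have : c (1, (α s).1) = (α s).1 := Subtype.ext (by simp [c])
    exact congrArg (fun a => F (a, (α s).2)) this
  · rintro u s hs
    have h1 : (α s).1 = t := by
      rcases hs with rfl | rfl
      · rw [α.source]
      · rw [α.target]
    change F (c (u, (α s).1), (α s).2) = F (t, (α s).2)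
    rw [h1, hc']

end Components

/-! ### The group S'_0(f, Y) inside the free group on components. -/

namespace PreNielsenGroup

variable {p : ℕ} {X X' Z : Type*} [TopologicalSpace X] [TopologicalSpace X'] [TopologicalSpace Z]

/-- A class in the kernel is represented by one manifold that bounds in the homotopy pullback, so it
is Nielsen equivalent to the empty manifold and is already a generator of the subgroup. -/
theorem nielsenSubgroup_eq_ker (f : C(X, Z)) (Y : Set Z) :
    nielsenSubgroup p f Y = (Bordism.push (p := p) (toHPullback f Y)).ker := by
  refine le_antisymm (nielsenSubgroup_le_ker f Y) ?_
  rintro ⟨s⟩ hs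
  have h0 : Bordism.push (toHPullback f Y) (Bordism.mk (SingularMfd.empty p (f ⁻¹' Y))) = 0 :=
    map_zero (Bordism.push (toHPullback f Y))
  refine AddSubgroup.subset_closure ⟨s, SingularMfd.empty p _, NielsenEquiv.of_bordant
    (Bordism.mk_eq_mk.1 ((AddMonoidHom.mem_ker.1 hs).trans h0.symm)), (sub_zero _).symm⟩

/-- The class of a point. -/
def point {f : C(X, Z)} {Y : Set Z} (x : f ⁻¹' Y) : PreNielsenGroup 0 f Y :=
  QuotientAddGroup.mk (Bordism.mk (SingularMfd.point x))

theorem hom_ext {f : C(X, Z)} {Y : Set Z} {G : Type*} [AddCommGroup G]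
    {φ ψ : PreNielsenGroup 0 f Y →+ G} (h : ∀ x, φ (point x) = ψ (point x)) : φ = ψ :=
  QuotientAddGroup.addMonoidHom_ext _ (Bordism.hom_ext h)

/-- The homomorphism counting the points in each path component of the homotopy pullback. -/
def degree (f : C(X, Z)) (Y : Set Z) :
    PreNielsenGroup 0 f Y →+ (ZerothHomotopy (HPullback f Y) →₀ ℤ) :=
  QuotientAddGroup.lift _ (Bordism.degree.comp (Bordism.push (toHPullback f Y))) fun b hb => by
    rw [AddMonoidHom.mem_ker, AddMonoidHom.comp_apply, nielsenSubgroup_le_ker f Y hb, map_zero]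

theorem degree_point {f : C(X, Z)} {Y : Set Z} (x : f ⁻¹' Y) :
    degree f Y (point x) = Finsupp.single (component f Y x) 1 :=
  Bordism.degree_mk_point (toHPullback f Y x)

theorem degree_injective (f : C(X, Z)) (Y : Set Z) : Function.Injective (degree f Y) := by
  rw [injective_iff_map_eq_zero]
  intro a ha
  obtain ⟨b, rfl⟩ := QuotientAddGroup.mk_surjective a
  rw [QuotientAddGroup.eq_zero_iff, nielsenSubgroup_eq_ker, AddMonoidHom.mem_ker]
  exact Bordism.degree_injective (ha.trans (map_zero _).symm)

theorem map_point {f : C(X, Z)} {f' : C(X', Z)} (Y : Set Z) (k : C(X, X')) (hk : f'.comp k = f)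
    (x : f ⁻¹' Y) : map Y k hk (point x) = point (preimageMap Y k hk x) := rfl

theorem degree_map {f : C(X, Z)} {f' : C(X', Z)} (Y : Set Z) (k : C(X, X')) (hk : f'.comp k = f)
    (a : PreNielsenGroup 0 f Y) :
    degree f' Y (map Y k hk a) = Finsupp.mapDomain (componentMap Y k hk) (degree f Y a) := by
  have : (degree f' Y).comp (map Y k hk) =
      (Finsupp.mapDomain.addMonoidHom (componentMap Y k hk)).comp (degree f Y) :=
    hom_ext fun x => by
      simp only [AddMonoidHom.comp_apply, Finsupp.mapDomain.addMonoidHom_apply, map_point,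
        degree_point, Finsupp.mapDomain_single, componentMap_component]
  exact DFunLike.congr_fun this a

/-- Points generate, and each has its degree at a component met by the preimage of `Y`. Other
components of the homotopy pullback never occur. -/
theorem degree_mem_supported {f : C(X, Z)} {Y : Set Z} (a : PreNielsenGroup 0 f Y) :
    degree f Y a ∈ Finsupp.supported ℤ ℤ (range (component f Y)) := by
  let q := (Finsupp.supported ℤ ℤ (range (component f Y))).mkQ.toAddMonoidHom
  have : q.comp (degree f Y) = 0 := hom_ext fun x => by
    rw [AddMonoidHom.comp_apply, degree_point]
    exact (Submodule.Quotient.mk_eq_zero _).2 (Finsupp.single_mem_supported ℤ 1 ⟨x, rfl⟩)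
  exact (Submodule.Quotient.mk_eq_zero _).1 (DFunLike.congr_fun this a)

end PreNielsenGroup

/-! ### Essential classes and the Nielsen group of order 0. -/

section Essential

variable {X Z : Type*} [TopologicalSpace X] [TopologicalSpace Z]

/-- The point `x` can be traced along every homotopy of `f`. -/
def IsEssentialPoint (f : C(X, Z)) (Y : Set Z) (x : X) : Prop :=
  f x ∈ Y ∧ ∀ F : C(unitInterval × X, Z), slice F 0 = f → ∃ y, NielsenRel F Y (0, x) (1, y)

/-- The class `K` can only be that of `(0, x)`. Its nonempty end sections are automatically full
Nielsen classes, by `NielsenRel.of_slice`, so all that is asked is that `K` reach time 1. -/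
theorem isEssentialClass_iff {f : C(X, Z)} {Y : Set Z} {x : X} (hx : f x ∈ Y) :
    IsEssentialClass f Y {y | NielsenRel f Y x y} ↔ IsEssentialPoint f Y x := by
  refine ⟨fun h => ⟨hx, fun F hF => ?_⟩, fun h => ⟨⟨x, hx, rfl⟩, ?_⟩⟩
  · obtain ⟨K, ⟨k, -, rfl⟩, h0, y, hy, h1⟩ := h.2 F hF
    have h2 : x ∈ {y | NielsenRel f Y x y} := NielsenRel.refl hx
    rw [← h0] at h2
    have h3 : y ∈ {y' | NielsenRel (slice F 1) Y y y'} := NielsenRel.refl hy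
    rw [← h1] at h3
    exact ⟨y, (NielsenRel.symm h2).trans h3⟩
  · rintro F rfl
    obtain ⟨y, hy⟩ := h.2 F rfl
    refine ⟨{z | NielsenRel F Y (0, x) z}, ⟨_, hx, rfl⟩, ?_, y, hy.2.1, ?_⟩
    · ext x'
      exact ⟨fun h' => h'.of_slice, fun h' => h'.map (inclAt X 0) rfl⟩
    · ext y'
      exact ⟨fun h' => (hy.symm.trans h').of_slice, fun h' => hy.trans (h'.map (inclAt X 1) rfl)⟩

/-- The path components of the homotopy pullback that correspond to essential classes. -/
def essentialComponents (f : C(X, Z)) (Y : Set Z) : Set (ZerothHomotopy (HPullback f Y)) :=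
  {n | ∃ x : f ⁻¹' Y, IsEssentialPoint f Y x ∧ component f Y x = n}

theorem nonempty_essentialComponents_equiv (f : C(X, Z)) (Y : Set Z) :
    Nonempty (essentialComponents f Y ≃ {N : Set X // IsEssentialClass f Y N}) := by
  let cls : ZerothHomotopy (HPullback f Y) → Set X :=
    fun n => {y | ∃ hy : f y ∈ Y, component f Y ⟨y, hy⟩ = n}
  have hcls : ∀ x : f ⁻¹' Y, cls (component f Y x) = {y | NielsenRel f Y x y} := by
    intro x
    ext y
    refine Iff.trans ?_ nielsenRel_iff_component.symm
    exact ⟨fun ⟨hy, h⟩ => ⟨x.2, hy, h.symm⟩, fun ⟨_, hy, h⟩ => ⟨hy, h.symm⟩⟩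
  have : BijOn cls (essentialComponents f Y) {N | IsEssentialClass f Y N} := by
    refine ⟨?_, ?_, ?_⟩
    · rintro _ ⟨x, hx, rfl⟩
      rw [hcls]
      exact (isEssentialClass_iff x.2).2 hx
    · rintro _ ⟨x, hx, rfl⟩ n - h
      have h1 : (x : X) ∈ cls (component f Y x) := ⟨x.2, rfl⟩
      rw [h] at h1
      exact h1.2
    · rintro N hN
      obtain ⟨x, hx, rfl⟩ := hN.1
      exact ⟨component f Y ⟨x, hx⟩, ⟨⟨x, hx⟩, (isEssentialClass_iff hx).1 hN, rfl⟩, hcls _⟩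
  exact ⟨this.equiv cls⟩

open PreNielsenGroup

/-- Distinct Nielsen classes of the initial map are not merged by the homotopy. This excludes
cancellation when degrees are pushed forward. -/
theorem componentMap_injOn {F : C(unitInterval × X, Z)} {f : C(X, Z)} (hF : slice F 0 = f)
    (Y : Set Z) :
    InjOn (componentMap (f' := F) Y (inclAt X 0) hF) (range (component f Y)) := by
  subst hF
  rintro _ ⟨x, rfl⟩ _ ⟨y, rfl⟩ h
  have h1 : NielsenRel F Y (0, (x : X)) (0, (y : X)) :=
    nielsenRel_iff_component.2 ⟨x.2, y.2, (componentMap_component Y (inclAt X 0) rfl x).symm.trans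
      (h.trans (componentMap_component Y (inclAt X 0) rfl y))⟩
  obtain ⟨_, _, h2⟩ := nielsenRel_iff_component.1 h1.of_slice
  exact h2

theorem mem_nielsenGroup_iff {f : C(X, Z)} {Y : Set Z} {a : PreNielsenGroup 0 f Y} :
    a ∈ nielsenGroup 0 f Y ↔
      degree f Y a ∈ Finsupp.supported ℤ ℤ (essentialComponents f Y) := by
  classical
  simp only [nielsenGroup, AddSubgroup.mem_iInf, AddSubgroup.mem_comap, AddSubgroup.mem_inf]
  constructor
  · intro h
    rw [Finsupp.mem_supported]
    intro n hn
    obtain ⟨x, rfl⟩ := (Finsupp.mem_supported ℤ _).1 (degree_mem_supported a) hn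
    refine ⟨x, ⟨x.2, fun F hF => ?_⟩, rfl⟩
    obtain ⟨b, hb⟩ := (h F hF).2
    have h1 := (degree_map Y (inclAt X 1) rfl b).symm.trans
      ((congrArg (degree F Y) hb).trans (degree_map Y (inclAt X 0) hF a))
    -- By injectivity on the support, the component of `x` keeps its nonzero coefficient in the
    -- degree over `F`. As the same degree comes from time 1, some component of the final map lands
    -- there.
    have h2 : componentMap (f' := F) Y (inclAt X 0) hF (component f Y x) ∈
        (Finsupp.mapDomain (componentMap (f' := F) Y (inclAt X 0) hF) (degree f Y a)).support := by
      rw [Finsupp.mapDomain_support_of_injOn _ ((componentMap_injOn hF Y).mono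
        ((Finsupp.mem_supported ℤ _).1 (degree_mem_supported a)))]
      exact Finset.mem_image_of_mem _ hn
    rw [← h1] at h2
    obtain ⟨m, hm, hm'⟩ := Finset.mem_image.1 (Finsupp.mapDomain_support h2)
    obtain ⟨y, rfl⟩ := (Finsupp.mem_supported ℤ _).1 (degree_mem_supported b) hm
    exact ⟨y, nielsenRel_iff_component.2 ⟨_, _,
      (componentMap_component Y (inclAt X 0) hF x).symm.trans (hm'.symm.trans (componentMap_component Y (inclAt X 1) rfl y))⟩⟩
  · intro h F hF
    refine ⟨⟨a, rfl⟩, ?_⟩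
    let i₁ : PreNielsenGroup 0 (slice F 1) Y →+ PreNielsenGroup 0 F Y :=
      PreNielsenGroup.map Y (inclAt X 1) rfl
    -- By linearity one essential component suffices, and the point `y` at time 1 to which it can be
    -- traced provides the preimage.
    have h1 : Finsupp.supported ℤ ℤ (essentialComponents f Y) ≤
        (LinearMap.range ((degree F Y).comp i₁).toIntLinearMap).comap
          (Finsupp.lmapDomain ℤ ℤ (componentMap (f' := F) Y (inclAt X 0) hF)) := by
      rw [Finsupp.supported_eq_span_single, Submodule.span_le]
      rintro _ ⟨_, ⟨x, hx, rfl⟩, rfl⟩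
      obtain ⟨y, hy⟩ := hx.2 F hF
      obtain ⟨_, hy', h2⟩ := nielsenRel_iff_component.1 hy
      refine ⟨point ⟨y, hy'⟩, ?_⟩
      change degree F Y (PreNielsenGroup.map Y (inclAt X 1) rfl (point ⟨y, hy'⟩)) =
        Finsupp.mapDomain _ _
      rw [map_point, degree_point, Finsupp.mapDomain_single]
      exact congrArg (fun n => Finsupp.single n 1)
        (h2.symm.trans (componentMap_component Y (inclAt X 0) hF x).symm)
    obtain ⟨b, hb⟩ := h1 h
    exact ⟨b, degree_injective F Y (hb.trans (degree_map Y (inclAt X 0) hF a).symm)⟩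

theorem supported_essentialComponents_le (f : C(X, Z)) (Y : Set Z) :
    Finsupp.supported ℤ ℤ (essentialComponents f Y) ≤
      LinearMap.range (degree f Y).toIntLinearMap := by
  rw [Finsupp.supported_eq_span_single, Submodule.span_le]
  rintro _ ⟨_, ⟨x, -, rfl⟩, rfl⟩
  exact ⟨point x, degree_point x⟩

/-- The Nielsen group of order `0` is free on the essential classes. -/
theorem nonempty_nielsenGroup_equiv (f : C(X, Z)) (Y : Set Z) :
    Nonempty (nielsenGroup 0 f Y ≃ₗ[ℤ] ({N : Set X // IsEssentialClass f Y N} →₀ ℤ)) := by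
  obtain ⟨e⟩ := nonempty_essentialComponents_equiv f Y
  let φ : nielsenGroup 0 f Y →ₗ[ℤ] Finsupp.supported ℤ ℤ (essentialComponents f Y) :=
    ((degree f Y).comp (nielsenGroup 0 f Y).subtype).toIntLinearMap.codRestrict _ fun a =>
      mem_nielsenGroup_iff.1 a.2
  have hφ : Function.Bijective φ := by
    constructor
    · intro a b h
      exact Subtype.ext (degree_injective f Y (congrArg Subtype.val h))
    · rintro ⟨g, hg⟩
      obtain ⟨a, rfl⟩ := supported_essentialComponents_le f Y hg
      exact ⟨⟨a, mem_nielsenGroup_iff.2 hg⟩, rfl⟩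
  exact ⟨(LinearEquiv.ofBijective φ hφ).trans
    ((Finsupp.supportedEquivFinsupp _).trans (Finsupp.domLCongr e))⟩

end Essential

/-- The rank of a free group is the size of its basis. The lift appears because closed manifolds
range over `Type`, which puts the bordism group in the universe `max 1 u`, whereas Nielsen classes
are subsets of `X`. -/
theorem nielsenNumber_zero {X : Type u} {Z : Type v} [TopologicalSpace X] [TopologicalSpace Z]
    (f : C(X, Z)) (Y : Set Z) :
    nielsenNumber 0 f Y = Cardinal.lift.{1, u} (classicalNielsenNumber f Y) := by
  obtain ⟨e⟩ := nonempty_nielsenGroup_equiv f Y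
  have h := e.lift_rank_eq
  rw [rank_finsupp_self] at h
  rw [nielsenNumber, classicalNielsenNumber, ← Cardinal.lift_id'.{u, max 1 u} (Module.rank ℤ _), h,
    Cardinal.lift_lift]
  exact congrFun Cardinal.lift_umax.{u, 1} _

end HigherNielsen

end

theorem mainTheorem3 {X : Type u} {Z : Type v} [TopologicalSpace X] [TopologicalSpace Z]
    (Y : Set Z) (f : C(X, Z)) :
    (∀ (p : ℕ) (g : C(X, Z)), f.Homotopic g →
      HigherNielsen.nielsenNumber p f Y ≤ Module.rank ℤ (HigherNielsen.Bordism p (g ⁻¹' Y))) ∧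
    HigherNielsen.nielsenNumber 0 f Y =
      Cardinal.lift.{1, u} (HigherNielsen.classicalNielsenNumber f Y) :=
  ⟨fun _ _ h => HigherNielsen.nielsenNumber_le_rank Y h, HigherNielsen.nielsenNumber_zero f Y⟩
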